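/- For graphs $G,J$, let $N(G,J)$ be the number of copies of $J$ in $G$, i.e. of (unlabelled) subgraphs of $G$ isomorphic to $J$. For a positive integer $n$ and $p\in[0,1]$, let $\mathbb{E}_pX_J=\mathbb{E}\,N(G_{n,p},J)$, where $G_{n,p}$ is the binomial (Erdős–Rényi) random graph on $n$ vertices with edge probability $p$. For $q\in[0,1]$, a finite graph $H$ is called $q$-sparse (with respect to $n$) if $\mathbb{E}_qX_I\ge 1$ for every subgraph $I$ of $H$. Theorem. There is a constant $L>0$ such that the following holds for every positive integer $n$, all $p,q\in(0,1]$ with $p=Lq$, and every finite $q$-sparse graph $H$. If $F$ is a clique $K_k$ with $2\le k\le n$ or a cycle $C_k$ with $3\le k\le n$, then $$N(H,F)<\mathbb{E}_pX_F.$$ (The constant $L$ does not depend on $n,p,q,H,F$ or $k$; in particular $k$ may depend on $n$.) -/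

import Mathlib

open scoped unitInterval

namespace CopyThreshold

/-- `expectedCopies n p J` is the expected number `E_p X_J` of (unlabelled) copies of `J` in the
binomial random graph `G_{n,p}`. -/
noncomputable def expectedCopies (n : ℕ) (p : I) {U : Type*} (J : SimpleGraph U) : ℝ :=
  ∫ G, (SimpleGraph.copyCount G J : ℝ) ∂(SimpleGraph.binomialRandom (Fin n) p)

/-- `J` is `q`-sparse (with respect to `n`) if `E_q X_I ≥ 1` for every subgraph `I` of `J`. -/
def IsSparse (n : ℕ) (q : I) {U : Type*} (J : SimpleGraph U) : Prop :=
  ∀ A : J.Subgraph, 1 ≤ expectedCopies n q A.coe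

/-- `F` is a clique with `k` vertices. -/
def IsCliqueOfOrder {U : Type*} (F : SimpleGraph U) (k : ℕ) : Prop :=
  Nonempty (F ≃g (SimpleGraph.completeGraph (Fin k)))

/-- `F` is a cycle with `k` vertices. -/
def IsCycleOfOrder {U : Type*} (F : SimpleGraph U) (k : ℕ) : Prop :=
  3 ≤ k ∧ Nonempty (F ≃g SimpleGraph.cycleGraph k)

end CopyThreshold

namespace CopyThreshold

/-! ### Expected number of copies as a count in the complete graph -/

open MeasureTheory ProbabilityTheory

/-! Since E_p X_F = N(K_n,F) (Lq)^e(F), and n^v(F) exceeds N(K_n,F) by at most a factor exponential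
in e(F), it suffices to prove N(H,F) ≤ C^e(F) n^v(F) q^e(F) with an absolute C; a large L then
absorbs every such factor.

Sparsity enters mainly as a counting principle (`IsSparse.one_le_card_mul`): if the copies in K_n of
the subgraph spanned by an edge set E can be decoded from codes, then 1 ≤ #codes · q^|E|. Coding by
vertex maps shows that n^a q^b < 1 forces a|E| ≤ b|V| for all subgraphs (`IsSparse.density`). Coding
by unordered families gains factorials and bounds their size linearly.

If F has k+1 vertices and m edges and ρ = n^k q^m is below c/(k+1)^2, the copies of F cover few
vertices (`IsSparse.exists_cover`). Explore them greedily: a new copy is disjoint from the past,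
hangs on it by one vertex, or meets it in at least two vertices. The first kind number O(nρ) by
coding. The third kind raises the density, by strict balance, so the density bound allows at most m
of them per copy of the first kind. The second kind, coded by roots, tails and pointers, is
controlled by the number of roots. Altogether O((k+1)^2 (1+m) nρ) vertices are covered.

For cliques, bounded density means degeneracy, hence few cliques per vertex. On the small cover this
suffices when cliques are rare. Otherwise a density bound depending on k, or a logarithmic one,
suffices on all of H (`IsSparse.card_cliques_le`).

For cycles, coding a cycle together with all edges touching it bounds the average degree along it by
18nq, so the product of its degrees is at most (18nq)^(k+1). The paths of a random walk have total
probability at most 1, so short products of degrees mean few walks. A cycle is cut, after a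
rotation, into a walk along which the degrees are small and a path with i edges closing it
(`card_cycles_le`). The number of closing paths is bounded because a union of many paths with common
ends would be too dense, and an excess of edges bounds the degrees inside that union
(`IsSparse.card_pathsBetween_le`). The length i is chosen so that (18nq)^i ≤ n < (18nq)^(i+1); when
cycles are rare, i = k is used inside the small cover. -/

/-- The probability that the binomial random graph contains a prescribed set of edges. -/
lemma binomialRandom_real_subset {V : Type*} [Finite V] (p : I) (S : Finset (Sym2 V))
    (hS : ∀ e ∈ S, ¬ e.IsDiag) :
    (SimpleGraph.binomialRandom V p).real {G | (S : Set (Sym2 V)) ⊆ G.edgeSet} =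
      (p : ℝ) ^ S.card := by
  classical
  have himg : (SimpleGraph.edgeSet '' {G : SimpleGraph V | (S : Set (Sym2 V)) ⊆ G.edgeSet}) =
      {s ∈ {s : Set (Sym2 V) | (S : Set (Sym2 V)) ⊆ s} | s ⊆ Sym2.diagSetᶜ} := by
    ext s
    constructor
    · rintro ⟨G, hG, rfl⟩
      exact ⟨hG, SimpleGraph.edgeSet_subset_compl_diagSet G⟩
    · rintro ⟨h1, h2⟩
      have h3 : (SimpleGraph.fromEdgeSet s).edgeSet = s := by
        rw [SimpleGraph.edgeSet_fromEdgeSet]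
        exact sdiff_eq_left.2 (Set.disjoint_left.2 fun e he => h2 he)
      exact ⟨SimpleGraph.fromEdgeSet s, by simpa only [Set.mem_ofPred_eq, h3] using h1, h3⟩
  -- The random edge set almost surely avoids the diagonal, so this condition can be dropped before
  -- the product measure is evaluated.
  rw [measureReal_def, SimpleGraph.binomialRandom_apply', himg,
    ← setBernoulli_apply_eq_apply_subsets, setBernoulli_apply']
  have hpre : ((fun (P : Sym2 V → Prop) => {i | P i}) ⁻¹' {s : Set (Sym2 V) | (S : Set (Sym2 V)) ⊆ s}) =
      Set.pi (S : Set (Sym2 V)) (fun _ => {P : Prop | P}) := by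
    ext P
    simp [Set.subset_def, Set.mem_pi]
  rw [hpre, Measure.infinitePi_pi _ (fun i _ => MeasurableSet.of_discrete)]
  have hfac : ∀ e ∈ S, ((unitInterval.toNNReal p • Measure.dirac (e ∈ (Sym2.diagSetᶜ : Set (Sym2 V))) +
      unitInterval.toNNReal (unitInterval.symm p) • Measure.dirac False : Measure Prop) {P : Prop | P}) =
      (unitInterval.toNNReal p : ENNReal) := by
    intro e he
    have := hS e he
    have h1 : e ∈ (Sym2.diagSetᶜ : Set (Sym2 V)) := this
    simp [h1]
  rw [Finset.prod_congr rfl hfac]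
  simp

/-- A subgraph of `G`, seen as a subgraph of the complete graph. -/
def toTopSubgraph {V : Type*} {G : SimpleGraph V} (A : G.Subgraph) :
    (⊤ : SimpleGraph V).Subgraph where
  verts := A.verts
  Adj := A.Adj
  adj_sub h := A.adj_sub h |>.ne
  edge_vert h := A.edge_vert h
  symm := A.symm

/-- The index set on the right no longer depends on `G`, which is what linearity of expectation
needs. -/
lemma copyCount_eq_sum {V U : Type*} [Fintype V] (G : SimpleGraph V) (J : SimpleGraph U)
    [DecidablePred fun A : (⊤ : SimpleGraph V).Subgraph => Nonempty (J ≃g A.coe)]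
    [Fintype (⊤ : SimpleGraph V).Subgraph] :
    (SimpleGraph.copyCount G J : ℝ) =
      ∑ A : (⊤ : SimpleGraph V).Subgraph with Nonempty (J ≃g A.coe),
        Set.indicator {G : SimpleGraph V | A.edgeSet ⊆ G.edgeSet} (fun _ => (1 : ℝ)) G := by
  classical
  simp only [Set.indicator_apply, Set.mem_ofPred_eq]
  rw [Finset.sum_boole, Finset.filter_filter]
  norm_cast
  unfold SimpleGraph.copyCount
  refine Finset.card_bij (fun A _ => toTopSubgraph A) ?_ ?_ ?_
  · intro A hA
    simp only [Finset.mem_filter, Finset.mem_univ, true_and] at hA ⊢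
    refine ⟨hA, ?_⟩
    exact A.edgeSet_subset
  · intro A _ B _ h
    have h1 := congrArg SimpleGraph.Subgraph.verts h
    have h2 := congrArg SimpleGraph.Subgraph.Adj h
    exact SimpleGraph.Subgraph.ext h1 h2
  · intro B hB
    simp only [Finset.mem_filter, Finset.mem_univ, true_and] at hB
    refine ⟨⟨B.verts, B.Adj, fun {v w} h => ?_, fun h => B.edge_vert h, B.symm⟩, ?_, rfl⟩
    · exact hB.2 (show s(v, w) ∈ B.edgeSet from h)
    · simp only [Finset.mem_filter, Finset.mem_univ, true_and]
      exact hB.1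

lemma ncard_edgeSet_of_iso_coe {V U : Type*} {G : SimpleGraph V} {J : SimpleGraph U}
    {A : G.Subgraph} (e : J ≃g A.coe) : A.edgeSet.ncard = J.edgeSet.ncard := by
  have h1 : A.edgeSet = Sym2.map (Subtype.val) '' A.coe.edgeSet := by
    ext x
    induction x with
    | _ x y =>
      simp only [SimpleGraph.Subgraph.mem_edgeSet, Set.mem_image]
      constructor
      · intro h
        exact ⟨s(⟨x, A.edge_vert h⟩, ⟨y, A.edge_vert h.symm⟩), h, rfl⟩
      · rintro ⟨z, hz, hxy⟩
        induction z with
        | _ a b =>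
          have h : A.Adj a b := hz
          have := (SimpleGraph.Subgraph.mem_edgeSet (G' := A)).2 h
          rw [Sym2.map_mk] at hxy
          rw [← SimpleGraph.Subgraph.mem_edgeSet, ← hxy]
          exact this
  rw [h1, Set.ncard_image_of_injective _ (Sym2.map.injective Subtype.val_injective)]
  exact (Nat.card_congr e.mapEdgeSet).symm

/-- The expected number of copies of `J` is the number of copies in the complete graph times
`p ^ e(J)`. -/
lemma expectedCopies_eq (n : ℕ) (p : I) {U : Type*} (J : SimpleGraph U) :
    expectedCopies n p J =
      (SimpleGraph.copyCount (⊤ : SimpleGraph (Fin n)) J : ℝ) * (p : ℝ) ^ J.edgeSet.ncard := by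
  classical
  have hmeas : ∀ S : Set (SimpleGraph (Fin n)), MeasurableSet S := fun S =>
    SimpleGraph.measurableEmbedding_edgeSet.measurableSet_image.1
      (SimpleGraph.edgeSet '' S).toFinite.measurableSet
  unfold expectedCopies
  simp_rw [copyCount_eq_sum]
  rw [integral_finsetSum]
  · rw [Finset.sum_mul]
    refine Finset.sum_congr rfl fun A hA => ?_
    simp only [Finset.mem_filter, Finset.mem_univ, true_and] at hA
    rw [Set.indicator_of_mem (show (⊤ : SimpleGraph (Fin n)) ∈ _ from A.edgeSet_subset), one_mul]
    rw [integral_indicator_const _ (hmeas _), smul_eq_mul, mul_one]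
    obtain ⟨e⟩ := hA
    have := binomialRandom_real_subset p A.edgeSet.toFinset (V := Fin n) (fun e he => by
      have : e ∈ A.edgeSet := by simpa using he
      exact SimpleGraph.not_isDiag_of_mem_edgeSet _ (A.edgeSet_subset this))
    simp only [Set.coe_toFinset] at this
    rw [this, ← Set.ncard_eq_toFinset_card', ncard_edgeSet_of_iso_coe e]
  · intro A _
    exact (integrable_const (1 : ℝ)).indicator (hmeas _)

/-! ### Sparsity as a lower bound on the number of codes -/

/-- The endpoints of a finite set of edges. -/
noncomputable def endpoints {W : Type*} [Fintype W] (E : Finset (Sym2 W)) : Finset W := by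
  classical exact Finset.univ.filter fun x => ∃ e ∈ E, x ∈ e

lemma mem_endpoints {W : Type*} [Fintype W] {E : Finset (Sym2 W)} {x : W} :
    x ∈ endpoints E ↔ ∃ e ∈ E, x ∈ e := by
  simp [endpoints]

/-- The subgraph spanned by a set of edges. -/
def edgeSubgraph {W : Type*} (H : SimpleGraph W) (E : Finset (Sym2 W))
    (hE : (E : Set (Sym2 W)) ⊆ H.edgeSet) : H.Subgraph where
  verts := {x | ∃ e ∈ E, x ∈ e}
  Adj x y := s(x, y) ∈ E
  adj_sub h := hE h
  edge_vert h := ⟨_, h, by simp⟩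
  symm := ⟨fun x y h => by rwa [Sym2.eq_swap]⟩

/-- If the copies of an edge set in the complete graph can be reconstructed from a finite set of
codes, then sparsity gives a lower bound on the number of codes. -/
lemma IsSparse.one_le_card_mul {W : Type*} [Fintype W] [DecidableEq W] {H : SimpleGraph W} {n : ℕ}
    {q : I} (hs : IsSparse n q H) (hn : 0 < n) (E : Finset (Sym2 W))
    (hE : (E : Set (Sym2 W)) ⊆ H.edgeSet) {Γ : Type*} (codes : Finset Γ)
    (enc : (W → Fin n) → Γ)
    (hmem : ∀ f : W → Fin n, Set.InjOn f (endpoints E) → enc f ∈ codes)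
    (hdec : ∀ f g : W → Fin n, Set.InjOn f (endpoints E) → Set.InjOn g (endpoints E) →
      enc f = enc g → E.image (Sym2.map f) = E.image (Sym2.map g)) :
    1 ≤ (codes.card : ℝ) * (q : ℝ) ^ E.card := by
  classical
  set A := edgeSubgraph H E hE with hA
  have h1 := hs A
  rw [expectedCopies_eq] at h1
  have hedge : A.edgeSet = (E : Set (Sym2 W)) := by
    ext x
    induction x with
    | _ x y => simp [A, edgeSubgraph]
  have hcard : A.coe.edgeSet.ncard = E.card := by
    rw [← ncard_edgeSet_of_iso_coe (SimpleGraph.Iso.refl (G := A.coe)), hedge,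
      Set.ncard_coe_finset]
  rw [hcard] at h1
  refine h1.trans (mul_le_mul_of_nonneg_right ?_ (pow_nonneg q.2.1 _))
  norm_cast
  have : Fintype A.verts := Fintype.ofFinite _
  have : Fintype {f : A.coe →g (⊤ : SimpleGraph (Fin n)) // Function.Injective f} :=
    Fintype.ofFinite _
  rw [SimpleGraph.copyCount_eq_card_image_copyToSubgraph]
  -- The value outside the spanned vertices is a dummy: injectivity and decoding only concern the
  -- endpoints of `E`.
  let ext : A.coe.Copy (⊤ : SimpleGraph (Fin n)) → W → Fin n := fun φ x =>
    if h : x ∈ A.verts then φ ⟨x, h⟩ else ⟨0, hn⟩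
  have hext : ∀ φ (x : A.verts), ext φ x = φ x := fun φ x => by
    simp only [ext, dif_pos x.2]
  have hinj : ∀ φ, Set.InjOn (ext φ) (endpoints E) := by
    intro φ x hx y hy hxy
    have hx' : x ∈ A.verts := mem_endpoints.1 hx
    have hy' : y ∈ A.verts := mem_endpoints.1 hy
    have := (hext φ ⟨x, hx'⟩).symm.trans (hxy.trans (hext φ ⟨y, hy'⟩))
    exact congrArg Subtype.val (φ.injective this)
  have hadj : ∀ φ a b, (SimpleGraph.Copy.toSubgraph φ).Adj a b ↔
      s(a, b) ∈ E.image (Sym2.map (ext φ)) := by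
    intro φ a b
    simp only [Finset.mem_image, SimpleGraph.Subgraph.map_adj, Relation.Map,
      SimpleGraph.Subgraph.top_adj, SimpleGraph.Subgraph.coe_adj]
    constructor
    · rintro ⟨x, y, hxy, rfl, rfl⟩
      exact ⟨s(x.1, y.1), hxy, by simp [hext]⟩
    · rintro ⟨e, he, hab⟩
      induction e with
      | _ x y =>
        have hx : x ∈ A.verts := ⟨_, he, by simp⟩
        have hy : y ∈ A.verts := ⟨_, he, by simp⟩
        rw [Sym2.map_mk, Sym2.eq_iff] at hab
        rcases hab with ⟨h1, h2⟩ | ⟨h1, h2⟩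
        · exact ⟨⟨x, hx⟩, ⟨y, hy⟩, he, (hext φ ⟨x, hx⟩).symm.trans h1,
            (hext φ ⟨y, hy⟩).symm.trans h2⟩
        · exact ⟨⟨y, hy⟩, ⟨x, hx⟩, by rw [Sym2.eq_swap] at he; exact he,
            (hext φ ⟨y, hy⟩).symm.trans h2, (hext φ ⟨x, hx⟩).symm.trans h1⟩
  -- The spanned subgraph has no isolated vertices, so its image is determined by the images of its
  -- edges.
  have hverts : ∀ (φ : A.coe.Copy (⊤ : SimpleGraph (Fin n))) (a : Fin n), a ∈ (SimpleGraph.Copy.toSubgraph φ).verts ↔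
      ∃ b, (SimpleGraph.Copy.toSubgraph φ).Adj a b := by
    intro φ a
    constructor
    · rintro ⟨x, -, rfl⟩
      obtain ⟨e, he, hx⟩ := x.2
      obtain ⟨y, hy⟩ := hx
      rw [hy] at he
      have hy' : y ∈ A.verts := ⟨_, he, by simp⟩
      exact ⟨φ ⟨y, hy'⟩, ⟨x, ⟨y, hy'⟩, he, rfl, rfl⟩⟩
    · rintro ⟨b, hb⟩
      exact SimpleGraph.Subgraph.edge_vert _ hb
  have hex : ∀ B ∈ (Finset.univ : Finset (A.coe.Copy (⊤ : SimpleGraph (Fin n)))).image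
      SimpleGraph.Copy.toSubgraph, ∃ φ : A.coe.Copy (⊤ : SimpleGraph (Fin n)), SimpleGraph.Copy.toSubgraph φ = B := by
    intro B hB
    simpa using hB
  rcases isEmpty_or_nonempty (A.coe.Copy (⊤ : SimpleGraph (Fin n))) with hem | hne
  · simp
  choose! ψ hψ using hex
  refine Finset.card_le_card_of_injOn (fun B => enc (ext (ψ B))) ?_ ?_
  · intro B hB
    exact hmem _ (hinj _)
  · intro B hB C hC hBC
    have himg := hdec _ _ (hinj _) (hinj _) hBC
    rw [← hψ B hB, ← hψ C hC]
    have hA' : (SimpleGraph.Copy.toSubgraph (ψ B)).Adj = (SimpleGraph.Copy.toSubgraph (ψ C)).Adj := by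
      ext a b
      rw [hadj, hadj, himg]
    refine SimpleGraph.Subgraph.ext ?_ hA'
    ext a
    rw [hverts, hverts, hA']

/-- Labelled version of sparsity. -/
lemma IsSparse.one_le_pow_mul {W : Type*} [Fintype W] {H : SimpleGraph W} {n : ℕ}
    {q : I} (hs : IsSparse n q H) (hn : 0 < n) (E : Finset (Sym2 W))
    (hE : (E : Set (Sym2 W)) ⊆ H.edgeSet) :
    1 ≤ (n : ℝ) ^ (endpoints E).card * (q : ℝ) ^ E.card := by
  classical
  have := hs.one_le_card_mul hn E hE (Finset.univ : Finset (endpoints E → Fin n))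
    (fun f x => f x) (fun _ _ => Finset.mem_univ _) (fun f g _ _ hfg => by
      refine Finset.image_congr fun e he => Sym2.map_congr fun x hx => ?_
      exact congrFun hfg ⟨x, mem_endpoints.2 ⟨e, he, hx⟩⟩)
  simpa using this

/-- If `n ^ a * q ^ b < 1` then the edge density of every subgraph is at most `b / a`. -/
lemma IsSparse.density {W : Type*} [Fintype W] {H : SimpleGraph W} {n : ℕ}
    {q : I} (hs : IsSparse n q H) (hn : 0 < n) {a b : ℕ}
    (hab : (n : ℝ) ^ a * (q : ℝ) ^ b < 1) (E : Finset (Sym2 W))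
    (hE : (E : Set (Sym2 W)) ⊆ H.edgeSet) : a * E.card ≤ b * (endpoints E).card := by
  by_contra! hlt
  have h1 := hs.one_le_pow_mul hn E hE
  set v := (endpoints E).card with hv
  have hv0 : v ≠ 0 := by
    intro h0
    have : endpoints E = ∅ := Finset.card_eq_zero.1 (by omega)
    have hE0 : E ≠ ∅ := by
      rintro rfl
      simp at hlt
    obtain ⟨e, he⟩ := Finset.nonempty_iff_ne_empty.2 hE0
    induction e with
    | _ x y =>
      have : x ∈ endpoints E := mem_endpoints.2 ⟨_, he, by simp⟩
      simp_all
  -- The a-th power of the sparsity inequality is compared with the v-th power of the hypothesis;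
  -- since q ≤ 1, too many edges would make it less than 1.
  have h2 : (1 : ℝ) ≤ ((n : ℝ) ^ v * (q : ℝ) ^ E.card) ^ a := one_le_pow₀ h1
  have h3 : ((n : ℝ) ^ v * (q : ℝ) ^ E.card) ^ a ≤ ((n : ℝ) ^ a * (q : ℝ) ^ b) ^ v := by
    rw [mul_pow, mul_pow, ← pow_mul, ← pow_mul, ← pow_mul, ← pow_mul, mul_comm v a]
    refine mul_le_mul_of_nonneg_left ?_ (by positivity)
    refine pow_le_pow_of_le_one q.2.1 q.2.2 ?_
    rw [mul_comm E.card a]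
    exact hlt.le
  have h4 : ((n : ℝ) ^ a * (q : ℝ) ^ b) ^ v < 1 :=
    pow_lt_one₀ (mul_nonneg (by positivity) (pow_nonneg q.2.1 _)) hab hv0
  linarith

/-! ### Greedy exploration of the copies of a balanced graph -/

section Exploration

variable {W : Type*}

/-- `c` maps the graph `F` injectively and homomorphically into `H`. -/
def IsCopyMap {X : Type*} (F : SimpleGraph X) (H : SimpleGraph W) (c : X → W) : Prop :=
  Function.Injective c ∧ ∀ x y, F.Adj x y → H.Adj (c x) (c y)

lemma IsCopyMap.comp_iso {X : Type*} {F : SimpleGraph X} {H : SimpleGraph W} {c : X → W}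
    (hc : IsCopyMap F H c) (g : F ≃g F) : IsCopyMap F H (c ∘ g) :=
  ⟨hc.1.comp g.injective, fun _ _ h => hc.2 _ _ (g.map_adj_iff.2 h)⟩

variable [DecidableEq W] {k : ℕ}

/-- The image of the edges of `F` under the map `c`. -/
noncomputable def blockEdges {X : Type*} [Fintype X] (F : SimpleGraph X) (c : X → W) :
    Finset (Sym2 W) := by
  classical exact F.edgeFinset.image (Sym2.map c)

/-- The edges of `F` meeting the vertex set `A`. -/
noncomputable def edgesMeeting {X : Type*} [Fintype X] (F : SimpleGraph X) (A : Finset X) :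
    Finset (Sym2 X) := by
  classical exact F.edgeFinset.filter fun e => ∃ x ∈ A, x ∈ e

lemma mem_blockEdges {X : Type*} [Fintype X] {F : SimpleGraph X} {c : X → W} {e : Sym2 W} :
    e ∈ blockEdges F c ↔ ∃ e' ∈ F.edgeSet, Sym2.map c e' = e := by
  simp [blockEdges]

lemma mem_edgesMeeting {X : Type*} [Fintype X] {F : SimpleGraph X} {A : Finset X} {e : Sym2 X} :
    e ∈ edgesMeeting F A ↔ e ∈ F.edgeSet ∧ ∃ x ∈ A, x ∈ e := by
  simp [edgesMeeting]

lemma card_blockEdges {X : Type*} [Fintype X] {F : SimpleGraph X} {c : X → W}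
    (hc : Function.Injective c) : (blockEdges F c).card = F.edgeSet.ncard := by
  classical
  unfold blockEdges
  rw [Finset.card_image_of_injective _ (Sym2.map.injective hc), Set.ncard_eq_toFinset_card']
  congr

lemma blockEdges_subset {X : Type*} [Fintype X] {F : SimpleGraph X} {H : SimpleGraph W}
    {c : X → W} (hc : IsCopyMap F H c) : (blockEdges F c : Set (Sym2 W)) ⊆ H.edgeSet := by
  intro e he
  obtain ⟨e', he', rfl⟩ := mem_blockEdges.1 (Finset.mem_coe.1 he)
  induction e' with
  | _ x y => exact hc.2 x y he'

lemma blockEdges_comp_iso {X : Type*} [Fintype X] {F : SimpleGraph X} (g : F ≃g F) (c : X → W) :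
    blockEdges F (c ∘ g) = blockEdges F c := by
  ext e
  simp only [mem_blockEdges]
  constructor
  · rintro ⟨e', he', rfl⟩
    refine ⟨Sym2.map g e', ?_, by rw [Sym2.map_map]⟩
    induction e' with
    | _ x y => exact g.map_adj_iff.2 he'
  · rintro ⟨e', he', rfl⟩
    refine ⟨Sym2.map g.symm e', ?_, ?_⟩
    · induction e' with
      | _ x y => exact g.symm.map_adj_iff.2 he'
    · rw [Sym2.map_map]
      congr 1
      ext x
      simp

/-- A graph on `k + 1` vertices without isolated vertices that is vertex transitive and
strictly balanced. -/
structure IsBalanced (F : SimpleGraph (Fin (k + 1))) : Prop where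
  exists_adj : ∀ x, ∃ y, F.Adj x y
  transitive : ∀ x, ∃ g : F ≃g F, g 0 = x
  balanced : ∀ A : Finset (Fin (k + 1)), A.Nonempty → A.card + 2 ≤ k + 1 →
    F.edgeSet.ncard * A.card + 1 ≤ k * (edgesMeeting F A).card

lemma card_union_image (U : Finset W) {c : Fin (k + 1) → W} (hc : Function.Injective c) :
    (U ∪ Finset.univ.image c).card = U.card + (Finset.univ.filter fun x => c x ∉ U).card := by
  classical
  have : U ∪ Finset.univ.image c = U ∪ (Finset.univ.filter fun x => c x ∉ U).image c := by
    ext v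
    simp only [Finset.mem_union, Finset.mem_image, Finset.mem_univ, true_and, Finset.mem_filter]
    constructor
    · rintro (h | ⟨x, rfl⟩)
      · exact Or.inl h
      · by_cases hx : c x ∈ U
        · exact Or.inl hx
        · exact Or.inr ⟨x, hx, rfl⟩
    · rintro (h | ⟨x, -, rfl⟩)
      · exact Or.inl h
      · exact Or.inr ⟨x, rfl⟩
  rw [this, Finset.card_union_of_disjoint, Finset.card_image_of_injective _ hc]
  rw [Finset.disjoint_right]
  intro v hv
  obtain ⟨x, hx, rfl⟩ := Finset.mem_image.1 hv
  exact (Finset.mem_filter.1 hx).2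

variable [Fintype W]

/-- A record of a greedy exploration of the copies of `F` in `H`: `base` lists the copies that were
disjoint from the previously explored set, `pendant` those that met it in a single vertex (their
image of `0`), and `steps` counts the remaining ones, whose vertices are collected in `rest`. -/
structure Exploration (F : SimpleGraph (Fin (k + 1))) (H : SimpleGraph W) where
  verts : Finset W
  edges : Finset (Sym2 W)
  base : Finset (Fin (k + 1) → W)
  pendant : Finset (Fin (k + 1) → W)
  rest : Finset W
  steps : ℕ
  edges_subset : (edges : Set (Sym2 W)) ⊆ H.edgeSet
  endpoints_subset : endpoints edges ⊆ verts
  budget : F.edgeSet.ncard * verts.card + steps ≤ k * edges.card + F.edgeSet.ncard * base.card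
  base_copy : ∀ c ∈ base, IsCopyMap F H c ∧ blockEdges F c ⊆ edges ∧ ∀ x, c x ∈ verts
  pendant_copy : ∀ c ∈ pendant, IsCopyMap F H c ∧ blockEdges F c ⊆ edges ∧ ∀ x, c x ∈ verts
  base_card : F.edgeSet.ncard * base.card ≤ (base.biUnion (blockEdges F)).card
  pendant_card : F.edgeSet.ncard * pendant.card ≤ (pendant.biUnion (blockEdges F)).card
  tail_inj : ∀ c ∈ pendant, ∀ c' ∈ pendant, Fin.tail c = Fin.tail c' → c = c'
  rest_card : rest.card ≤ (k + 1) * steps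
  mem_verts : ∀ v ∈ verts, (∃ c ∈ base, ∃ x, c x = v) ∨ v ∈ rest ∨ ∃ c ∈ pendant, ∃ x, Fin.tail c x = v

/-- The edges of the copy `c` that meet the complement of `U`. -/
noncomputable def newEdges (F : SimpleGraph (Fin (k + 1))) (U : Finset W) (c : Fin (k + 1) → W) :
    Finset (Sym2 W) := by
  classical exact (blockEdges F c).filter fun e => ∃ v ∈ e, v ∉ U

lemma card_newEdges {F : SimpleGraph (Fin (k + 1))} {U : Finset W} {c : Fin (k + 1) → W}
    (hc : Function.Injective c) :
    (newEdges F U c).card = (edgesMeeting F (Finset.univ.filter fun x => c x ∉ U)).card := by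
  classical
  rw [← Finset.card_image_of_injective (edgesMeeting F _) (Sym2.map.injective hc)]
  congr 1
  ext e
  simp only [newEdges, Finset.mem_filter, mem_blockEdges, Finset.mem_image, mem_edgesMeeting,
    Finset.mem_univ, true_and]
  constructor
  · rintro ⟨⟨e', he', rfl⟩, v, hv, hvU⟩
    obtain ⟨x, hx, rfl⟩ := Sym2.mem_map.1 hv
    exact ⟨e', ⟨he', x, hvU, hx⟩, rfl⟩
  · rintro ⟨e', ⟨he', x, hxU, hx⟩, rfl⟩
    exact ⟨⟨e', he', rfl⟩, c x, Sym2.mem_map.2 ⟨x, hx, rfl⟩, hxU⟩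

lemma newEdges_subset {F : SimpleGraph (Fin (k + 1))} {U : Finset W} {c : Fin (k + 1) → W} :
    newEdges F U c ⊆ blockEdges F c := by
  classical exact Finset.filter_subset _ _

lemma disjoint_newEdges {F : SimpleGraph (Fin (k + 1))} {U : Finset W} {c : Fin (k + 1) → W}
    {E : Finset (Sym2 W)} (hE : endpoints E ⊆ U) : Disjoint E (newEdges F U c) := by
  classical
  rw [Finset.disjoint_left]
  intro e he he'
  simp only [newEdges, Finset.mem_filter] at he'
  obtain ⟨-, v, hv, hvU⟩ := he'
  exact hvU (hE (mem_endpoints.2 ⟨e, he, hv⟩))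

/-- At most one vertex of the copy is old, so no edge has both ends old. This covers both the
disjoint and the pendant copies, whose edges are thus all new. -/
lemma newEdges_eq_of_card {F : SimpleGraph (Fin (k + 1))} {U : Finset W} {c : Fin (k + 1) → W}
    (hA : k ≤ (Finset.univ.filter fun x => c x ∉ U).card) : newEdges F U c = blockEdges F c := by
  classical
  unfold newEdges
  rw [Finset.filter_eq_self]
  intro e he
  obtain ⟨e', he', rfl⟩ := mem_blockEdges.1 he
  by_contra! hno
  induction e' with
  | _ x y =>
    have hxy : x ≠ y := F.ne_of_adj he'
    have hx : c x ∈ U := hno _ (by simp)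
    have hy : c y ∈ U := hno _ (by simp)
    have hsub : (Finset.univ.filter fun x => c x ∉ U) ⊆ Finset.univ \ {x, y} := by
      intro z hz
      simp only [Finset.mem_filter, Finset.mem_univ, true_and] at hz
      simp only [Finset.mem_sdiff, Finset.mem_univ, Finset.mem_insert, Finset.mem_singleton,
        true_and, not_or]
      exact ⟨fun h => hz (h ▸ hx), fun h => hz (h ▸ hy)⟩
    have h1 := Finset.card_le_card hsub
    rw [Finset.card_sdiff_of_subset (Finset.subset_univ _), Finset.card_pair hxy, Finset.card_univ,
      Fintype.card_fin] at h1
    have h2 : 2 ≤ k + 1 := by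
      have := Finset.card_le_univ ({x, y} : Finset (Fin (k + 1)))
      rwa [Finset.card_pair hxy, Fintype.card_fin] at this
    omega

lemma endpoints_union_newEdges {F : SimpleGraph (Fin (k + 1))} {U : Finset W}
    {c : Fin (k + 1) → W} {E : Finset (Sym2 W)} (hE : endpoints E ⊆ U) :
    endpoints (E ∪ newEdges F U c) ⊆ U ∪ Finset.univ.image c := by
  intro v hv
  obtain ⟨e, he, hve⟩ := mem_endpoints.1 hv
  rcases Finset.mem_union.1 he with h | h
  · exact Finset.mem_union_left _ (hE (mem_endpoints.2 ⟨e, h, hve⟩))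
  · obtain ⟨e', he', rfl⟩ := mem_blockEdges.1 (newEdges_subset h)
    obtain ⟨x, -, rfl⟩ := Sym2.mem_map.1 hve
    exact Finset.mem_union_right _ (Finset.mem_image_of_mem _ (Finset.mem_univ _))

/-- An exploration that misses a vertex of a copy can be extended. -/
lemma Exploration.exists_extend {F : SimpleGraph (Fin (k + 1))} {H : SimpleGraph W}
    (hF : IsBalanced F) (S : Exploration F H) {c : Fin (k + 1) → W} (hc : IsCopyMap F H c)
    (hnew : ∃ x, c x ∉ S.verts) : ∃ T : Exploration F H, S.verts.card < T.verts.card := by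
  classical
  set U := S.verts with hU
  set A := Finset.univ.filter fun x => c x ∉ U with hA
  have hApos : 0 < A.card := by
    obtain ⟨x, hx⟩ := hnew
    exact Finset.card_pos.2 ⟨x, by simp [hA, hx]⟩
  have hAle : A.card ≤ k + 1 := by
    simpa using Finset.card_le_univ A
  have hverts : (U ∪ Finset.univ.image c).card = U.card + A.card := card_union_image U hc.1
  have hNcard : (newEdges F U c).card = (edgesMeeting F A).card := card_newEdges hc.1
  have hdisj := disjoint_newEdges (F := F) (c := c) S.endpoints_subset
  have hedges : (S.edges ∪ newEdges F U c).card = S.edges.card + (newEdges F U c).card :=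
    Finset.card_union_of_disjoint hdisj
  have hsubset : ((S.edges ∪ newEdges F U c : Finset (Sym2 W)) : Set (Sym2 W)) ⊆ H.edgeSet := by
    rw [Finset.coe_union]
    exact Set.union_subset S.edges_subset
      ((Finset.coe_subset.2 newEdges_subset).trans (blockEdges_subset hc))
  have hbudget := S.budget
  have hold : ∀ d : Fin (k + 1) → W, (IsCopyMap F H d ∧ blockEdges F d ⊆ S.edges ∧ ∀ x, d x ∈ U) →
      (IsCopyMap F H d ∧ blockEdges F d ⊆ S.edges ∪ newEdges F U c ∧
        ∀ x, d x ∈ U ∪ Finset.univ.image c) := fun d hd =>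
    ⟨hd.1, hd.2.1.trans Finset.subset_union_left, fun x => Finset.mem_union_left _ (hd.2.2 x)⟩
  have hlt : U.card < (U ∪ Finset.univ.image c).card := by omega
  have hblock : ∀ (D : Finset (Fin (k + 1) → W)) (d : Fin (k + 1) → W), Function.Injective d →
      (∀ d ∈ D, IsCopyMap F H d ∧ blockEdges F d ⊆ S.edges ∧ ∀ x, d x ∈ U) →
      blockEdges F d = newEdges F U c → F.edgeSet.ncard * D.card ≤ (D.biUnion (blockEdges F)).card →
      F.edgeSet.ncard * (insert d D).card ≤ ((insert d D).biUnion (blockEdges F)).card := by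
    intro D d hd hD hdN hcard
    rw [Finset.biUnion_insert, Finset.card_union_of_disjoint, card_blockEdges hd]
    · have := Nat.mul_le_mul_left F.edgeSet.ncard (Finset.card_insert_le d D)
      rw [mul_add, mul_one] at this
      omega
    · rw [hdN]
      refine (Finset.disjoint_of_subset_left ?_ hdisj).symm
      exact Finset.biUnion_subset.2 fun d hd => (hD d hd).2.1
  -- With m the number of edges of `F`, the quantity m|V| − k|E| grows by exactly m for a disjoint
  -- copy, is unchanged for a pendant one, and drops by at least 1 otherwise. This is what `budget`
  -- records.
  rcases (by omega : A.card = k + 1 ∨ A.card = k ∧ A.card ≠ k + 1 ∨ A.card + 2 ≤ k + 1) with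
    hfull | ⟨hpend, -⟩ | hirr
  · -- the copy is disjoint from the explored set
    have hNeq : newEdges F U c = blockEdges F c := newEdges_eq_of_card (show k ≤ A.card by omega)
    have hNc : (newEdges F U c).card = F.edgeSet.ncard := by rw [hNeq, card_blockEdges hc.1]
    have hcB : c ∉ S.base := fun h => by
      obtain ⟨x, hx⟩ := hnew
      exact hx ((S.base_copy c h).2.2 x)
    refine ⟨⟨U ∪ Finset.univ.image c, S.edges ∪ newEdges F U c, insert c S.base, S.pendant, S.rest,
      S.steps, hsubset, endpoints_union_newEdges S.endpoints_subset, ?_, ?_, ?_, ?_,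
      S.pendant_card, S.tail_inj, S.rest_card, ?_⟩, hlt⟩
    · rw [hverts, hedges, hNc, Finset.card_insert_of_notMem hcB, hfull]
      nlinarith
    · intro d hd
      rcases Finset.mem_insert.1 hd with rfl | hd
      · exact ⟨hc, hNeq ▸ Finset.subset_union_right, fun x =>
          Finset.mem_union_right _ (Finset.mem_image_of_mem _ (Finset.mem_univ _))⟩
      · exact hold d (S.base_copy d hd)
    · exact fun d hd => hold d (S.pendant_copy d hd)
    · exact hblock _ _ hc.1 S.base_copy hNeq.symm S.base_card
    · intro v hv
      rcases Finset.mem_union.1 hv with hv | hv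
      · rcases S.mem_verts v hv with ⟨d, hd, h⟩ | h
        · exact Or.inl ⟨d, Finset.mem_insert_of_mem hd, h⟩
        · exact Or.inr h
      · obtain ⟨x, -, rfl⟩ := Finset.mem_image.1 hv
        exact Or.inl ⟨c, Finset.mem_insert_self _ _, x, rfl⟩
  · -- the copy is attached by a single vertex
    have hNeq : newEdges F U c = blockEdges F c := newEdges_eq_of_card (show k ≤ A.card by omega)
    have hNc : (newEdges F U c).card = F.edgeSet.ncard := by rw [hNeq, card_blockEdges hc.1]
    obtain ⟨x₀, hx₀⟩ : ∃ x₀, Aᶜ = {x₀} := by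
      refine Finset.card_eq_one.1 ?_
      rw [Finset.card_compl, Fintype.card_fin]
      omega
    have hmemA : ∀ x, x ≠ x₀ → c x ∉ U := by
      intro x hx
      have : x ∉ Aᶜ := by rw [hx₀]; simpa using hx
      simpa [hA] using this
    have hx₀U : c x₀ ∈ U := by
      have : x₀ ∈ Aᶜ := by rw [hx₀]; simp
      simpa [hA] using this
    obtain ⟨g, hg⟩ := hF.transitive x₀
    set d := c ∘ g with hd
    have hdc : IsCopyMap F H d := hc.comp_iso g
    have hdN : blockEdges F d = newEdges F U c := by rw [hNeq, hd, blockEdges_comp_iso]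
    have hd0 : d 0 ∈ U := by simpa [hd, hg] using hx₀U
    have hdtail : ∀ x, Fin.tail d x ∉ U := by
      intro x
      refine hmemA _ fun h => ?_
      exact Fin.succ_ne_zero x (g.injective (h.trans hg.symm))
    refine ⟨⟨U ∪ Finset.univ.image c, S.edges ∪ newEdges F U c, S.base, insert d S.pendant, S.rest,
      S.steps, hsubset, endpoints_union_newEdges S.endpoints_subset, ?_, ?_, ?_, S.base_card,
      ?_, ?_, S.rest_card, ?_⟩, hlt⟩
    · rw [hverts, hedges, hNc, hpend]
      nlinarith
    · exact fun e he => hold e (S.base_copy e he)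
    · intro e he
      rcases Finset.mem_insert.1 he with rfl | he
      · exact ⟨hdc, hdN ▸ Finset.subset_union_right, fun x =>
          Finset.mem_union_right _ (Finset.mem_image_of_mem _ (Finset.mem_univ _))⟩
      · exact hold e (S.pendant_copy e he)
    · exact hblock _ _ hdc.1 S.pendant_copy hdN S.pendant_card
    · have hk : 0 < k := by omega
      have hne : ∀ e ∈ S.pendant, Fin.tail d ≠ Fin.tail e := by
        intro e he h
        have := (S.pendant_copy e he).2.2 (Fin.succ ⟨0, hk⟩)
        exact hdtail ⟨0, hk⟩ (by rw [h]; exact this)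
      intro e he e' he' hee'
      rcases Finset.mem_insert.1 he with rfl | he1 <;> rcases Finset.mem_insert.1 he' with rfl | he2
      · rfl
      · exact absurd hee' (hne _ he2)
      · exact absurd hee'.symm (hne _ he1)
      · exact S.tail_inj _ he1 _ he2 hee'
    · intro v hv
      have hold' : v ∈ U → (∃ c ∈ S.base, ∃ x, c x = v) ∨ v ∈ S.rest ∨
          ∃ c ∈ insert d S.pendant, ∃ x, Fin.tail c x = v := by
        intro hv
        rcases S.mem_verts v hv with h | h | ⟨e, he, h⟩
        · exact Or.inl h
        · exact Or.inr (Or.inl h)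
        · exact Or.inr (Or.inr ⟨e, Finset.mem_insert_of_mem he, h⟩)
      rcases Finset.mem_union.1 hv with hv | hv
      · exact hold' hv
      · obtain ⟨x, -, rfl⟩ := Finset.mem_image.1 hv
        by_cases hx : x = x₀
        · exact hold' (hx ▸ hx₀U)
        · refine Or.inr (Or.inr ⟨d, Finset.mem_insert_self _ _, ?_⟩)
          have h0 : g.symm x ≠ 0 := fun h => hx (by rw [← hg, ← h]; simp)
          obtain ⟨y, hy⟩ := Fin.exists_succ_eq.2 h0
          exact ⟨y, by simp [Fin.tail, hd, hy]⟩
  · -- the copy meets the explored set in at least two vertices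
    have hbal := hF.balanced A (Finset.card_pos.1 hApos) hirr
    refine ⟨⟨U ∪ Finset.univ.image c, S.edges ∪ newEdges F U c, S.base, S.pendant,
      S.rest ∪ Finset.univ.image c, S.steps + 1, hsubset,
      endpoints_union_newEdges S.endpoints_subset, ?_, ?_, ?_, S.base_card,
      S.pendant_card, S.tail_inj, ?_, ?_⟩, hlt⟩
    · rw [hverts, hedges, hNcard]
      nlinarith
    · exact fun e he => hold e (S.base_copy e he)
    · exact fun e he => hold e (S.pendant_copy e he)
    · have h1 := Finset.card_union_le S.rest (Finset.univ.image c)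
      have h2 : (Finset.univ.image c).card ≤ k + 1 := by
        simpa using Finset.card_image_le (s := Finset.univ) (f := c)
      have h3 := S.rest_card
      rw [mul_add, mul_one]
      omega
    · intro v hv
      rcases Finset.mem_union.1 hv with hv | hv
      · rcases S.mem_verts v hv with h | h | h
        · exact Or.inl h
        · exact Or.inr (Or.inl (Finset.mem_union_left _ h))
        · exact Or.inr (Or.inr h)
      · exact Or.inr (Or.inl (Finset.mem_union_right _ hv))

/-- There is an exploration that covers all copies. -/
lemma exists_exploration {F : SimpleGraph (Fin (k + 1))} (hF : IsBalanced F) (H : SimpleGraph W) :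
    ∃ S : Exploration F H, ∀ c, IsCopyMap F H c → ∀ x, c x ∈ S.verts := by
  classical
  let S₀ : Exploration F H :=
    { verts := ∅, edges := ∅, base := ∅, pendant := ∅, rest := ∅, steps := 0
      edges_subset := by simp
      endpoints_subset := by
        intro v hv
        simp [mem_endpoints] at hv
      budget := by simp
      base_copy := by simp
      pendant_copy := by simp
      base_card := by simp
      pendant_card := by simp
      tail_inj := by simp
      rest_card := by simp
      mem_verts := by simp }
  -- An exploration with the most vertices cannot be extended, so it misses no copy.
  obtain ⟨m, ⟨S, hS⟩, hmax⟩ : ∃ m, (∃ S : Exploration F H, S.verts.card = m) ∧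
      ∀ T : Exploration F H, T.verts.card ≤ m := by
    have hb : ∀ T : Exploration F H, T.verts.card ≤ Fintype.card W := fun T => Finset.card_le_univ _
    have hP : ∃ m, m ≤ Fintype.card W ∧ ∃ S : Exploration F H, S.verts.card = m :=
      ⟨_, hb S₀, S₀, rfl⟩
    have hspec := Nat.findGreatest_spec (P := fun m => ∃ S : Exploration F H, S.verts.card = m)
      (hb S₀) ⟨S₀, rfl⟩
    exact ⟨_, hspec, fun T => Nat.le_findGreatest (hb T) ⟨T, rfl⟩⟩
  refine ⟨S, fun c hc x => ?_⟩
  by_contra hx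
  obtain ⟨T, hT⟩ := S.exists_extend hF hc ⟨x, hx⟩
  have := hmax T
  omega

end Exploration

/-! ### Coding families of edge-disjoint and pendant copies -/

section Counting

lemma pow_self_le_exp_mul_factorial (m : ℕ) : (m : ℝ) ^ m ≤ Real.exp 1 ^ m * (m.factorial : ℝ) := by
  have h := Real.pow_div_factorial_le_exp (m : ℝ) (Nat.cast_nonneg m) m
  rw [div_le_iff₀ (by positivity)] at h
  rwa [← Real.exp_nat_mul, mul_one]

/-- The binomial coefficient supplies b!, which is at least (b/e)^b; b-th roots are then taken.
Coding by ordered families would lose this factorial. -/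
lemma cast_le_exp_mul_of_one_le_choose {N b : ℕ} {x : ℝ} (hx : 0 ≤ x)
    (h : 1 ≤ (N.choose b : ℝ) * x ^ b) : (b : ℝ) ≤ Real.exp 1 * (N * x) := by
  rcases Nat.eq_zero_or_pos b with rfl | hb
  · simp only [Nat.cast_zero]
    positivity
  have h1 : (N.choose b : ℝ) ≤ (N : ℝ) ^ b / (b.factorial : ℝ) := Nat.choose_le_pow_div b N
  have h2 : 1 ≤ (N : ℝ) ^ b / (b.factorial : ℝ) * x ^ b :=
    h.trans (mul_le_mul_of_nonneg_right h1 (by positivity))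
  have h3 : (b.factorial : ℝ) ≤ (N * x) ^ b := by
    rw [div_mul_eq_mul_div, le_div_iff₀ (by positivity), ← mul_pow] at h2
    linarith
  have h4 : (b : ℝ) ^ b ≤ (Real.exp 1 * (N * x)) ^ b := by
    rw [mul_pow]
    exact (pow_self_le_exp_mul_factorial b).trans (mul_le_mul_of_nonneg_left h3 (by positivity))
  exact le_of_pow_le_pow_left₀ hb.ne' (by positivity) h4

variable {W : Type*} [DecidableEq W] {k : ℕ}

lemma blockEdges_comp {X V : Type*} [Fintype X] [DecidableEq V] (F : SimpleGraph X) (c : X → W)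
    (f : W → V) : blockEdges F (f ∘ c) = (blockEdges F c).image (Sym2.map f) := by
  ext e
  simp only [mem_blockEdges, Finset.mem_image]
  constructor
  · rintro ⟨e', he', rfl⟩
    exact ⟨_, ⟨e', he', rfl⟩, by rw [Sym2.map_map]⟩
  · rintro ⟨_, ⟨e', he', rfl⟩, rfl⟩
    exact ⟨e', he', by rw [Sym2.map_map]⟩

/-- The unordered family of mapped copies determines the mapped edge set, so decoding only has to
recover that family. -/
lemma image_biUnion_blockEdges {X V : Type*} [Fintype X] [DecidableEq X] [DecidableEq V]
    (F : SimpleGraph X)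
    (D : Finset (X → W)) (f : W → V) :
    (D.biUnion (blockEdges F)).image (Sym2.map f) =
      (D.image (fun c => f ∘ c)).biUnion (blockEdges F) := by
  rw [Finset.biUnion_image, Finset.image_biUnion]
  simp_rw [blockEdges_comp]

variable [Fintype W]

lemma mem_endpoints_biUnion {F : SimpleGraph (Fin (k + 1))} (hF : ∀ x, ∃ y, F.Adj x y)
    {D : Finset (Fin (k + 1) → W)} {c : Fin (k + 1) → W} (hc : c ∈ D) (x : Fin (k + 1)) :
    c x ∈ endpoints (D.biUnion (blockEdges F)) := by
  obtain ⟨y, hy⟩ := hF x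
  refine mem_endpoints.2 ⟨s(c x, c y), ?_, by simp⟩
  exact Finset.mem_biUnion.2 ⟨c, hc, mem_blockEdges.2 ⟨s(x, y), hy, by simp⟩⟩

/-- Sparsity bounds the size of a family of edge-disjoint copies. -/
lemma IsSparse.card_le_of_edge_disjoint {H : SimpleGraph W} {n : ℕ} {q : I}
    (hs : IsSparse n q H) (hn : 0 < n) {F : SimpleGraph (Fin (k + 1))}
    (hF : ∀ x, ∃ y, F.Adj x y) (B : Finset (Fin (k + 1) → W))
    (hB : ∀ c ∈ B, IsCopyMap F H c)
    (hcard : F.edgeSet.ncard * B.card ≤ (B.biUnion (blockEdges F)).card) :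
    (B.card : ℝ) ≤ Real.exp 1 * ((n : ℝ) ^ (k + 1) * (q : ℝ) ^ F.edgeSet.ncard) := by
  have hsub : ((B.biUnion (blockEdges F) : Finset (Sym2 W)) : Set (Sym2 W)) ⊆ H.edgeSet := by
    intro e he
    obtain ⟨c, hc, he⟩ := Finset.mem_biUnion.1 (Finset.mem_coe.1 he)
    exact blockEdges_subset (hB c hc) he
  have h1 := hs.one_le_card_mul hn _ hsub
    (Finset.powersetCard B.card (Finset.univ : Finset (Fin (k + 1) → Fin n)))
    (fun f => B.image (fun c => f ∘ c)) (fun f hf => ?_) (fun f g _ _ hfg => ?_)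
  · rw [Finset.card_powersetCard, Finset.card_univ, Fintype.card_fun, Fintype.card_fin,
      Fintype.card_fin] at h1
    have h2 : (q : ℝ) ^ (B.biUnion (blockEdges F)).card ≤ ((q : ℝ) ^ F.edgeSet.ncard) ^ B.card := by
      rw [← pow_mul]
      exact pow_le_pow_of_le_one q.2.1 q.2.2 hcard
    have h3 := cast_le_exp_mul_of_one_le_choose (pow_nonneg q.2.1 _)
      (h1.trans (mul_le_mul_of_nonneg_left h2 (by positivity)))
    simpa using h3
  · rw [Finset.mem_powersetCard]
    refine ⟨Finset.subset_univ _, Finset.card_image_of_injOn ?_⟩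
    intro c hc d hd hcd
    ext x
    exact hf (mem_endpoints_biUnion hF hc x) (mem_endpoints_biUnion hF hd x) (congrFun hcd x)
  · rw [image_biUnion_blockEdges, image_biUnion_blockEdges]
    rw [hfg]

/-- The attachment vertices of a family of pendant copies that are not inner vertices of the
family. -/
noncomputable def roots (R : Finset (Fin (k + 1) → W)) : Finset W :=
  (R.image fun c => c 0).filter fun v => ¬ ∃ c ∈ R, ∃ x, Fin.tail c x = v

/-- Sparsity applied to a family of pendant copies: an embedding of the family is encoded by the
images of the roots, the set of the images of the tails and, for every tail, the attachment
vertex. -/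
lemma IsSparse.one_le_of_pendant {H : SimpleGraph W} {n : ℕ} {q : I}
    (hs : IsSparse n q H) (hn : 0 < n) {F : SimpleGraph (Fin (k + 1))}
    (hF : ∀ x, ∃ y, F.Adj x y) (R : Finset (Fin (k + 1) → W))
    (hR : ∀ c ∈ R, IsCopyMap F H c)
    (hcard : F.edgeSet.ncard * R.card ≤ (R.biUnion (blockEdges F)).card)
    (htail : ∀ c ∈ R, ∀ c' ∈ R, Fin.tail c = Fin.tail c' → c = c') :
    1 ≤ (n.choose (roots R).card : ℝ) * ((n ^ k).choose R.card : ℝ) *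
      (((roots R).card + k * R.card : ℕ) : ℝ) ^ R.card * ((q : ℝ) ^ F.edgeSet.ncard) ^ R.card := by
  classical
  have hsub : ((R.biUnion (blockEdges F) : Finset (Sym2 W)) : Set (Sym2 W)) ⊆ H.edgeSet := by
    intro e he
    obtain ⟨c, hc, he⟩ := Finset.mem_biUnion.1 (Finset.mem_coe.1 he)
    exact blockEdges_subset (hR c hc) he
  set Y := roots R with hY
  let z : Fin n := ⟨0, hn⟩
  let V : Finset (Fin n) × Finset (Fin k → Fin n) → Finset (Fin n) := fun p =>
    p.1 ∪ p.2.biUnion fun a => Finset.univ.image a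
  let tails : (W → Fin n) → Finset (Fin k → Fin n) := fun f => R.image fun c => Fin.tail (f ∘ c)
  let ptr : (W → Fin n) → (Fin k → Fin n) → Fin n := fun f a =>
    if h : ∃ c ∈ R, Fin.tail (f ∘ c) = a then f (h.choose 0) else z
  let P := Finset.powersetCard Y.card (Finset.univ : Finset (Fin n)) ×ˢ
    Finset.powersetCard R.card (Finset.univ : Finset (Fin k → Fin n))
  -- Pointers are functions on all possible tails, frozen to `z` off the chosen set, so they
  -- contribute only |V|^r, where r is the number of copies. A pointer may also land on a vertex of
  -- another tail; only attachment vertices outside all tails are coded as roots.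
  let codes : Finset (Σ _ : Finset (Fin n) × Finset (Fin k → Fin n), (Fin k → Fin n) → Fin n) :=
    P.sigma fun p => Fintype.piFinset fun a => if a ∈ p.2 then V p else {z}
  have htails : ∀ f : W → Fin n, Set.InjOn f (endpoints (R.biUnion (blockEdges F))) →
      ∀ c ∈ R, ∀ d ∈ R, Fin.tail (f ∘ c) = Fin.tail (f ∘ d) → c = d := by
    intro f hf c hc d hd hcd
    refine htail c hc d hd ?_
    ext x
    exact hf (mem_endpoints_biUnion hF hc _) (mem_endpoints_biUnion hF hd _) (congrFun hcd x)
  have hptr : ∀ f : W → Fin n, Set.InjOn f (endpoints (R.biUnion (blockEdges F))) →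
      ∀ c ∈ R, ptr f (Fin.tail (f ∘ c)) = f (c 0) := by
    intro f hf c hc
    have h : ∃ d ∈ R, Fin.tail (f ∘ d) = Fin.tail (f ∘ c) := ⟨c, hc, rfl⟩
    simp only [ptr, dif_pos h]
    rw [htails f hf _ h.choose_spec.1 c hc h.choose_spec.2]
  have hYend : ∀ y ∈ Y, y ∈ endpoints (R.biUnion (blockEdges F)) := by
    intro y hy
    obtain ⟨c, hc, rfl⟩ := Finset.mem_image.1 (Finset.mem_filter.1 hy).1
    exact mem_endpoints_biUnion hF hc 0
  have h1 := hs.one_le_card_mul hn _ hsub codes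
    (fun f => ⟨(Y.image f, tails f), ptr f⟩) (fun f hf => ?_) (fun f g hf hg hfg => ?_)
  · have hcodes : codes.card ≤ n.choose Y.card * (n ^ k).choose R.card *
        (Y.card + k * R.card) ^ R.card := by
      have hPc : P.card = n.choose Y.card * (n ^ k).choose R.card := by
        simp [P, Finset.card_product]
      rw [← hPc, Finset.card_sigma, ← smul_eq_mul, ← Finset.sum_const]
      refine Finset.sum_le_sum fun p hp => ?_
      obtain ⟨hp1, hp2⟩ := Finset.mem_product.1 hp
      rw [Finset.mem_powersetCard] at hp1 hp2
      rw [Fintype.card_piFinset]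
      have : ∀ a, (if a ∈ p.2 then V p else {z}).card = if a ∈ p.2 then (V p).card else 1 := by
        intro a
        split_ifs <;> simp
      simp_rw [this]
      rw [Finset.prod_ite_mem, Finset.univ_inter, Finset.prod_const, hp2.2]
      refine Nat.pow_le_pow_left ?_ _
      refine (Finset.card_union_le _ _).trans ?_
      rw [hp1.2]
      refine Nat.add_le_add_left ?_ _
      refine (Finset.card_biUnion_le_card_mul _ _ k fun a _ => ?_).trans ?_
      · simpa using Finset.card_image_le (s := Finset.univ) (f := a)
      · rw [hp2.2, mul_comm]
    have h2 : (q : ℝ) ^ (R.biUnion (blockEdges F)).card ≤ ((q : ℝ) ^ F.edgeSet.ncard) ^ R.card := by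
      rw [← pow_mul]
      exact pow_le_pow_of_le_one q.2.1 q.2.2 hcard
    refine h1.trans (mul_le_mul ?_ h2 (pow_nonneg q.2.1 _) (by positivity))
    exact_mod_cast hcodes
  · refine Finset.mem_sigma.2 ⟨Finset.mem_product.2 ⟨?_, ?_⟩, ?_⟩
    · rw [Finset.mem_powersetCard]
      refine ⟨Finset.subset_univ _, Finset.card_image_of_injOn ?_⟩
      exact hf.mono fun y hy => hYend y hy
    · rw [Finset.mem_powersetCard]
      exact ⟨Finset.subset_univ _, Finset.card_image_of_injOn fun c hc d hd h =>
        htails f hf c hc d hd h⟩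
    · rw [Fintype.mem_piFinset]
      intro a
      by_cases ha : a ∈ tails f
      · simp only [ha, if_true]
        obtain ⟨c, hc, rfl⟩ := Finset.mem_image.1 ha
        rw [hptr f hf c hc]
        by_cases hroot : ∃ d ∈ R, ∃ x, Fin.tail d x = c 0
        · obtain ⟨d, hd, x, hx⟩ := hroot
          refine Finset.mem_union_right _ (Finset.mem_biUnion.2 ⟨Fin.tail (f ∘ d), ?_, ?_⟩)
          · exact Finset.mem_image_of_mem _ hd
          · rw [← hx]
            exact Finset.mem_image.2 ⟨x, Finset.mem_univ _, rfl⟩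
        · refine Finset.mem_union_left _ (Finset.mem_image_of_mem _ ?_)
          exact Finset.mem_filter.2 ⟨Finset.mem_image_of_mem (fun c => c 0) hc, hroot⟩
      · simp only [ha, if_false, Finset.mem_singleton]
        refine dif_neg ?_
        rintro ⟨c, hc, h⟩
        exact ha (Finset.mem_image.2 ⟨c, hc, h⟩)
  · rw [Sigma.mk.injEq, Prod.mk.injEq] at hfg
    obtain ⟨⟨-, ht⟩, hp⟩ := hfg
    have hp := eq_of_heq hp
    have key : ∀ f g : W → Fin n, Set.InjOn f (endpoints (R.biUnion (blockEdges F))) →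
        Set.InjOn g (endpoints (R.biUnion (blockEdges F))) → tails f = tails g → ptr f = ptr g →
        R.image (fun c => f ∘ c) ⊆ R.image (fun c => g ∘ c) := by
      intro f g hf hg ht hp a ha
      obtain ⟨c, hc, rfl⟩ := Finset.mem_image.1 ha
      have h1 : Fin.tail (f ∘ c) ∈ tails g := ht ▸ Finset.mem_image_of_mem _ hc
      obtain ⟨d, hd, hdc⟩ := Finset.mem_image.1 h1
      refine Finset.mem_image.2 ⟨d, hd, ?_⟩
      have h0 : g (d 0) = f (c 0) := by
        rw [← hptr g hg d hd, ← hptr f hf c hc, hdc, hp]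
      ext1 x
      refine Fin.cases h0 (fun i => ?_) x
      exact congrFun hdc i
    rw [image_biUnion_blockEdges, image_biUnion_blockEdges]
    rw [(key f g hf hg ht hp).antisymm (key g f hg hf ht.symm hp.symm)]

end Counting

/-! ### A small cover of the copies when they are rare -/

section Window

lemma exp_one_pow_four_lt : Real.exp 1 ^ 4 < 55 := by
  have h := Real.exp_one_lt_d9
  have h0 := Real.exp_pos 1
  calc Real.exp 1 ^ 4 < 2.7182818286 ^ 4 := by gcongr
    _ < 55 := by norm_num

/-- If `ρ` is small, then the inequality provided by sparsity bounds the number of pendant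
copies. -/
lemma pendant_card_le {n k y r : ℕ} {ρ x : ℝ} (hx : 0 ≤ x) (hρ0 : 0 < ρ) (hρ : (n : ℝ) ^ k * x = ρ)
    (hsmall : 55 * ((k : ℝ) + 1) ^ 2 * ρ ≤ 1)
    (h : 1 ≤ (n.choose y : ℝ) * ((n ^ k).choose r : ℝ) * ((y + k * r : ℕ) : ℝ) ^ r * x ^ r) :
    (r : ℝ) ≤ 2 * y + n * ρ := by
  by_contra! hlt
  have hρ1 : ρ ≤ 1 := by
    have : 1 ≤ 55 * ((k : ℝ) + 1) ^ 2 := by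
      have : (0 : ℝ) ≤ k := Nat.cast_nonneg k
      nlinarith
    nlinarith
  have hr0 : r ≠ 0 := by
    rintro rfl
    have : (0 : ℝ) ≤ 2 * y + n * ρ := by positivity
    simp at hlt
    linarith
  have hyr : 2 * y ≤ r := by
    have : (2 * y : ℝ) ≤ r := by
      have : (0 : ℝ) ≤ n * ρ := by positivity
      linarith
    exact_mod_cast this
  have hEr : n * ρ ≤ r := by
    have : (0 : ℝ) ≤ y := Nat.cast_nonneg y
    linarith
  -- the roots
  have h1 : (n.choose y : ℝ) * ρ ^ y ≤ Real.exp 1 ^ r := by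
    calc (n.choose y : ℝ) * ρ ^ y ≤ (n : ℝ) ^ y / y.factorial * ρ ^ y :=
          mul_le_mul_of_nonneg_right (Nat.choose_le_pow_div y n) (by positivity)
      _ = (n * ρ) ^ y / y.factorial := by rw [mul_pow]; ring
      _ ≤ Real.exp (n * ρ) := Real.pow_div_factorial_le_exp _ (by positivity) _
      _ ≤ Real.exp r := Real.exp_le_exp.2 hEr
      _ = Real.exp 1 ^ r := by rw [← Real.exp_nat_mul, mul_one]
  -- As r ≥ 2y, the square of the root factor is paid for by one ρ per pendant copy. The squared
  -- block factor has two, so one ρ per copy remains, which gives the contradiction e^4 (k+1)^2 ρ <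
  -- 1 at the end.
  have h1' : ((n.choose y : ℝ)) ^ 2 * ρ ^ r ≤ (Real.exp 1 ^ 2) ^ r := by
    calc ((n.choose y : ℝ)) ^ 2 * ρ ^ r ≤ ((n.choose y : ℝ)) ^ 2 * ρ ^ (2 * y) :=
          mul_le_mul_of_nonneg_left (pow_le_pow_of_le_one hρ0.le hρ1 hyr) (by positivity)
      _ = ((n.choose y : ℝ) * ρ ^ y) ^ 2 := by ring
      _ ≤ (Real.exp 1 ^ r) ^ 2 := by gcongr
      _ = (Real.exp 1 ^ 2) ^ r := by rw [← pow_mul, ← pow_mul, mul_comm]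
  -- the blocks
  have h2 : ((n ^ k).choose r : ℝ) * ((y + k * r : ℕ) : ℝ) ^ r * x ^ r ≤
      (Real.exp 1 * ((k : ℝ) + 1) * ρ) ^ r := by
    have hv : ((y + k * r : ℕ) : ℝ) ≤ ((k : ℝ) + 1) * r := by
      have : y + k * r ≤ (k + 1) * r := by nlinarith
      exact_mod_cast this
    calc ((n ^ k).choose r : ℝ) * ((y + k * r : ℕ) : ℝ) ^ r * x ^ r
        ≤ ((n ^ k : ℕ) : ℝ) ^ r / r.factorial * (((k : ℝ) + 1) * r) ^ r * x ^ r := by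
          gcongr
          exact Nat.choose_le_pow_div r (n ^ k)
      _ = (((k : ℝ) + 1) * ρ) ^ r * ((r : ℝ) ^ r / r.factorial) := by
          rw [← hρ]
          push_cast
          rw [mul_pow, mul_pow, mul_pow]
          ring
      _ ≤ (((k : ℝ) + 1) * ρ) ^ r * Real.exp r := by
          gcongr
          exact Real.pow_div_factorial_le_exp _ (Nat.cast_nonneg r) _
      _ = (Real.exp 1 * ((k : ℝ) + 1) * ρ) ^ r := by
          rw [show Real.exp r = Real.exp 1 ^ r by rw [← Real.exp_nat_mul, mul_one], ← mul_pow]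
          ring
  have h3 : 1 ≤ (n.choose y : ℝ) * (Real.exp 1 * ((k : ℝ) + 1) * ρ) ^ r := by
    refine h.trans ?_
    rw [mul_assoc, mul_assoc]
    refine mul_le_mul_of_nonneg_left ?_ (by positivity)
    rwa [← mul_assoc]
  have h4 : 1 ≤ (Real.exp 1 ^ 4 * ((k : ℝ) + 1) ^ 2 * ρ) ^ r := by
    calc (1 : ℝ) ≤ ((n.choose y : ℝ) * (Real.exp 1 * ((k : ℝ) + 1) * ρ) ^ r) ^ 2 :=
          one_le_pow₀ h3
      _ = ((n.choose y : ℝ) ^ 2 * ρ ^ r) * (Real.exp 1 ^ 2 * ((k : ℝ) + 1) ^ 2 * ρ) ^ r := by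
          simp only [mul_pow, ← pow_mul]
          ring
      _ ≤ (Real.exp 1 ^ 2) ^ r * (Real.exp 1 ^ 2 * ((k : ℝ) + 1) ^ 2 * ρ) ^ r := by gcongr
      _ = (Real.exp 1 ^ 4 * ((k : ℝ) + 1) ^ 2 * ρ) ^ r := by
          rw [← mul_pow]
          ring
  have h5 : Real.exp 1 ^ 4 * ((k : ℝ) + 1) ^ 2 * ρ < 1 := by
    have : Real.exp 1 ^ 4 * (((k : ℝ) + 1) ^ 2 * ρ) < 55 * (((k : ℝ) + 1) ^ 2 * ρ) :=
      mul_lt_mul_of_pos_right exp_one_pow_four_lt (by positivity)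
    nlinarith
  have h6 := pow_lt_one₀ (by positivity) h5 hr0
  linarith

variable {W : Type*} [Fintype W] [DecidableEq W] {k : ℕ}

/-- If the expected number of copies of the balanced graph `F` is much smaller than `n`, then the
copies of `F` in a sparse graph cover few vertices. -/
theorem IsSparse.exists_cover {H : SimpleGraph W} {n : ℕ} {q : I} (hs : IsSparse n q H)
    (hn : 0 < n) (hq : 0 < (q : ℝ)) {F : SimpleGraph (Fin (k + 1))} (hF : IsBalanced F)
    (hsmall : 55 * ((k : ℝ) + 1) ^ 2 * ((n : ℝ) ^ k * (q : ℝ) ^ F.edgeSet.ncard) ≤ 1) :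
    ∃ U : Finset W, (∀ c, IsCopyMap F H c → ∀ x, c x ∈ U) ∧
      (U.card : ℝ) ≤ 7 * ((k : ℝ) + 1) ^ 2 * (1 + F.edgeSet.ncard) *
        ((n : ℝ) ^ (k + 1) * (q : ℝ) ^ F.edgeSet.ncard) := by
  obtain ⟨S, hS⟩ := exists_exploration hF H
  refine ⟨S.verts, hS, ?_⟩
  set m := F.edgeSet.ncard with hm
  set ρ := (n : ℝ) ^ k * (q : ℝ) ^ m with hρ
  have hn' : (0 : ℝ) < n := Nat.cast_pos.2 hn
  have hρ0 : 0 < ρ := by positivity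
  have hE : (n : ℝ) ^ (k + 1) * (q : ℝ) ^ m = n * ρ := by rw [hρ]; ring
  have hρ1 : ρ < 1 := by
    have : (0 : ℝ) ≤ k := Nat.cast_nonneg k
    nlinarith
  set b := S.base.card with hb
  set r := S.pendant.card with hr
  -- the number of base copies
  have hbE : (b : ℝ) ≤ 3 * (n * ρ) := by
    have h := hs.card_le_of_edge_disjoint hn hF.exists_adj S.base (fun c hc => (S.base_copy c hc).1)
      S.base_card
    rw [hE] at h
    have h3 := Real.exp_one_lt_three
    have : 0 ≤ (n : ℝ) * ρ := by positivity
    nlinarith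
  -- the number of irregular steps
  have hsteps : S.steps ≤ m * b := by
    -- Density gives k|E| ≤ m|V|; cancelling this in the budget leaves only the steps and the base.
    have h1 := hs.density hn hρ1 S.edges S.edges_subset
    have h2 := Nat.mul_le_mul_left m (Finset.card_le_card S.endpoints_subset)
    have h3 : m * S.verts.card + S.steps ≤ k * S.edges.card + m * b := S.budget
    omega
  -- the number of roots
  have hbase_range : (S.base.biUnion fun c => Finset.univ.image c).card ≤ (k + 1) * b := by
    rw [mul_comm]
    refine Finset.card_biUnion_le_card_mul _ _ _ fun c _ => ?_
    simpa using Finset.card_image_le (s := Finset.univ) (f := c)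
  have hrest := S.rest_card
  have hroots : (roots S.pendant).card ≤ (k + 1) * b + (k + 1) * S.steps := by
    -- An attachment vertex was already explored, so it lies in a base copy, in `rest` or in a tail;
    -- roots exclude the last option.
    have hsub : roots S.pendant ⊆ (S.base.biUnion fun c => Finset.univ.image c) ∪ S.rest := by
      intro v hv
      obtain ⟨hv1, hv2⟩ := Finset.mem_filter.1 hv
      obtain ⟨c, hc, rfl⟩ := Finset.mem_image.1 hv1
      rcases S.mem_verts _ ((S.pendant_copy c hc).2.2 0) with ⟨d, hd, x, hx⟩ | h | h
      · exact Finset.mem_union_left _ (Finset.mem_biUnion.2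
          ⟨d, hd, Finset.mem_image.2 ⟨x, Finset.mem_univ _, hx⟩⟩)
      · exact Finset.mem_union_right _ h
      · exact absurd h hv2
    have := (Finset.card_le_card hsub).trans (Finset.card_union_le _ _)
    omega
  have hrle : (r : ℝ) ≤ 2 * (roots S.pendant).card + n * ρ :=
    pendant_card_le (pow_nonneg q.2.1 m) hρ0 rfl hsmall
      (hs.one_le_of_pendant hn hF.exists_adj S.pendant (fun c hc => (S.pendant_copy c hc).1)
        S.pendant_card S.tail_inj)
  have hverts : S.verts.card ≤ (k + 1) * b + (k + 1) * S.steps + k * r := by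
    have hsub : S.verts ⊆ ((S.base.biUnion fun c => Finset.univ.image c) ∪ S.rest) ∪
        S.pendant.biUnion fun c => Finset.univ.image (Fin.tail c) := by
      intro v hv
      rcases S.mem_verts v hv with ⟨d, hd, x, hx⟩ | h | ⟨d, hd, x, hx⟩
      · exact Finset.mem_union_left _ (Finset.mem_union_left _ (Finset.mem_biUnion.2
          ⟨d, hd, Finset.mem_image.2 ⟨x, Finset.mem_univ _, hx⟩⟩))
      · exact Finset.mem_union_left _ (Finset.mem_union_right _ h)
      · exact Finset.mem_union_right _ (Finset.mem_biUnion.2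
          ⟨d, hd, Finset.mem_image.2 ⟨x, Finset.mem_univ _, hx⟩⟩)
    have h1 := (Finset.card_le_card hsub).trans (Finset.card_union_le _ _)
    have h2 := Finset.card_union_le (S.base.biUnion fun c => Finset.univ.image c) S.rest
    have h3 : (S.pendant.biUnion fun c => Finset.univ.image (Fin.tail c)).card ≤ r * k := by
      refine Finset.card_biUnion_le_card_mul _ _ _ fun c _ => ?_
      simpa using Finset.card_image_le (s := Finset.univ) (f := Fin.tail c)
    rw [mul_comm r k] at h3
    omega
  rw [hE]
  have e1 : (S.steps : ℝ) ≤ m * b := by exact_mod_cast hsteps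
  have e2 : ((roots S.pendant).card : ℝ) ≤ (k + 1) * b + (k + 1) * S.steps := by
    exact_mod_cast hroots
  have e3 : (S.verts.card : ℝ) ≤ (k + 1) * b + (k + 1) * S.steps + k * r := by
    exact_mod_cast hverts
  have hX0 : 0 ≤ (n : ℝ) * ρ := by positivity
  generalize (n : ℝ) * ρ = X at *
  have hk0 : (0 : ℝ) ≤ k := Nat.cast_nonneg k
  have hm0 : (0 : ℝ) ≤ m := Nat.cast_nonneg m
  have e4 : ((k : ℝ) + 1) * b + (k + 1) * S.steps ≤ (k + 1) * (1 + m) * (3 * X) := by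
    calc ((k : ℝ) + 1) * b + (k + 1) * S.steps ≤ ((k : ℝ) + 1) * b + (k + 1) * (m * b) := by gcongr
      _ = (k + 1) * (1 + m) * b := by ring
      _ ≤ (k + 1) * (1 + m) * (3 * X) := by gcongr
  have e5 : (r : ℝ) ≤ 2 * ((k + 1) * (1 + m) * (3 * X)) + X := by linarith
  have e6 : (k : ℝ) * r ≤ k * (2 * ((k + 1) * (1 + m) * (3 * X)) + X) := by gcongr
  refine e3.trans ((add_le_add e4 e6).trans ?_)
  have e7 : 0 ≤ (k : ℝ) * X * m := by positivity
  have e8 : 0 ≤ (k : ℝ) * X := by positivity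
  have e9 : 0 ≤ (k : ℝ) * k * X * m := by positivity
  have e10 : 0 ≤ (k : ℝ) * k * X := by positivity
  have e11 : 0 ≤ X * m := by positivity
  nlinarith

end Window

/-! ### Cliques: degeneracy, copies in the complete graph, balance -/

section Cliques

lemma isDiag_of_mem_filter {W : Type*} {H : SimpleGraph W} {E : Finset (Sym2 W)}
    (hE : (E : Set (Sym2 W)) ⊆ H.edgeSet) {e : Sym2 W} (he : e ∈ E) : ¬ e.IsDiag :=
  SimpleGraph.not_isDiag_of_mem_edgeSet _ (hE he)

/-- Handshake lemma for a finite set of edges. -/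
lemma sum_card_filter_mem {W : Type*} [Fintype W] [DecidableEq W] {H : SimpleGraph W}
    {E : Finset (Sym2 W)} (hE : (E : Set (Sym2 W)) ⊆ H.edgeSet) :
    ∑ v : W, (E.filter fun e => v ∈ e).card = 2 * E.card := by
  simp_rw [Finset.card_filter]
  rw [Finset.sum_comm, mul_comm, ← smul_eq_mul, ← Finset.sum_const]
  refine Finset.sum_congr rfl fun e he => ?_
  rw [← Finset.card_filter, ← Sym2.card_toFinset_of_not_isDiag e (isDiag_of_mem_filter hE he)]
  congr 1
  ext v
  simp

/-- Otherwise the edges inside `S` number at least (D+1)|S|/2, against the density hypothesis. -/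
lemma exists_low_degree {W : Type*} [Fintype W] [DecidableEq W] {H : SimpleGraph W}
    [DecidableRel H.Adj] {D : ℕ}
    (hD : ∀ E : Finset (Sym2 W), (E : Set (Sym2 W)) ⊆ H.edgeSet →
      2 * E.card ≤ D * (endpoints E).card) {S : Finset W} (hS : S.Nonempty) :
    ∃ v ∈ S, (S.filter fun w => H.Adj v w).card ≤ D := by
  classical
  by_contra! hlt
  set E := H.edgeFinset.filter fun e => ∀ x ∈ e, x ∈ S with hEdef
  have hE : (E : Set (Sym2 W)) ⊆ H.edgeSet := by
    intro e he
    simpa using (Finset.mem_filter.1 (Finset.mem_coe.1 he)).1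
  have hend : endpoints E ⊆ S := by
    intro v hv
    obtain ⟨e, he, hve⟩ := mem_endpoints.1 hv
    exact (Finset.mem_filter.1 he).2 v hve
  have hdeg : ∀ v ∈ S, (S.filter fun w => H.Adj v w).card ≤ (E.filter fun e => v ∈ e).card := by
    intro v hv
    refine Finset.card_le_card_of_injOn (fun w => s(v, w)) ?_ ?_
    · intro w hw
      simp only [Finset.coe_filter, Set.mem_ofPred_eq] at hw
      simp only [hEdef, Finset.coe_filter, Finset.mem_filter, Set.mem_ofPred_eq]
      refine ⟨⟨by simpa using hw.2, ?_⟩, by simp⟩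
      intro x hx
      rcases Sym2.mem_iff.1 hx with rfl | rfl
      · exact hv
      · exact hw.1
    · intro w _ w' _ h
      exact Sym2.congr_right.1 h
  have h1 : (D + 1) * S.card ≤ 2 * E.card := by
    rw [← sum_card_filter_mem hE, mul_comm, ← smul_eq_mul, ← Finset.sum_const]
    refine (Finset.sum_le_sum fun v hv => Nat.succ_le_of_lt ((hlt v hv).trans_le (hdeg v hv))).trans ?_
    exact Finset.sum_le_sum_of_subset (Finset.subset_univ S)
  have h2 := (hD E hE).trans (Nat.mul_le_mul_left D (Finset.card_le_card hend))
  have h3 := Finset.card_pos.2 hS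
  nlinarith

/-- In a graph of small edge density there are few cliques. -/
lemma card_cliques_le {W : Type*} [Fintype W] [DecidableEq W] {H : SimpleGraph W}
    [DecidableRel H.Adj] {D k : ℕ}
    (hD : ∀ E : Finset (Sym2 W), (E : Set (Sym2 W)) ⊆ H.edgeSet →
      2 * E.card ≤ D * (endpoints E).card) (U : Finset W) :
    (U.powerset.filter fun s => H.IsNClique (k + 1) s).card ≤ U.card * D.choose k := by
  induction U using Finset.strongInduction with
  | H U ih =>
    rcases U.eq_empty_or_nonempty with rfl | hU
    · simp [Finset.filter_singleton, SimpleGraph.isNClique_iff]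
    · obtain ⟨v, hv, hdeg⟩ := exists_low_degree hD hU
      have h1 := ih (U.erase v) (Finset.erase_ssubset hv)
      set N := U.filter fun w => H.Adj v w with hN
      -- Delete a vertex v of low degree: the cliques lost consist of v and k of its at most D
      -- neighbours.
      have hsub : (U.powerset.filter fun s => H.IsNClique (k + 1) s) ⊆
          ((U.erase v).powerset.filter fun s => H.IsNClique (k + 1) s) ∪
            (Finset.powersetCard k N).image (insert v) := by
        intro s hs
        obtain ⟨hsU, hs⟩ := Finset.mem_filter.1 hs
        rw [Finset.mem_powerset] at hsU
        by_cases hvs : v ∈ s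
        · refine Finset.mem_union_right _ (Finset.mem_image.2
            ⟨s.erase v, Finset.mem_powersetCard.2 ⟨?_, ?_⟩, Finset.insert_erase hvs⟩)
          · intro w hw
            obtain ⟨hwv, hw⟩ := Finset.mem_erase.1 hw
            exact Finset.mem_filter.2 ⟨hsU hw, hs.isClique hvs hw (Ne.symm hwv)⟩
          · rw [Finset.card_erase_of_mem hvs, hs.card_eq]
            rfl
        · refine Finset.mem_union_left _ (Finset.mem_filter.2 ⟨?_, hs⟩)
          rw [Finset.mem_powerset]
          exact fun w hw => Finset.mem_erase.2 ⟨fun h => hvs (h ▸ hw), hsU hw⟩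
      refine (Finset.card_le_card hsub).trans ((Finset.card_union_le _ _).trans ?_)
      have h2 : ((Finset.powersetCard k N).image (insert v)).card ≤ D.choose k := by
        refine Finset.card_image_le.trans ?_
        rw [Finset.card_powersetCard]
        exact Nat.choose_le_choose k hdeg
      rw [Finset.card_erase_of_mem hv] at h1
      have h3 : U.card = (U.card - 1) + 1 := by
        have := Finset.card_pos.2 hU
        omega
      rw [h3, add_mul, one_mul]
      exact add_le_add h1 h2

lemma copyCount_congr {V U U' : Type*} [Fintype V] (G : SimpleGraph V) {F : SimpleGraph U}
    {F' : SimpleGraph U'} (e : F ≃g F') : G.copyCount F = G.copyCount F' := by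
  classical
  unfold SimpleGraph.copyCount
  congr 1
  refine Finset.filter_congr fun A _ => ?_
  exact ⟨fun ⟨f⟩ => ⟨f.comp e.symm⟩, fun ⟨f⟩ => ⟨f.comp e⟩⟩

/-- A copy of a complete graph is determined by its vertex set. -/
lemma copyCount_completeGraph_le {W : Type*} [Fintype W] [DecidableEq W] (H : SimpleGraph W)
    [DecidableRel H.Adj] (K : ℕ) :
    H.copyCount (SimpleGraph.completeGraph (Fin K)) ≤
      ((Finset.univ : Finset W).powerset.filter fun s => H.IsNClique K s).card := by
  classical
  unfold SimpleGraph.copyCount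
  have hadj : ∀ A : H.Subgraph, Nonempty ((SimpleGraph.completeGraph (Fin K)) ≃g A.coe) →
      ∀ a b, A.Adj a b ↔ a ∈ A.verts ∧ b ∈ A.verts ∧ a ≠ b := by
    rintro A ⟨e⟩ a b
    constructor
    · intro h
      exact ⟨A.edge_vert h, A.edge_vert h.symm, (A.adj_sub h).ne⟩
    · rintro ⟨ha, hb, hab⟩
      have h1 : (SimpleGraph.completeGraph (Fin K)).Adj (e.symm ⟨a, ha⟩) (e.symm ⟨b, hb⟩) := by
        intro h
        exact hab (congrArg Subtype.val (e.symm.injective h))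
      have h2 := e.map_adj_iff.2 h1
      simpa using h2
  refine Finset.card_le_card_of_injOn (fun A => A.verts.toFinset) ?_ ?_
  · intro A hA
    have hA : Nonempty ((SimpleGraph.completeGraph (Fin K)) ≃g A.coe) := by simpa using hA
    simp only [Finset.coe_filter, Finset.mem_powerset, Set.mem_ofPred_eq]
    refine ⟨Finset.subset_univ _, ?_, ?_⟩
    · intro a ha b hb hab
      simp only [Set.coe_toFinset] at ha hb
      exact A.adj_sub ((hadj A hA a b).2 ⟨ha, hb, hab⟩)
    · obtain ⟨e⟩ := hA
      rw [Set.toFinset_card, ← Fintype.card_congr e.toEquiv, Fintype.card_fin]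
  · intro A hA B hB hAB
    have hA : Nonempty ((SimpleGraph.completeGraph (Fin K)) ≃g A.coe) := by simpa using hA
    have hB : Nonempty ((SimpleGraph.completeGraph (Fin K)) ≃g B.coe) := by simpa using hB
    have hv : A.verts = B.verts := Set.toFinset_inj.1 hAB
    refine SimpleGraph.Subgraph.ext hv ?_
    ext a b
    rw [hadj A hA, hadj B hB, hv]

lemma choose_le_copyCount_completeGraph (n K : ℕ) :
    n.choose K ≤ (⊤ : SimpleGraph (Fin n)).copyCount (SimpleGraph.completeGraph (Fin K)) := by
  classical
  have hcopy : ∀ s ∈ Finset.powersetCard K (Finset.univ : Finset (Fin n)),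
      ∃ A : (⊤ : SimpleGraph (Fin n)).Subgraph,
        Nonempty ((SimpleGraph.completeGraph (Fin K)) ≃g A.coe) ∧ A.verts = s := by
    intro s hs
    have hcard : s.card = K := (Finset.mem_powersetCard.1 hs).2
    let c : (SimpleGraph.completeGraph (Fin K)).Copy (⊤ : SimpleGraph (Fin n)) :=
      (SimpleGraph.Embedding.completeGraph (s.orderEmbOfFin hcard).toEmbedding).toCopy
    refine ⟨c.toSubgraph, ⟨c.isoToSubgraph⟩, ?_⟩
    ext v
    simp only [SimpleGraph.Subgraph.map_verts, SimpleGraph.Subgraph.verts_top, Set.image_univ]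
    have := Finset.range_orderEmbOfFin s hcard
    rw [← this]
    rfl
  choose! A hA hAs using hcopy
  have h1 : n.choose K = (Finset.powersetCard K (Finset.univ : Finset (Fin n))).card := by simp
  rw [h1]
  unfold SimpleGraph.copyCount
  refine Finset.card_le_card_of_injOn A ?_ ?_
  · intro s hs
    simpa using hA s hs
  · intro s hs t ht hst
    have := (hAs s hs).symm.trans ((congrArg _ hst).trans (hAs t ht))
    exact_mod_cast this

/-- Factor by factor, n(k−i) ≤ k(n−i) for i < k ≤ n. This holds up to k = n, where falling
factorials are far below powers. -/
lemma pow_mul_factorial_le {n k : ℕ} (hkn : k ≤ n) :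
    n ^ k * k.factorial ≤ k ^ k * n.descFactorial k := by
  rw [← Nat.descFactorial_self, Nat.descFactorial_eq_prod_range, Nat.descFactorial_eq_prod_range]
  have h : ∀ m : ℕ, m ^ k = ∏ _i ∈ Finset.range k, m := fun m => by simp
  rw [h n, h k, ← Finset.prod_mul_distrib, ← Finset.prod_mul_distrib]
  refine Finset.prod_le_prod' fun i hi => ?_
  have hik := (Finset.mem_range.1 hi).le
  rw [Nat.mul_sub, Nat.mul_sub, mul_comm n k]
  exact Nat.sub_le_sub_left (Nat.mul_le_mul_right i hkn) _

lemma pow_le_pow_mul_choose {n k : ℕ} (hkn : k ≤ n) : n ^ k ≤ k ^ k * n.choose k := by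
  have h := pow_mul_factorial_le hkn
  rw [Nat.descFactorial_eq_factorial_mul_choose, ← mul_assoc, mul_right_comm] at h
  exact Nat.le_of_mul_le_mul_right h k.factorial_pos

lemma ncard_edgeSet_top (n : ℕ) :
    (SimpleGraph.completeGraph (Fin n)).edgeSet.ncard = n.choose 2 := by
  classical
  rw [Set.ncard_eq_toFinset_card']
  have := SimpleGraph.card_edgeFinset_top_eq_card_choose_two (V := Fin n)
  rw [Fintype.card_fin] at this
  rw [← this]
  congr

/-- Edges missing `A` lie in its complement. With |A| = a and complement of size b+2, so k = a+b+1,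
twice the gap k·M − m·a is at least k·a·(b+1) ≥ 2, where M counts the edges meeting `A` and m all
edges. -/
lemma isBalanced_completeGraph {k : ℕ} (hk : 1 ≤ k) :
    IsBalanced (SimpleGraph.completeGraph (Fin (k + 1))) where
  exists_adj x := by
    have : Nontrivial (Fin (k + 1)) := Fin.nontrivial_iff_two_le.2 (by omega)
    obtain ⟨y, hy⟩ := exists_ne x
    exact ⟨y, hy.symm⟩
  transitive x := ⟨SimpleGraph.Iso.completeGraph (Equiv.swap 0 x), by
    change Equiv.swap 0 x 0 = x
    simp⟩
  balanced A hA hcard := by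
    classical
    set F := SimpleGraph.completeGraph (Fin (k + 1)) with hF
    have hsub : F.edgeFinset ⊆ edgesMeeting F A ∪ Aᶜ.offDiag.image Sym2.mk.uncurry := by
      intro e he
      rw [SimpleGraph.mem_edgeFinset] at he
      by_cases h : ∃ x ∈ A, x ∈ e
      · exact Finset.mem_union_left _ (mem_edgesMeeting.2 ⟨he, h⟩)
      · refine Finset.mem_union_right _ ?_
        push Not at h
        induction e with
        | _ x y =>
          refine Finset.mem_image.2 ⟨(x, y), Finset.mem_offDiag.2 ⟨?_, ?_, F.ne_of_adj he⟩, rfl⟩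
          · rw [Finset.mem_compl]
            exact fun hx => h x hx (by simp)
          · rw [Finset.mem_compl]
            exact fun hy => h y hy (by simp)
    have h1 := (Finset.card_le_card hsub).trans (Finset.card_union_le _ _)
    have h2 : F.edgeFinset.card = F.edgeSet.ncard := (Set.ncard_eq_toFinset_card' _).symm
    have h3 : (Aᶜ.offDiag.image Sym2.mk.uncurry).card = Aᶜ.card.choose 2 :=
      Sym2.card_image_offDiag _
    rw [h2, h3, Finset.card_compl, Fintype.card_fin, ncard_edgeSet_top] at h1
    rw [ncard_edgeSet_top]
    have hApos := hA.card_pos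
    obtain ⟨b, hb⟩ : ∃ b, k + 1 = A.card + (b + 2) := ⟨k + 1 - A.card - 2, by omega⟩
    have h4 : k + 1 - A.card = b + 2 := by omega
    rw [h4] at h1
    generalize A.card = a at *
    generalize (edgesMeeting F A).card = M at *
    have e1 : 2 * (k + 1).choose 2 = (k + 1) * k := by
      rw [Nat.choose_two_right]
      exact Nat.mul_div_cancel' (Nat.even_mul_pred_self (k + 1)).two_dvd
    have e2 : 2 * (b + 2).choose 2 = (b + 2) * (b + 1) := by
      rw [Nat.choose_two_right]
      exact Nat.mul_div_cancel' (Nat.even_mul_pred_self (b + 2)).two_dvd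
    obtain rfl : k = a + b + 1 := by omega
    zify at *
    nlinarith [mul_pos (show (0 : ℤ) < a by omega) (show (0 : ℤ) < b + 1 by omega)]

end Cliques

/-! ### The clique case -/

lemma sq_le_two_mul_two_pow (m : ℕ) : m ^ 2 ≤ 2 * 2 ^ m := by
  rcases Nat.lt_or_ge m 4 with h | h
  · interval_cases m <;> norm_num
  · induction m, h using Nat.le_induction with
    | base => norm_num
    | succ m hm ih => rw [pow_succ 2 m]; nlinarith

/-- Sparsity applied to `H` itself, isolated vertices included: a graph with more than n vertices
has no copy in K_n. -/
lemma IsSparse.card_le {W : Type*} [Fintype W] {H : SimpleGraph W} {n : ℕ} {q : I}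
    (hs : IsSparse n q H) : Fintype.card W ≤ n := by
  classical
  have h1 := hs ⊤
  rw [expectedCopies_eq] at h1
  by_contra! hlt
  have h0 : ((⊤ : SimpleGraph (Fin n)).copyCount (⊤ : H.Subgraph).coe) = 0 := by
    rw [SimpleGraph.copyCount_eq_zero]
    rintro ⟨f⟩
    have := Fintype.card_le_of_injective _ f.injective
    simp at this
    omega
  rw [h0] at h1
  norm_num at h1

/-- A bound on the number of cliques in a `q`-sparse graph. -/
lemma IsSparse.card_cliques_le {W : Type*} [Fintype W] [DecidableEq W] {H : SimpleGraph W}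
    [DecidableRel H.Adj] {n : ℕ} {q : I} (hs : IsSparse n q H) (hn : 0 < n) (hq : 0 < (q : ℝ))
    (hq2 : (q : ℝ) ≤ 1 / 2) {k e : ℕ} (hk : 1 ≤ k) (he : 2 * e = (k + 1) * k) :
    (((Finset.univ : Finset W).powerset.filter fun s => H.IsNClique (k + 1) s).card : ℝ) ≤
      (2 : ℝ) ^ (18 * e) * ((n : ℝ) ^ (k + 1) * (q : ℝ) ^ e) := by
  have hke : k ≤ e := by nlinarith
  have he' : (⊤ : SimpleGraph (Fin (k + 1))).edgeSet.ncard = e := by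
    have := ncard_edgeSet_top (k + 1)
    rw [this, Nat.choose_two_right, Nat.add_sub_cancel, ← he, Nat.mul_div_cancel_left _ two_pos]
  have hn1 : (1 : ℝ) ≤ n := by exact_mod_cast hn
  have hK : ((k : ℝ) + 1) ≤ 2 ^ e := by
    have : k + 1 ≤ 2 ^ e := (Nat.succ_le_of_lt Nat.lt_two_pow_self).trans
      (Nat.pow_le_pow_right two_pos hke)
    exact_mod_cast this
  have hE1 : (1 : ℝ) + e ≤ 2 ^ e := by
    have : 1 + e ≤ 2 ^ e := by
      rw [add_comm]
      exact Nat.succ_le_of_lt Nat.lt_two_pow_self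
    exact_mod_cast this
  have htwo : (2 : ℝ) ≤ 2 ^ e := le_self_pow₀ (by norm_num) (by omega)
  have hpos : (0 : ℝ) < (n : ℝ) ^ (k + 1) * (q : ℝ) ^ e := by positivity
  have hsplit : (2 : ℝ) ^ (18 * e) = (2 ^ e) ^ 18 := by rw [← pow_mul, mul_comm]
  set N := ((Finset.univ : Finset W).powerset.filter fun s => H.IsNClique (k + 1) s).card
    with hN
  set t : ℝ := 2 ^ e with ht
  -- Rare cliques: they all live on the small cover, and density (k+1)/2 leaves at most k+1 cliques
  -- per vertex of it.
  by_cases hwin : 55 * ((k : ℝ) + 1) ^ 2 * ((n : ℝ) ^ k * (q : ℝ) ^ e) ≤ 1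
  · obtain ⟨U, hU, hUc⟩ := hs.exists_cover hn hq (isBalanced_completeGraph hk)
      (by rw [he']; exact hwin)
    rw [he'] at hUc
    have hD : ∀ E : Finset (Sym2 W), (E : Set (Sym2 W)) ⊆ H.edgeSet →
        2 * E.card ≤ (k + 1) * (endpoints E).card := by
      intro E hE
      have h1 : (n : ℝ) ^ k * (q : ℝ) ^ e < 1 := by
        have : (0 : ℝ) < (n : ℝ) ^ k * (q : ℝ) ^ e := by positivity
        nlinarith [(Nat.cast_nonneg k : (0 : ℝ) ≤ k)]
      have h2 := hs.density hn h1 E hE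
      have h3 : k * (2 * E.card) ≤ k * ((k + 1) * (endpoints E).card) := by
        calc k * (2 * E.card) = 2 * (k * E.card) := by ring
          _ ≤ 2 * (e * (endpoints E).card) := Nat.mul_le_mul_left _ h2
          _ = 2 * e * (endpoints E).card := by ring
          _ = _ := by rw [he]; ring
      exact Nat.le_of_mul_le_mul_left h3 hk
    have hNU : N ≤ U.card * (k + 1) := by
      have h1 := CopyThreshold.card_cliques_le (k := k) hD U
      rw [Nat.choose_succ_self_right] at h1
      refine le_trans (Finset.card_le_card ?_) h1
      intro s hsm
      rw [Finset.mem_filter] at hsm ⊢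
      refine ⟨Finset.mem_powerset.2 fun v hv => ?_, hsm.2⟩
      have hcard := hsm.2.card_eq
      let c : Fin (k + 1) → W := fun i => (s.equivFin.symm (Fin.cast hcard.symm i) : s)
      have hinj : Function.Injective c := fun i j hij => by
        simpa [c, Subtype.coe_inj] using hij
      have hc : IsCopyMap (SimpleGraph.completeGraph (Fin (k + 1))) H c := by
        refine ⟨hinj, fun x y hxy => ?_⟩
        exact hsm.2.isClique (by simp [c]) (by simp [c]) (hinj.ne hxy)
      have := hU c hc (Fin.cast hcard (s.equivFin ⟨v, hv⟩))
      simpa [c] using this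
    calc (N : ℝ) ≤ (U.card : ℝ) * (k + 1) := by exact_mod_cast hNU
      _ ≤ (7 * ((k : ℝ) + 1) ^ 2 * (1 + e) * ((n : ℝ) ^ (k + 1) * (q : ℝ) ^ e)) * (k + 1) := by
          gcongr
      _ = (7 * ((k : ℝ) + 1) ^ 3 * (1 + e)) * ((n : ℝ) ^ (k + 1) * (q : ℝ) ^ e) := by ring
      _ ≤ t ^ 18 * ((n : ℝ) ^ (k + 1) * (q : ℝ) ^ e) := by
          gcongr
          calc 7 * ((k : ℝ) + 1) ^ 3 * (1 + e) ≤ t ^ 3 * t ^ 3 * t := by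
                gcongr
                calc (7 : ℝ) ≤ 2 ^ 3 := by norm_num
                  _ ≤ t ^ 3 := by gcongr
            _ = t ^ 7 := by ring
            _ ≤ t ^ 18 := pow_le_pow_right₀ (by linarith) (by norm_num)
      _ = _ := by rw [hsplit]
  push Not at hwin
  -- Degeneracy of order k suffices now: it costs 2^O(k) cliques per vertex, and the number n of
  -- vertices is at most n^(k+1) q^e up to a factor polynomial in k.
  by_cases hden : (n : ℝ) ^ 1 * (q : ℝ) ^ (2 * (k + 1)) < 1
  · have hD : ∀ E : Finset (Sym2 W), (E : Set (Sym2 W)) ⊆ H.edgeSet →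
        2 * E.card ≤ (4 * (k + 1)) * (endpoints E).card := by
      intro E hE
      have h2 := hs.density hn hden E hE
      linarith
    have h1 : N ≤ Fintype.card W * (4 * (k + 1)).choose k :=
      CopyThreshold.card_cliques_le hD Finset.univ
    have h2 : N ≤ n * 2 ^ (8 * e) := h1.trans (Nat.mul_le_mul hs.card_le
      ((Nat.choose_le_two_pow _ _).trans (Nat.pow_le_pow_right two_pos (by omega))))
    calc (N : ℝ) ≤ (n : ℝ) * 2 ^ (8 * e) := by exact_mod_cast h2
      _ = n * 1 * t ^ 8 := by rw [mul_one, ht, ← pow_mul, mul_comm e]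
      _ ≤ n * (55 * ((k : ℝ) + 1) ^ 2 * ((n : ℝ) ^ k * (q : ℝ) ^ e)) * t ^ 8 := by gcongr
      _ = (55 * ((k : ℝ) + 1) ^ 2) * t ^ 8 * ((n : ℝ) ^ (k + 1) * (q : ℝ) ^ e) := by ring
      _ ≤ (t ^ 6 * t ^ 2) * t ^ 8 * ((n : ℝ) ^ (k + 1) * (q : ℝ) ^ e) := by
          gcongr
          calc (55 : ℝ) ≤ 2 ^ 6 := by norm_num
            _ ≤ t ^ 6 := by gcongr
      _ = t ^ 16 * ((n : ℝ) ^ (k + 1) * (q : ℝ) ^ e) := by ring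
      _ ≤ t ^ 18 * ((n : ℝ) ^ (k + 1) * (q : ℝ) ^ e) := by
          gcongr
          · linarith
          · norm_num
      _ = _ := by rw [hsplit]
  push Not at hden
  -- Since q ≤ 1/2, n q^l < 1 for this l, so the degeneracy is always logarithmic. The resulting
  -- powers of log n are absorbed because q is now large in terms of n.
  set l := Nat.log 2 n + 1 with hl
  have hnl : n < 2 ^ l := Nat.lt_pow_succ_log_self one_lt_two n
  have hln : 2 ^ l ≤ 2 * n := by
    rw [hl, pow_succ, mul_comm]
    exact Nat.mul_le_mul_left 2 (Nat.pow_log_le_self 2 hn.ne')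
  have hD : ∀ E : Finset (Sym2 W), (E : Set (Sym2 W)) ⊆ H.edgeSet →
      2 * E.card ≤ (2 * l) * (endpoints E).card := by
    intro E hE
    have h1 : (n : ℝ) ^ 1 * (q : ℝ) ^ l < 1 := by
      calc (n : ℝ) ^ 1 * (q : ℝ) ^ l ≤ n * (1 / 2) ^ l := by rw [pow_one]; gcongr
        _ < 2 ^ l * (1 / 2) ^ l := by
            gcongr
            exact_mod_cast hnl
        _ = 1 := by rw [← mul_pow]; norm_num
    have h2 := hs.density hn h1 E hE
    linarith
  have h1 : N ≤ n * (2 * l) ^ k :=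
    (CopyThreshold.card_cliques_le hD Finset.univ).trans
      (Nat.mul_le_mul hs.card_le (Nat.choose_le_pow _ _))
  have hl2 : (2 * l) ^ 2 ≤ 16 * n := by
    have := sq_le_two_mul_two_pow l
    nlinarith
  -- Fourth powers keep exponents integral: (2l)^2 ≤ 16n makes (2l)^k at most (16n)^(k/2), while the
  -- failure of `hden` gives q^e ≥ n^(−k/4).
  have h2 : N ^ 4 ≤ 256 ^ k * n ^ (2 * k + 4) := by
    calc N ^ 4 ≤ (n * (2 * l) ^ k) ^ 4 := Nat.pow_le_pow_left h1 4
      _ = n ^ 4 * (((2 * l) ^ 2) ^ (2 * k)) := by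
          rw [← pow_mul, mul_pow n, ← pow_mul]; congr 2; ring
      _ ≤ n ^ 4 * ((16 * n) ^ (2 * k)) := by gcongr
      _ = (16 ^ 2) ^ k * n ^ (2 * k + 4) := by rw [mul_pow, ← pow_mul 16]; ring
      _ = _ := by norm_num
  have h3 : (n : ℝ) ^ (2 * k + 4) ≤ ((n : ℝ) ^ (k + 1) * (q : ℝ) ^ e) ^ 4 := by
    have h4 : (1 : ℝ) ≤ n ^ k * q ^ (4 * e) := by
      have : (1 : ℝ) ≤ ((n : ℝ) ^ 1 * (q : ℝ) ^ (2 * (k + 1))) ^ k := one_le_pow₀ hden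
      refine this.trans_eq ?_
      rw [mul_pow, pow_one, ← pow_mul, show 4 * e = 2 * (k + 1) * k by linarith]
    calc (n : ℝ) ^ (2 * k + 4) ≤ n ^ (3 * k + 4) * 1 := by
          rw [mul_one]
          exact pow_le_pow_right₀ hn1 (by omega)
      _ ≤ n ^ (3 * k + 4) * (n ^ k * q ^ (4 * e)) := by gcongr
      _ = _ := by rw [mul_pow, ← pow_mul, ← pow_mul]; ring
  have h5 : (N : ℝ) ^ 4 ≤ (4 ^ k * ((n : ℝ) ^ (k + 1) * (q : ℝ) ^ e)) ^ 4 := by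
    calc (N : ℝ) ^ 4 ≤ 256 ^ k * n ^ (2 * k + 4) := by exact_mod_cast h2
      _ ≤ 256 ^ k * ((n : ℝ) ^ (k + 1) * (q : ℝ) ^ e) ^ 4 := by gcongr
      _ = _ := by
        rw [mul_pow (4 ^ k), ← pow_mul 4, mul_comm k 4, pow_mul 4]
        norm_num
  refine (le_of_pow_le_pow_left₀ (by norm_num) (by positivity) h5).trans ?_
  gcongr
  calc (4 : ℝ) ^ k = 2 ^ (2 * k) := by rw [pow_mul]; norm_num
    _ ≤ 2 ^ (18 * e) := pow_le_pow_right₀ one_le_two (by omega)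

/-- The clique case: a `q`-sparse graph has fewer cliques than expected in `G_{n,p}`. -/
theorem IsSparse.copyCount_completeGraph_lt {W : Type*} [Fintype W] {H : SimpleGraph W} {n : ℕ}
    {q p : I} {L : ℝ} (hL : 2 ^ 21 ≤ L) (hs : IsSparse n q H) (hq : 0 < (q : ℝ))
    (hp : (p : ℝ) = L * q) {K : ℕ} (hK : 2 ≤ K) (hKn : K ≤ n) :
    (H.copyCount (SimpleGraph.completeGraph (Fin K)) : ℝ) <
      expectedCopies n p (SimpleGraph.completeGraph (Fin K)) := by
  classical
  obtain ⟨k, rfl⟩ : ∃ k, K = k + 1 := ⟨K - 1, by omega⟩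
  have hk : 1 ≤ k := by omega
  have hn : 0 < n := by omega
  have hq2 : (q : ℝ) ≤ 1 / 2 := by
    have := p.2.2
    nlinarith
  set e := (k + 1).choose 2 with hedef
  have he : 2 * e = (k + 1) * k := by
    have := Nat.triangle_succ k
    rw [hedef, Nat.choose_two_right, Nat.add_sub_cancel]
    exact Nat.mul_div_cancel' (by rw [mul_comm]; exact (Nat.even_mul_succ_self k).two_dvd)
  have hke : k ≤ e := by nlinarith
  have h1 : (H.copyCount (SimpleGraph.completeGraph (Fin (k + 1))) : ℝ) ≤
      (2 : ℝ) ^ (18 * e) * ((n : ℝ) ^ (k + 1) * (q : ℝ) ^ e) := by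
    refine le_trans ?_ (hs.card_cliques_le hn hq hq2 hk he)
    have := copyCount_completeGraph_le H (k + 1)
    rw [Finset.powerset_univ]
    exact_mod_cast this
  refine h1.trans_lt ?_
  rw [expectedCopies_eq]
  have he' : (SimpleGraph.completeGraph (Fin (k + 1))).edgeSet.ncard = e := ncard_edgeSet_top (k + 1)
  -- The factor (k+1)^(k+1) is not exponential in k, but k+1 ≤ 2^k makes it exponential in the
  -- number e of edges.
  have h2 : (n : ℝ) ^ (k + 1) ≤ 4 ^ e * (n.choose (k + 1) : ℝ) := by
    have h3 : (k + 1) ^ (k + 1) ≤ 4 ^ e := by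
      calc (k + 1) ^ (k + 1) ≤ (2 ^ k) ^ (k + 1) :=
            Nat.pow_le_pow_left (Nat.succ_le_of_lt Nat.lt_two_pow_self) _
        _ = 4 ^ e := by
            rw [← pow_mul, mul_comm k, ← he, pow_mul]; norm_num
    have h4 := (pow_le_pow_mul_choose hKn).trans (Nat.mul_le_mul_right _ h3)
    exact_mod_cast h4
  have h5 : (n.choose (k + 1) : ℝ) ≤
      (⊤ : SimpleGraph (Fin n)).copyCount (SimpleGraph.completeGraph (Fin (k + 1))) := by
    exact_mod_cast choose_le_copyCount_completeGraph n (k + 1)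
  have h6 : (0 : ℝ) < n.choose (k + 1) := by exact_mod_cast Nat.choose_pos hKn
  have h7 : (2 : ℝ) ^ (18 * e) * 4 ^ e < L ^ e := by
    calc (2 : ℝ) ^ (18 * e) * 4 ^ e = (2 ^ 20) ^ e := by
          rw [pow_mul, ← mul_pow]; norm_num
      _ < (2 ^ 21) ^ e := pow_lt_pow_left₀ (by norm_num) (by norm_num) (by omega)
      _ ≤ L ^ e := by gcongr
  have hqe : (0 : ℝ) < (q : ℝ) ^ e := by positivity
  rw [he', hp, mul_pow]
  calc (2 : ℝ) ^ (18 * e) * ((n : ℝ) ^ (k + 1) * (q : ℝ) ^ e)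
      ≤ 2 ^ (18 * e) * (4 ^ e * (n.choose (k + 1) : ℝ) * (q : ℝ) ^ e) := by gcongr
    _ = (2 ^ (18 * e) * 4 ^ e) * ((n.choose (k + 1) : ℝ) * (q : ℝ) ^ e) := by ring
    _ < L ^ e * ((n.choose (k + 1) : ℝ) * (q : ℝ) ^ e) := by gcongr
    _ = (n.choose (k + 1) : ℝ) * (L ^ e * (q : ℝ) ^ e) := by ring
    _ ≤ _ := by gcongr

open SimpleGraph (cycleGraph)

/-! ### Cycle graphs: balance and labelled versus unlabelled copies -/

section CycleGraph

variable {k : ℕ}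

lemma cycleGraph_adj_iff {x y : Fin (k + 1)} :
    (cycleGraph (k + 1)).Adj x y ↔ x ≠ y ∧ (y = x + 1 ∨ x = y + 1) := by
  rw [SimpleGraph.cycleGraph_eq_circulantGraph]
  simp only [SimpleGraph.circulantGraph_adj, Set.mem_singleton_iff, sub_eq_iff_eq_add, add_comm (1 : Fin (k + 1))]
  tauto

lemma fin_ne_add_one (hk : 1 ≤ k) (x : Fin (k + 1)) : x ≠ x + 1 := by
  obtain ⟨k, rfl⟩ : ∃ j, k = j + 1 := ⟨k - 1, by omega⟩
  intro h
  exact one_ne_zero (left_eq_add.1 h)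

lemma cycleGraph_adj_add_one (hk : 1 ≤ k) (x : Fin (k + 1)) :
    (cycleGraph (k + 1)).Adj x (x + 1) :=
  cycleGraph_adj_iff.2 ⟨fin_ne_add_one hk x, Or.inl rfl⟩

lemma mem_edgeSet_cycleGraph (hk : 1 ≤ k) {e : Sym2 (Fin (k + 1))} :
    e ∈ (cycleGraph (k + 1)).edgeSet ↔ ∃ x, s(x, x + 1) = e := by
  constructor
  · induction e with
    | _ x y =>
      intro h
      rcases (cycleGraph_adj_iff.1 h).2 with h | h
      · exact ⟨x, congrArg (fun z => s(x, z)) h.symm⟩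
      · exact ⟨y, Sym2.eq_swap.trans (congrArg (fun z => s(z, y)) h.symm)⟩
  · rintro ⟨x, rfl⟩
    exact cycleGraph_adj_add_one hk x

/-- The only danger is an edge traversed in both directions, which would need 1 + 1 = 0; hence at
least three vertices. -/
lemma cycle_edge_injective (hk : 2 ≤ k) :
    Function.Injective fun x : Fin (k + 1) => s(x, x + 1) := by
  intro x y hxy
  rcases Sym2.eq_iff.1 hxy with ⟨h, -⟩ | ⟨h1, h2⟩
  · exact h
  · rw [h1, add_assoc] at h2
    have h3 : (1 + 1 : Fin (k + 1)) = 0 := add_eq_left.1 h2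
    have h4 := congrArg Fin.val h3
    obtain ⟨k, rfl⟩ : ∃ j, k = j + 2 := ⟨k - 2, by omega⟩
    simp only [Fin.val_add, Fin.val_one, Fin.val_zero] at h4
    rw [Nat.mod_eq_of_lt (by omega)] at h4
    omega

lemma ncard_edgeSet_cycleGraph (hk : 2 ≤ k) : (cycleGraph (k + 1)).edgeSet.ncard = k + 1 := by
  have : (cycleGraph (k + 1)).edgeSet = Set.range fun x : Fin (k + 1) => s(x, x + 1) := by
    ext e
    exact mem_edgeSet_cycleGraph (by omega)
  rw [this, Set.ncard_range_of_injective (cycle_edge_injective hk), Nat.card_fin]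

/-- A nonempty set of residues closed under subtracting `1` contains everything. -/
lemma eq_univ_of_sub_one_mem {A : Finset (Fin (k + 1))} (hA : A.Nonempty)
    (hsub : ∀ x ∈ A, x - 1 ∈ A) : A = Finset.univ := by
  obtain ⟨a, ha⟩ := hA
  have h : ∀ j : Fin (k + 1), a - j ∈ A := by
    intro j
    induction j using Fin.induction with
    | zero => simpa using ha
    | succ j ih =>
      rw [← Fin.coeSucc_eq_succ, ← sub_sub]
      exact hsub _ ih
  refine Finset.eq_univ_of_forall fun x => ?_
  have := h (a - x)
  rwa [sub_sub_cancel] at this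

/-- A nonempty proper set `A` meets at least |A|+1 edges: the edge following each element, and the
one before some element whose predecessor is outside. Then |A|+1 ≤ k gives the inequality. -/
lemma isBalanced_cycleGraph (hk : 2 ≤ k) : IsBalanced (cycleGraph (k + 1)) where
  exists_adj x := ⟨x + 1, cycleGraph_adj_add_one (by omega) x⟩
  transitive x := by
    refine ⟨⟨Equiv.addRight x, ?_⟩, zero_add x⟩
    intro a b
    rw [cycleGraph_adj_iff, cycleGraph_adj_iff]
    simp only [Equiv.coe_addRight, ne_eq, add_left_inj, add_right_comm _ x]
  balanced A hA hcard := by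
    classical
    set B := A ∪ A.image (fun x => x - 1) with hB
    have hAB : A.card < B.card := by
      refine Finset.card_lt_card (Finset.ssubset_iff_subset_ne.2 ⟨Finset.subset_union_left, ?_⟩)
      intro h
      have := eq_univ_of_sub_one_mem hA fun x hx => by
        rw [h]
        exact Finset.mem_union_right _ (Finset.mem_image_of_mem _ hx)
      rw [this, Finset.card_univ, Fintype.card_fin] at hcard
      omega
    have hBM : B.card ≤ (edgesMeeting (cycleGraph (k + 1)) A).card := by
      refine Finset.card_le_card_of_injOn (fun x => s(x, x + 1)) ?_
        (cycle_edge_injective hk).injOn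
      intro x hx
      refine Finset.mem_coe.2 (mem_edgesMeeting.2
        ⟨(mem_edgeSet_cycleGraph (by omega)).2 ⟨x, rfl⟩, ?_⟩)
      rcases Finset.mem_union.1 (Finset.mem_coe.1 hx) with h | h
      · exact ⟨x, h, by simp⟩
      · obtain ⟨y, hy, rfl⟩ := Finset.mem_image.1 h
        exact ⟨y, hy, by simp⟩
    rw [ncard_edgeSet_cycleGraph hk]
    nlinarith

lemma isCopyMap_cycleGraph_iff {W : Type*} {H : SimpleGraph W} (hk : 1 ≤ k)
    {c : Fin (k + 1) → W} : IsCopyMap (cycleGraph (k + 1)) H c ↔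
      Function.Injective c ∧ ∀ x, H.Adj (c x) (c (x + 1)) := by
  refine and_congr_right fun _ => ⟨fun h x => h _ _ (cycleGraph_adj_add_one hk x), ?_⟩
  intro h x y hxy
  rcases (cycleGraph_adj_iff.1 hxy).2 with rfl | rfl
  · exact h x
  · exact (h y).symm

/-- Few labelled cycles have the same edges. -/
lemma card_filter_cycle_le {W : Type*} [Fintype W] [DecidableEq W]
    (S : Finset (Fin (k + 1) → W)) (hS : ∀ c ∈ S, Function.Injective c)
    (hsame : ∀ c ∈ S, ∀ c' ∈ S, ∀ x, ∃ y, s(c x, c (x + 1)) = s(c' y, c' (y + 1))) :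
    S.card ≤ (k + 1) * 2 ^ (k + 1) := by
  classical
  rcases S.eq_empty_or_nonempty with rfl | ⟨c₀, hc₀⟩
  · simp
  -- Read along a fixed cycle, any other one moves by ±1 at each step, so a starting index and one
  -- bit per step determine it. The loss against the dihedral count is only exponential.
  have hidx : ∀ c ∈ S, ∃ g : Fin (k + 1) → Fin (k + 1), (∀ x, c x = c₀ (g x)) ∧
      ∀ x, g (x + 1) = g x + 1 ∨ g (x + 1) = g x - 1 := by
    intro c hc
    have h1 : ∀ x, ∃ y, c x = c₀ y := by
      intro x
      obtain ⟨y, hy⟩ := hsame c hc c₀ hc₀ x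
      rcases Sym2.eq_iff.1 hy with ⟨h, -⟩ | ⟨h, -⟩
      · exact ⟨_, h⟩
      · exact ⟨_, h⟩
    choose g hg using h1
    refine ⟨g, hg, fun x => ?_⟩
    obtain ⟨y, hy⟩ := hsame c hc c₀ hc₀ x
    rw [hg, hg] at hy
    rcases Sym2.eq_iff.1 hy with ⟨h, h'⟩ | ⟨h, h'⟩
    · left
      rw [hS c₀ hc₀ h, hS c₀ hc₀ h']
    · right
      rw [hS c₀ hc₀ h, hS c₀ hc₀ h', add_sub_cancel_right]
  choose! g hg hstep using hidx
  have : S.card ≤ (Finset.univ : Finset (Fin (k + 1) × (Fin (k + 1) → Bool))).card := by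
    refine Finset.card_le_card_of_injOn
      (fun c => (g c 0, fun x => decide (g c (x + 1) = g c x + 1))) (fun _ _ => by simp) ?_
    intro c hc c' hc' h
    simp only [Prod.mk.injEq, funext_iff, decide_eq_decide] at h
    have heq : ∀ j, g c j = g c' j := by
      intro j
      induction j using Fin.induction with
      | zero => exact h.1
      | succ j ih =>
        rw [← Fin.coeSucc_eq_succ]
        have hj := h.2 j.castSucc
        have h1 := hstep c hc j.castSucc
        have h2 := hstep c' hc' j.castSucc
        by_cases hq : g c (j.castSucc + 1) = g c j.castSucc + 1
        · rw [hq, hj.1 hq, ih]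
        · rw [h1.resolve_left hq, h2.resolve_left (fun h => hq (hj.2 h)), ih]
    ext x
    rw [hg c hc, hg c' hc', heq]
  simpa [Finset.card_univ, mul_comm] using this

lemma descFactorial_le_copyCount_cycleGraph (hk : 2 ≤ k) (n : ℕ) :
    n.descFactorial (k + 1) ≤
      (⊤ : SimpleGraph (Fin n)).copyCount (cycleGraph (k + 1)) * ((k + 1) * 2 ^ (k + 1)) := by
  classical
  let toCopy : (Fin (k + 1) ↪ Fin n) → (cycleGraph (k + 1)).Copy (⊤ : SimpleGraph (Fin n)) :=
    fun c => ⟨⟨c, fun {a b} h => c.injective.ne h.ne⟩, c.injective⟩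
  have h1 : n.descFactorial (k + 1) = (Finset.univ : Finset (Fin (k + 1) ↪ Fin n)).card := by
    rw [Finset.card_univ, Fintype.card_embedding_eq, Fintype.card_fin, Fintype.card_fin]
  rw [h1, mul_comm, SimpleGraph.copyCount_eq_card_image_copyToSubgraph]
  refine Finset.card_le_mul_card_image_of_maps_to (f := fun c => (toCopy c).toSubgraph) ?_ _ ?_
  · intro c _
    exact Finset.mem_image_of_mem _ (Finset.mem_univ _)
  · intro A _
    rw [← Finset.card_image_of_injective _
      (DFunLike.coe_injective : Function.Injective fun c : Fin (k + 1) ↪ Fin n => (c : _ → _))]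
    refine card_filter_cycle_le _ ?_ ?_
    · intro c hc
      obtain ⟨c, -, rfl⟩ := Finset.mem_image.1 hc
      exact c.injective
    · intro c hc c' hc' x
      obtain ⟨c, hcA, rfl⟩ := Finset.mem_image.1 hc
      obtain ⟨c', hcA', rfl⟩ := Finset.mem_image.1 hc'
      have hA : (toCopy c).toSubgraph = (toCopy c').toSubgraph :=
        (Finset.mem_filter.1 hcA).2.trans (Finset.mem_filter.1 hcA').2.symm
      have hadj : (toCopy c).toSubgraph.Adj (c x) (c (x + 1)) :=
        ⟨x, x + 1, cycleGraph_adj_add_one (by omega) x, rfl, rfl⟩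
      rw [hA] at hadj
      obtain ⟨a, b, hab, ha, hb⟩ := hadj
      have ha : c' a = c x := ha
      have hb : c' b = c (x + 1) := hb
      rcases (cycleGraph_adj_iff.1 hab).2 with rfl | rfl
      · exact ⟨a, by rw [ha, hb]⟩
      · exact ⟨b, by rw [ha, hb, Sym2.eq_swap]⟩

end CycleGraph

/-! ### Counting walks and cycles through random walk weights -/

section Walks

variable {W : Type*}

/-- `p` is the sequence of vertices of a walk in `G`. -/
def IsWalk (G : SimpleGraph W) {j : ℕ} (p : Fin (j + 1) → W) : Prop :=
  ∀ l : Fin j, G.Adj (p l.castSucc) (p l.succ)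

lemma isWalk_snoc {G : SimpleGraph W} {j : ℕ} {p : Fin (j + 1) → W} {x : W} :
    IsWalk G (Fin.snoc p x : Fin (j + 2) → W) ↔ IsWalk G p ∧ G.Adj (p (Fin.last j)) x := by
  unfold IsWalk
  rw [Fin.forall_fin_succ']
  simp only [Fin.snoc_castSucc, Fin.succ_last, Fin.snoc_last, ← Fin.castSucc_succ]

variable [Fintype W] {G : SimpleGraph W} [DecidableRel G.Adj]

open Classical in
/-- The total probability of the paths of a random walk is at most that of the starting points. -/
lemma sum_walk_le (G : SimpleGraph W) [DecidableRel G.Adj] {g : W → ℝ} (hg : ∀ x, 0 ≤ g x) (j : ℕ) :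
    ∑ p : Fin (j + 1) → W with IsWalk G p,
      g (p 0) * ∏ l : Fin j, (G.degree (p l.castSucc) : ℝ)⁻¹ ≤ ∑ x, g x := by
  induction j with
  | zero =>
    refine (Finset.sum_le_sum_of_subset_of_nonneg (Finset.filter_subset _ _)
      fun p _ _ => mul_nonneg (hg _) (Finset.prod_nonneg fun _ _ => by positivity)).trans ?_
    rw [← Equiv.sum_comp (Equiv.funUnique (Fin 1) W).symm]
    simp
  | succ j ih =>
    refine le_trans ?_ ih
    -- Split off the last vertex: its deg choices each weigh 1/deg, with total 1, or 0 at an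
    -- isolated vertex.
    rw [Finset.sum_filter, Finset.sum_filter, ← Equiv.sum_comp (Fin.snocEquiv fun _ => W),
      Fintype.sum_prod_type_right]
    refine Finset.sum_le_sum fun p _ => ?_
    have hsnoc : ∀ x, (Fin.snocEquiv fun _ => W) (x, p) = (Fin.snoc p x : Fin (j + 2) → W) :=
      fun _ => rfl
    simp only [hsnoc, isWalk_snoc]
    by_cases hp : IsWalk G p
    · simp only [hp, true_and, if_true]
      have h0 : ∀ x : W, (Fin.snoc p x : Fin (j + 2) → W) 0 = p 0 := fun x => by
        rw [← Fin.castSucc_zero, Fin.snoc_castSucc]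
      have hd : ∀ (x : W) (l : Fin (j + 1)),
          (G.degree ((Fin.snocEquiv fun _ => W) (x, p) l.castSucc) : ℝ) = G.degree (p l) :=
        fun x l => congrArg (fun v => (G.degree v : ℝ))
          (Fin.snoc_castSucc (α := fun _ => W) x p l)
      simp only [hd, h0, Fin.prod_univ_castSucc (n := j)]
      rw [← Finset.sum_filter, Finset.sum_const, nsmul_eq_mul]
      have hcard : (Finset.univ.filter fun x => G.Adj (p (Fin.last j)) x).card =
          G.degree (p (Fin.last j)) := by
        rw [← SimpleGraph.neighborFinset_eq_filter, SimpleGraph.card_neighborFinset_eq_degree]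
      rw [hcard]
      have hnn : 0 ≤ g (p 0) * ∏ l : Fin j, (G.degree (p l.castSucc) : ℝ)⁻¹ :=
        mul_nonneg (hg _) (Finset.prod_nonneg fun _ _ => by positivity)
      calc _ = (g (p 0) * ∏ l : Fin j, (G.degree (p l.castSucc) : ℝ)⁻¹) *
            ((G.degree (p (Fin.last j)) : ℝ) * (G.degree (p (Fin.last j)) : ℝ)⁻¹) := by ring
        _ ≤ _ * 1 := by
          gcongr
          exact mul_inv_le_one
        _ = _ := mul_one _
    · simp [hp]

open Classical in
/-- The paths with `i` edges from `u` to `w`. -/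
noncomputable def pathsBetween (G : SimpleGraph W) (i : ℕ) (u w : W) : Finset (Fin (i + 1) → W) :=
  Finset.univ.filter fun p => Function.Injective p ∧ IsWalk G p ∧ p 0 = u ∧ p (Fin.last i) = w

lemma mem_pathsBetween {G : SimpleGraph W} {i : ℕ} {u w : W} {p : Fin (i + 1) → W} :
    p ∈ pathsBetween G i u w ↔
      Function.Injective p ∧ IsWalk G p ∧ p 0 = u ∧ p (Fin.last i) = w := by
  simp [pathsBetween]

lemma IsWalk.degree_pos {i : ℕ} {p : Fin (i + 1) → W} (hp : IsWalk G p) (l : Fin i) :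
    0 < G.degree (p l.castSucc) :=
  (SimpleGraph.degree_pos_iff_exists_adj _ _).2 ⟨_, hp l⟩

/-- The number of paths is bounded by the largest product of degrees along them. -/
lemma card_pathsBetween_le {i : ℕ} {u w : W} {B : ℝ} (hB0 : 0 ≤ B)
    (hB : ∀ p ∈ pathsBetween G i u w, ∏ l : Fin i, (G.degree (p l.castSucc) : ℝ) ≤ B) :
    ((pathsBetween G i u w).card : ℝ) ≤ B := by
  classical
  rcases (pathsBetween G i u w).eq_empty_or_nonempty with h0 | ⟨p₀, hp₀⟩
  · simpa [h0] using hB0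
  have hpos : ∀ p ∈ pathsBetween G i u w, 0 < ∏ l : Fin i, (G.degree (p l.castSucc) : ℝ) :=
    fun p hp => Finset.prod_pos fun l _ => by
      exact_mod_cast (mem_pathsBetween.1 hp).2.1.degree_pos l
  have hB0 : 0 < B := (hpos p₀ hp₀).trans_le (hB p₀ hp₀)
  have h1 := sum_walk_le G (g := fun x => if x = u then (1 : ℝ) else 0)
    (fun x => by split_ifs <;> norm_num) i
  rw [Finset.sum_ite_eq' Finset.univ u, if_pos (Finset.mem_univ u)] at h1
  -- For the random walk started at `u`, each of these paths has probability at least 1/B.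
  have h2 : ((pathsBetween G i u w).card : ℝ) * B⁻¹ ≤ 1 := by
    refine le_trans ?_ h1
    rw [← nsmul_eq_mul, ← Finset.sum_const]
    refine (Finset.sum_le_sum (g := fun p : Fin (i + 1) → W =>
      (if p 0 = u then (1 : ℝ) else 0) * ∏ l : Fin i, (G.degree (p l.castSucc) : ℝ)⁻¹) ?_).trans
      (Finset.sum_le_sum_of_subset_of_nonneg ?_ ?_)
    · intro p hp
      rw [if_pos (mem_pathsBetween.1 hp).2.2.1, one_mul, Finset.prod_inv_distrib]
      exact inv_anti₀ (hpos p hp) (hB p hp)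
    · intro p hp
      exact Finset.mem_filter.2 ⟨Finset.mem_univ _, (mem_pathsBetween.1 hp).2.1⟩
    · intro p _ _
      exact mul_nonneg (by split_ifs <;> norm_num) (Finset.prod_nonneg fun _ _ => by positivity)
  rwa [← div_eq_mul_inv, div_le_one hB0] at h2

/-- Labelled cycles along which the product of the degrees is small are few, provided that two
vertices are joined by few paths. -/
lemma card_cycles_le {j i k : ℕ} (hi : 1 ≤ i) (hk : j + i = k) (hk2 : 1 ≤ k)
    {A : Finset (Fin (k + 1) → W)} (hA : ∀ c, c ∈ A ↔ IsCopyMap (cycleGraph (k + 1)) G c)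
    {D X : ℝ} (hD : 0 < D) (hX0 : 0 ≤ X) (hdeg : ∀ c ∈ A, ∏ x, (G.degree (c x) : ℝ) ≤ D ^ (k + 1))
    (hX : ∀ u w, u ≠ w → ((pathsBetween G i u w).card : ℝ) ≤ X) :
    (A.card : ℝ) ≤ (k + 1) * (D ^ j * (2 * (G.edgeFinset.card : ℝ)) * X) := by
  classical
  have hcyc : ∀ c ∈ A, Function.Injective c ∧ ∀ x, G.Adj (c x) (c (x + 1)) := fun c hc =>
    (isCopyMap_cycleGraph_iff hk2).1 ((hA c).1 hc)
  let t : Fin j → Fin (k + 1) := fun l => ⟨l + 1, by omega⟩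
  -- every cycle has a rotation with small degrees on a given interval
  have hrot : ∀ c ∈ A, ∃ r : Fin (k + 1), ∏ l : Fin j, (G.degree (c (t l + r)) : ℝ) ≤ D ^ j := by
    intro c hc
    by_contra! hlt
    have h1 : ∏ _r : Fin (k + 1), D ^ j <
        ∏ r : Fin (k + 1), ∏ l : Fin j, (G.degree (c (t l + r)) : ℝ) :=
      Finset.prod_lt_prod_of_nonempty (fun _ _ => by positivity) (fun r _ => hlt r)
        Finset.univ_nonempty
    rw [Finset.prod_comm] at h1
    have h2 : ∀ l, ∏ r : Fin (k + 1), (G.degree (c (t l + r)) : ℝ) ≤ D ^ (k + 1) := by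
      intro l
      refine le_of_eq_of_le ?_ (hdeg c hc)
      exact Equiv.prod_comp (Equiv.addLeft (t l)) fun x => (G.degree (c x) : ℝ)
    have h3 := Finset.prod_le_prod (s := Finset.univ) (f := fun l : Fin j =>
      ∏ r : Fin (k + 1), (G.degree (c (t l + r)) : ℝ)) (fun l _ => by positivity)
      (fun l _ => h2 l)
    have h4 := h1.trans_le h3
    simp only [Finset.prod_const, Finset.card_univ, Fintype.card_fin, ← pow_mul] at h4
    rw [mul_comm] at h4
    exact lt_irrefl _ h4
  set A' := A.filter fun c => ∏ l : Fin j, (G.degree (c (t l)) : ℝ) ≤ D ^ j with hA'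
  have hAA' : A.card ≤ (k + 1) * A'.card := by
    choose! r hr using hrot
    have : A.card ≤ ((Finset.univ : Finset (Fin (k + 1))) ×ˢ A').card := by
      refine Finset.card_le_card_of_injOn (fun c => (r c, fun x => c (x + r c))) ?_ ?_
      · intro c hc
        refine Finset.mem_coe.2 (Finset.mem_product.2 ⟨Finset.mem_univ _, ?_⟩)
        refine Finset.mem_filter.2 ⟨(hA _).2 ((isCopyMap_cycleGraph_iff hk2).2 ⟨?_, ?_⟩), hr c hc⟩
        · exact (hcyc c hc).1.comp (add_left_injective _)
        · intro x
          have := (hcyc c hc).2 (x + r c)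
          rwa [add_right_comm] at this
      · intro c _ c' _ h
        simp only [Prod.mk.injEq, funext_iff] at h
        ext x
        have := h.2 (x - r c)
        rwa [← h.1, sub_add_cancel] at this
    simpa using this
  -- split the cycle into a walk and a path
  let wk : (Fin (k + 1) → W) → (Fin (j + 1 + 1) → W) := fun c l => c ⟨l, by omega⟩
  let pt : (Fin (k + 1) → W) → (Fin (i + 1) → W) := fun c l => c (Fin.ofNat (k + 1) (j + 1 + l))
  have hofNat : ∀ l, Fin.ofNat (k + 1) (l + 1) = Fin.ofNat (k + 1) l + 1 := by
    intro l
    ext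
    simp [Fin.val_add]
  have hlast : Fin.ofNat (k + 1) (j + 1 + i) = 0 := by
    ext
    simp [show j + 1 + i = k + 1 by omega]
  have hwk0 : ∀ c, wk c 0 = c 0 := fun c => rfl
  have hwk : ∀ c ∈ A, IsWalk G (wk c) := by
    intro c hc l
    have := (hcyc c hc).2 ⟨l, by omega⟩
    have h2 : (⟨l, by omega⟩ : Fin (k + 1)) + 1 = ⟨l + 1, by omega⟩ := by
      ext
      simp only [Fin.val_add, Fin.val_one']
      rw [Nat.add_mod_mod, Nat.mod_eq_of_lt (by omega)]
    rw [h2] at this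
    exact this
  have hpt : ∀ c ∈ A, pt c ∈ pathsBetween G i (wk c (Fin.last (j + 1))) (wk c 0) := by
    intro c hc
    refine mem_pathsBetween.2 ⟨?_, ?_, ?_, ?_⟩
    · intro a b hab
      have h1 := congrArg Fin.val ((hcyc c hc).1 hab)
      simp only [Fin.ofNat_eq_cast, Fin.val_natCast] at h1
      have ha := a.2
      have hb := b.2
      ext
      have hcase : ∀ a' : ℕ, a' < i + 1 → (j + 1 + a') % (k + 1) = if a' = i then 0 else j + 1 + a' := by
        intro a' ha'
        split_ifs with h
        · rw [h, show j + 1 + i = k + 1 by omega, Nat.mod_self]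
        · exact Nat.mod_eq_of_lt (by omega)
      rw [hcase _ ha, hcase _ hb] at h1
      split_ifs at h1 <;> omega
    · intro l
      have := (hcyc c hc).2 (Fin.ofNat (k + 1) (j + 1 + l))
      rw [← hofNat] at this
      exact this
    · change c _ = c _
      congr 1
      ext
      simp [Nat.mod_eq_of_lt (show j + 1 < k + 1 by omega)]
    · change c _ = c _
      congr 1
  have hne : ∀ c ∈ A, wk c (Fin.last (j + 1)) ≠ wk c 0 := by
    intro c hc h
    have := congrArg Fin.val ((hcyc c hc).1 h)
    simp at this
  -- Starting from the degree measure, of total mass 2|E|, cancels the degree of the first vertex.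
  -- Only the j degrees controlled by the rotation remain.
  set wt : (Fin (j + 1 + 1) → W) → ℝ := fun p =>
    (G.degree (p 0) : ℝ) * ∏ l : Fin (j + 1), (G.degree (p l.castSucc) : ℝ)⁻¹ with hwt
  have hwt0 : ∀ p, 0 ≤ wt p := fun p => by positivity
  have hone : ∀ c ∈ A', 1 ≤ D ^ j * wt (wk c) := by
    intro c hc
    have hcA := (Finset.mem_filter.1 hc).1
    have hd := (Finset.mem_filter.1 hc).2
    have h0 : (0 : ℝ) < G.degree (wk c 0) := by
      exact_mod_cast (hwk c hcA).degree_pos 0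
    have h1 : wt (wk c) = (∏ l : Fin j, (G.degree (c (t l)) : ℝ))⁻¹ := by
      simp only [hwt]
      rw [Fin.prod_univ_succ, Fin.castSucc_zero, mul_inv_cancel_left₀ h0.ne',
        ← Finset.prod_inv_distrib]
      rfl
    have h2 : 0 < ∏ l : Fin j, (G.degree (c (t l)) : ℝ) := Finset.prod_pos fun l _ => by
      exact_mod_cast (hwk c hcA).degree_pos l.succ
    rw [h1, ← div_eq_mul_inv, one_le_div h2]
    exact hd
  have hfib : ∀ p ∈ A'.image wk, ((A'.filter fun c => wk c = p).card : ℝ) ≤ X := by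
    intro p hp
    obtain ⟨c₀, hc₀, rfl⟩ := Finset.mem_image.1 hp
    refine le_trans ?_ (hX _ _ (hne c₀ (Finset.mem_filter.1 hc₀).1))
    rw [Nat.cast_le]
    refine Finset.card_le_card_of_injOn pt ?_ ?_
    · intro c hc
      obtain ⟨hc, hcw⟩ := Finset.mem_filter.1 (Finset.mem_coe.1 hc)
      have := hpt c (Finset.mem_filter.1 hc).1
      rwa [hcw] at this
    · intro c hc c' hc' h
      have h1 := (Finset.mem_filter.1 (Finset.mem_coe.1 hc)).2.trans
        (Finset.mem_filter.1 (Finset.mem_coe.1 hc')).2.symm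
      ext x
      by_cases hx : x.val ≤ j + 1
      · exact congrFun h1 ⟨x, by omega⟩
      · have h2 := congrFun h ⟨x - (j + 1), by omega⟩
        simp only [pt] at h2
        have h3 : Fin.ofNat (k + 1) (j + 1 + (x.val - (j + 1))) = x := by
          ext
          simp [show j + 1 + (x.val - (j + 1)) = x by omega]
        rwa [h3] at h2
  have hsum : ∑ p ∈ A'.image wk, wt p ≤ 2 * (G.edgeFinset.card : ℝ) := by
    have h1 := sum_walk_le G (g := fun x => (G.degree x : ℝ)) (fun _ => by positivity) (j + 1)
    have h2 : ∑ x, (G.degree x : ℝ) = 2 * (G.edgeFinset.card : ℝ) := by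
      exact_mod_cast G.sum_degrees_eq_twice_card_edges
    rw [h2] at h1
    refine le_trans (Finset.sum_le_sum_of_subset_of_nonneg ?_ fun p _ _ => hwt0 p) h1
    intro p hp
    obtain ⟨c, hc, rfl⟩ := Finset.mem_image.1 hp
    exact Finset.mem_filter.2 ⟨Finset.mem_univ _, hwk c (Finset.mem_filter.1 hc).1⟩
  have hmain : (A'.card : ℝ) ≤ D ^ j * (2 * (G.edgeFinset.card : ℝ)) * X := by
    rw [Finset.card_eq_sum_card_image wk A', Nat.cast_sum]
    calc ∑ p ∈ A'.image wk, ((A'.filter fun c => wk c = p).card : ℝ)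
        ≤ ∑ p ∈ A'.image wk, (D ^ j * wt p) * X := by
          refine Finset.sum_le_sum fun p hp => (hfib p hp).trans ?_
          obtain ⟨c, hc, rfl⟩ := Finset.mem_image.1 hp
          exact le_mul_of_one_le_left hX0 (hone c hc)
      _ = D ^ j * (∑ p ∈ A'.image wk, wt p) * X := by
          rw [← Finset.sum_mul, ← Finset.mul_sum]
      _ ≤ _ := by gcongr
  calc (A.card : ℝ) ≤ (k + 1) * (A'.card : ℝ) := by exact_mod_cast hAA'
    _ ≤ _ := by gcongr

end Walks

/-! ### Paths between two vertices of a sparse graph -/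

section PathUnion

variable {W : Type*}

lemma path_edge_injective {i : ℕ} {p : Fin (i + 1) → W} (hp : Function.Injective p) :
    Function.Injective fun l : Fin i => s(p l.castSucc, p l.succ) := by
  intro a b hab
  rcases Sym2.eq_iff.1 hab with ⟨h, -⟩ | ⟨h1, h2⟩
  · exact Fin.castSucc_injective _ (hp h)
  · have h1 := congrArg Fin.val (hp h1)
    have h2 := congrArg Fin.val (hp h2)
    simp at h1 h2
    omega

variable [DecidableEq W]

/-- The edges of the walk `p`. -/
def pathEdges {i : ℕ} (p : Fin (i + 1) → W) : Finset (Sym2 W) :=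
  Finset.univ.image fun l : Fin i => s(p l.castSucc, p l.succ)

lemma mem_pathEdges {i : ℕ} {p : Fin (i + 1) → W} {e : Sym2 W} :
    e ∈ pathEdges p ↔ ∃ l : Fin i, s(p l.castSucc, p l.succ) = e := by
  simp [pathEdges]

/-- A nonempty set of interior vertices of a path meets more edges than it has elements. -/
lemma card_lt_card_path_edges {i : ℕ} {N : Finset (Fin (i + 1))} (hN : N.Nonempty)
    (h0 : 0 ∉ N) (hlast : Fin.last i ∉ N) :
    N.card < (Finset.univ.filter fun l : Fin i => l.castSucc ∈ N ∨ l.succ ∈ N).card := by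
  set M₁ := Finset.univ.filter fun l : Fin i => l.castSucc ∈ N with hM₁
  have h1 : N.card ≤ M₁.card := by
    rw [← Finset.card_image_of_injective M₁ (Fin.castSucc_injective i)]
    refine Finset.card_le_card fun x hx => ?_
    obtain ⟨y, rfl⟩ := Fin.exists_castSucc_eq.2 (fun h : x = Fin.last i => hlast (h ▸ hx))
    exact Finset.mem_image_of_mem _ (Finset.mem_filter.2 ⟨Finset.mem_univ _, hx⟩)
  refine h1.trans_lt (Finset.card_lt_card (Finset.ssubset_iff_subset_ne.2 ⟨?_, ?_⟩))
  · exact Finset.monotone_filter_right _ fun l _ h => Or.inl h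
  · intro heq
    -- The edge entering the least element of `N` has its other end outside `N`: this is the extra
    -- edge.
    set m := N.min' hN with hm
    have hmN : m ∈ N := N.min'_mem hN
    obtain ⟨y, hy⟩ := Fin.exists_succ_eq.2 (fun h : m = 0 => h0 (h ▸ hmN))
    have hmem : y ∈ M₁ := by
      rw [heq]
      exact Finset.mem_filter.2 ⟨Finset.mem_univ _, Or.inr (hy ▸ hmN)⟩
    have := N.min'_le _ (Finset.mem_filter.1 hmem).2
    rw [← hm, ← hy] at this
    exact absurd this (not_le.2 Fin.castSucc_lt_succ)

variable [Fintype W]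

/-- A union of paths of length `i + 1` with common ends has many edges. -/
lemma card_endpoints_biUnion_pathEdges_le {H : SimpleGraph W} {i : ℕ} {u w : W}
    (S : Finset (Fin (i + 1 + 1) → W)) (hS : S ⊆ pathsBetween H (i + 1) u w) :
    (i + 1) * (endpoints (S.biUnion pathEdges) ∪ {u, w}).card ≤
      i * (S.biUnion pathEdges).card + 2 * (i + 1) := by
  induction S using Finset.induction_on with
  | empty =>
    have : endpoints (∅ : Finset (Sym2 W)) = ∅ := by
      ext
      simp [mem_endpoints]
    rw [Finset.biUnion_empty, this, Finset.empty_union, mul_comm 2]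
    exact (Nat.mul_le_mul_left _ Finset.card_le_two).trans (Nat.le_add_left _ _)
  | insert p S hpS ih =>
    have ih := ih ((Finset.subset_insert _ _).trans hS)
    obtain ⟨hinj, -, hpu, hpw⟩ := mem_pathsBetween.1 (hS (Finset.mem_insert_self _ _))
    rw [Finset.biUnion_insert]
    set E := S.biUnion pathEdges with hE
    set V := endpoints E ∪ {u, w} with hV
    set N := Finset.univ.filter fun l => p l ∉ V with hN
    have h0 : (0 : Fin (i + 1 + 1)) ∉ N := by simp [hN, hV, hpu]
    have hl : Fin.last (i + 1) ∉ N := by simp [hN, hV, hpw]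
    have hverts : endpoints (pathEdges p ∪ E) ∪ {u, w} ⊆ V ∪ N.image p := by
      intro x hx
      by_cases hxV : x ∈ V
      · exact Finset.mem_union_left _ hxV
      refine Finset.mem_union_right _ ?_
      have hx' : x ∈ endpoints (pathEdges p ∪ E) := by
        rcases Finset.mem_union.1 hx with h | h
        · exact h
        · exact absurd (Finset.mem_union_right _ h) hxV
      obtain ⟨e, he, hxe⟩ := mem_endpoints.1 hx'
      rcases Finset.mem_union.1 he with he | he
      · obtain ⟨l, rfl⟩ := mem_pathEdges.1 he
        rcases Sym2.mem_iff.1 hxe with rfl | rfl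
        · exact Finset.mem_image_of_mem _ (Finset.mem_filter.2 ⟨Finset.mem_univ _, hxV⟩)
        · exact Finset.mem_image_of_mem _ (Finset.mem_filter.2 ⟨Finset.mem_univ _, hxV⟩)
      · exact absurd (Finset.mem_union_left _ (mem_endpoints.2 ⟨e, he, hxe⟩)) hxV
    have hvc : (endpoints (pathEdges p ∪ E) ∪ {u, w}).card ≤ V.card + N.card :=
      (Finset.card_le_card hverts).trans
        ((Finset.card_union_le _ _).trans (Nat.add_le_add_left Finset.card_image_le _))
    rcases N.eq_empty_or_nonempty with hNe | hNe
    · rw [hNe, Finset.card_empty, add_zero] at hvc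
      have h1 : E.card ≤ (pathEdges p ∪ E).card := Finset.card_le_card Finset.subset_union_right
      calc _ ≤ (i + 1) * V.card := Nat.mul_le_mul_left _ hvc
        _ ≤ _ := ih
        _ ≤ _ := by gcongr
    -- The new path brings |N| vertices and at least |N|+1 edges; |N| ≤ i gives (i+1)|N| ≤ i(|N|+1).
    · have hM := card_lt_card_path_edges hNe h0 hl
      set M := Finset.univ.filter fun l : Fin (i + 1) => l.castSucc ∈ N ∨ l.succ ∈ N with hMdef
      have hNi : N.card ≤ i := by
        have : M.card ≤ i + 1 := (Finset.card_le_univ _).trans (by simp)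
        omega
      have hdisj : Disjoint (M.image fun l => s(p l.castSucc, p l.succ)) E := by
        rw [Finset.disjoint_left]
        intro e he heE
        obtain ⟨l, hl, rfl⟩ := Finset.mem_image.1 he
        rcases (Finset.mem_filter.1 hl).2 with h | h
        · exact (Finset.mem_filter.1 h).2
            (Finset.mem_union_left _ (mem_endpoints.2 ⟨_, heE, by simp⟩))
        · exact (Finset.mem_filter.1 h).2
            (Finset.mem_union_left _ (mem_endpoints.2 ⟨_, heE, by simp⟩))
      have hEc : M.card + E.card ≤ (pathEdges p ∪ E).card := by
        rw [← Finset.card_image_of_injective M (path_edge_injective hinj),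
          ← Finset.card_union_of_disjoint hdisj]
        exact Finset.card_le_card (Finset.union_subset_union_left
          (Finset.image_subset_image (Finset.subset_univ _)))
      calc _ ≤ (i + 1) * (V.card + N.card) := Nat.mul_le_mul_left _ hvc
        _ = (i + 1) * V.card + (i + 1) * N.card := by ring
        _ ≤ (i * E.card + 2 * (i + 1)) + i * (N.card + 1) := by
            refine Nat.add_le_add ih ?_
            nlinarith
        _ = i * ((N.card + 1) + E.card) + 2 * (i + 1) := by ring
        _ ≤ i * (pathEdges p ∪ E).card + 2 * (i + 1) := by
            gcongr
            omega

lemma biUnion_pathEdges_subset {H : SimpleGraph W} {i : ℕ} {u w : W} :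
    ((pathsBetween H i u w).biUnion pathEdges : Set (Sym2 W)) ⊆ H.edgeSet := by
  intro e he
  obtain ⟨p, hp, hep⟩ := Finset.mem_biUnion.1 (Finset.mem_coe.1 he)
  obtain ⟨l, rfl⟩ := mem_pathEdges.1 hep
  exact (mem_pathsBetween.1 hp).2.1 l

/-- Two vertices of a sparse graph are joined by few short paths. -/
lemma IsSparse.card_pathsBetween_le {H : SimpleGraph W} {n : ℕ} {q : I} (hs : IsSparse n q H)
    (hn : 0 < n) {i : ℕ} (hi : (n : ℝ) ^ (2 * i + 1) * (q : ℝ) ^ (2 * i + 3) < 1) {u w : W} :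
    ((pathsBetween H (i + 1) u w).card : ℝ) ≤ 2 ^ (9 * i + 11) := by
  classical
  set E := (pathsBetween H (i + 1) u w).biUnion pathEdges with hE
  have hEH : (E : Set (Sym2 W)) ⊆ H.edgeSet := biUnion_pathEdges_subset
  set V := endpoints E ∪ {u, w} with hV
  have h1 : (i + 1) * V.card ≤ i * E.card + 2 * (i + 1) :=
    card_endpoints_biUnion_pathEdges_le _ subset_rfl
  have h2 : (2 * i + 1) * E.card ≤ (2 * i + 3) * V.card :=
    (hs.density hn hi E hEH).trans
      (Nat.mul_le_mul_left _ (Finset.card_le_card Finset.subset_union_left))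
  -- Counting inside the union of the paths loses no path, and there every degree is at least 2
  -- except possibly at the two ends.
  set G := SimpleGraph.fromEdgeSet (E : Set (Sym2 W)) with hG
  have hadj : ∀ p ∈ pathsBetween H (i + 1) u w, IsWalk G p := by
    intro p hp l
    rw [hG, SimpleGraph.fromEdgeSet_adj]
    exact ⟨Finset.mem_coe.2 (Finset.mem_biUnion.2 ⟨p, hp, mem_pathEdges.2 ⟨l, rfl⟩⟩),
      ((mem_pathsBetween.1 hp).2.1 l).ne⟩
  have hGE : G.edgeFinset = E := by
    ext e
    rw [SimpleGraph.mem_edgeFinset, hG, SimpleGraph.edgeSet_fromEdgeSet]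
    constructor
    · exact fun h => h.1
    · exact fun h => ⟨h, fun hd => H.not_isDiag_of_mem_edgeSet (hEH h) hd⟩
  have hHG : pathsBetween H (i + 1) u w ⊆ pathsBetween G (i + 1) u w := by
    intro p hp
    have hp' := mem_pathsBetween.1 hp
    exact mem_pathsBetween.2 ⟨hp'.1, hadj p hp, hp'.2.2⟩
  have hdeg2 : ∀ x ∈ V, x ≠ u → x ≠ w → 2 ≤ G.degree x := by
    intro x hx hxu hxw
    have hx : x ∈ endpoints E := by
      rcases Finset.mem_union.1 hx with h | h
      · exact h
      · simp [hxu, hxw] at h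
    obtain ⟨e, he, hxe⟩ := mem_endpoints.1 hx
    obtain ⟨p, hp, hep⟩ := Finset.mem_biUnion.1 he
    obtain ⟨l, rfl⟩ := mem_pathEdges.1 hep
    have hp' := mem_pathsBetween.1 hp
    obtain ⟨m, rfl⟩ : ∃ m, x = p m := by
      rcases Sym2.mem_iff.1 hxe with h | h
      · exact ⟨_, h⟩
      · exact ⟨_, h⟩
    obtain ⟨a, rfl⟩ := Fin.exists_succ_eq.2 (fun h : m = 0 => hxu (h ▸ hp'.2.2.1))
    obtain ⟨b, hb⟩ := Fin.exists_castSucc_eq.2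
      (fun h : a.succ = Fin.last (i + 1) => hxw (h ▸ hp'.2.2.2))
    rw [← SimpleGraph.card_neighborFinset_eq_degree]
    refine Finset.one_lt_card.2 ⟨p a.castSucc, ?_, p b.succ, ?_, ?_⟩
    · rw [SimpleGraph.mem_neighborFinset]
      exact (hadj p hp a).symm
    · rw [SimpleGraph.mem_neighborFinset, ← hb]
      exact hadj p hp b
    · intro h
      have h1 := congrArg Fin.val (hp'.1 h)
      have h2 := congrArg Fin.val hb
      simp at h1 h2
      omega
  refine le_trans (Nat.cast_le.2 (Finset.card_le_card hHG))
    (CopyThreshold.card_pathsBetween_le (by positivity) fun p hp => ?_)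
  obtain ⟨hinj, hwalk, hpu, hpw⟩ := mem_pathsBetween.1 hp
  -- The terms added on the right are nonnegative: `u` already occurs on the left and `w` is
  -- removed.
  have hsum : ∑ l : Fin (i + 1), ((G.degree (p l.castSucc) : ℤ) - 2) ≤
      ∑ x ∈ V.erase w, ((G.degree x : ℤ) - 2) := by
    rw [← Finset.sum_image (s := Finset.univ) (g := fun l : Fin (i + 1) => p l.castSucc)
      (f := fun x => (G.degree x : ℤ) - 2)
      (fun a _ b _ h => Fin.castSucc_injective _ (hinj h))]
    refine Finset.sum_le_sum_of_subset_of_nonneg ?_ ?_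
    · intro x hx
      obtain ⟨l, -, rfl⟩ := Finset.mem_image.1 hx
      refine Finset.mem_erase.2 ⟨?_, ?_⟩
      · rw [← hpw]
        exact hinj.ne l.castSucc_lt_last.ne
      · refine Finset.mem_union_left _ (mem_endpoints.2 ⟨s(p l.castSucc, p l.succ), ?_, by simp⟩)
        rw [← hGE, SimpleGraph.mem_edgeFinset]
        exact hwalk l
    · intro x hx hx'
      have hxu : x ≠ u := by
        rintro rfl
        refine hx' (Finset.mem_image.2 ⟨0, Finset.mem_univ _, ?_⟩)
        rw [Fin.castSucc_zero, hpu]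
      have := hdeg2 x (Finset.mem_of_mem_erase hx) hxu (Finset.ne_of_mem_erase hx)
      omega
  have hwV : w ∈ V := by simp [hV]
  have hsum2 : ∑ x ∈ V.erase w, ((G.degree x : ℤ) - 2) ≤ 2 * E.card - 2 * (V.card - 1) := by
    rw [Finset.sum_sub_distrib, Finset.sum_const, Finset.card_erase_of_mem hwV, nsmul_eq_mul,
      Nat.cast_sub (Finset.card_pos.2 ⟨w, hwV⟩)]
    have h3 : ∑ x ∈ V.erase w, (G.degree x : ℤ) ≤ 2 * E.card := by
      refine (Finset.sum_le_sum_of_subset_of_nonneg (Finset.subset_univ _)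
        fun _ _ _ => by positivity).trans ?_
      have hc : ∑ x, G.degree x = 2 * E.card := by
        refine G.sum_degrees_eq_twice_card_edges.trans
          (congrArg (2 * ·) (Eq.trans ?_ (congrArg Finset.card hGE)))
        congr!
      exact_mod_cast hc.le
    push_cast
    linarith
  have hexp : ∑ l : Fin (i + 1), (G.degree (p l.castSucc) - 1) ≤ 9 * i + 11 := by
    have h3 : ((∑ l : Fin (i + 1), (G.degree (p l.castSucc) - 1) : ℕ) : ℤ) =
        ∑ l : Fin (i + 1), ((G.degree (p l.castSucc) : ℤ) - 2) + (i + 1) := by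
      have : ((i : ℤ) + 1) = ∑ _l : Fin (i + 1), (1 : ℤ) := by simp
      rw [this, ← Finset.sum_add_distrib, Nat.cast_sum]
      refine Finset.sum_congr rfl fun l _ => ?_
      rw [Nat.cast_sub (hwalk.degree_pos l)]
      push_cast
      ring
    -- Combining `h1` and `h2` gives |E| ≤ 2(i+1)(2i+3), and then `h2` gives |E| − |V| ≤ 2|E|/(2i+3)
    -- ≤ 4(i+1).
    have h4 : ((E.card : ℤ) + 2 - V.card) ≤ 4 * i + 6 := by
      zify at h1 h2
      nlinarith
    zify
    zify at h3
    rw [h3]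
    linarith
  calc ∏ l : Fin (i + 1), (G.degree (p l.castSucc) : ℝ)
      ≤ ∏ l : Fin (i + 1), (2 : ℝ) ^ (G.degree (p l.castSucc) - 1) := by
        refine Finset.prod_le_prod (fun _ _ => by positivity) fun l _ => ?_
        have h3 := hwalk.degree_pos l
        have h4 : G.degree (p l.castSucc) ≤ 2 ^ (G.degree (p l.castSucc) - 1) := by
          have := (G.degree (p l.castSucc) - 1).lt_two_pow_self
          omega
        exact_mod_cast h4
    _ = 2 ^ ∑ l : Fin (i + 1), (G.degree (p l.castSucc) - 1) := Finset.prod_pow_eq_pow_sum _ _ _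
    _ ≤ _ := pow_le_pow_right₀ one_le_two hexp

/-- The number of paths between two vertices, bounded in terms of shorter paths. -/
lemma IsSparse.exists_card_pathsBetween_le {H : SimpleGraph W} {n : ℕ} {q : I}
    (hs : IsSparse n q H) (hn : 0 < n) {i : ℕ} (hi1 : 1 ≤ i) {κ : ℝ} (hκ : 0 ≤ κ)
    (hi : κ ^ (i + 1) * ((n : ℝ) ^ i * (q : ℝ) ^ (i + 1)) ≤ 1) {X : ℝ} (hX0 : 0 ≤ X) {u w : W}
    (hX : ∀ x, x ≠ w → ((pathsBetween H i x w).card : ℝ) ≤ X) :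
    ∃ e : ℕ, κ ^ e ≤ (n : ℝ) ^ 2 ∧ ((pathsBetween H (i + 1) u w).card : ℝ) ≤ e * X := by
  classical
  set P := pathsBetween H (i + 1) u w with hP
  set E := P.biUnion pathEdges with hE
  have hEH : (E : Set (Sym2 W)) ⊆ H.edgeSet := biUnion_pathEdges_subset
  set V := endpoints E ∪ {u, w} with hV
  have h1 : (i + 1) * V.card ≤ i * E.card + 2 * (i + 1) :=
    card_endpoints_biUnion_pathEdges_le _ subset_rfl
  have hn1 : (1 : ℝ) ≤ n := by exact_mod_cast hn
  have hq : (0 : ℝ) ≤ q := q.2.1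
  refine ⟨E.card, ?_, ?_⟩
  -- With (i+1)|V| ≤ i|E| + 2(i+1), sparsity becomes 1 ≤ n^(2(i+1)) (n^i q^(i+1))^|E|, and each edge
  -- costs a factor κ^(−(i+1)).
  · have h2 : 1 ≤ (n : ℝ) ^ V.card * (q : ℝ) ^ E.card := by
      refine (hs.one_le_pow_mul hn E hEH).trans ?_
      gcongr
      exact Finset.subset_union_left
    have h3 : 1 ≤ (n : ℝ) ^ (i * E.card + 2 * (i + 1)) * (q : ℝ) ^ (E.card * (i + 1)) := by
      refine (one_le_pow₀ h2 (n := i + 1)).trans ?_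
      rw [mul_pow, ← pow_mul, ← pow_mul, mul_comm V.card]
      gcongr
    have h4 : (κ ^ E.card) ^ (i + 1) ≤ ((n : ℝ) ^ 2) ^ (i + 1) := by
      calc (κ ^ E.card) ^ (i + 1)
          ≤ (κ ^ E.card) ^ (i + 1) *
            ((n : ℝ) ^ (i * E.card + 2 * (i + 1)) * (q : ℝ) ^ (E.card * (i + 1))) :=
            le_mul_of_one_le_right (by positivity) h3
        _ = ((n : ℝ) ^ 2) ^ (i + 1) *
            (κ ^ (i + 1) * ((n : ℝ) ^ i * (q : ℝ) ^ (i + 1))) ^ E.card := by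
            rw [mul_pow, mul_pow, ← pow_mul, ← pow_mul, ← pow_mul, ← pow_mul, ← pow_mul,
              pow_add]
            ring
        _ ≤ ((n : ℝ) ^ 2) ^ (i + 1) * 1 := by
            gcongr
            exact pow_le_one₀ (by positivity) hi
        _ = _ := mul_one _
    exact le_of_pow_le_pow_left₀ (by omega) (by positivity) h4
  -- Distinct second vertices give distinct edges at `u`; after the second vertex a path with i
  -- edges remains.
  · have himg : (P.image fun p => p 1).card ≤ E.card := by
      refine Finset.card_le_card_of_injOn (fun x => s(u, x)) ?_ ?_
      · intro x hx
        obtain ⟨p, hp, rfl⟩ := Finset.mem_image.1 (Finset.mem_coe.1 hx)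
        refine Finset.mem_coe.2 (Finset.mem_biUnion.2 ⟨p, hp, mem_pathEdges.2 ⟨0, ?_⟩⟩)
        rw [Fin.castSucc_zero, (mem_pathsBetween.1 hp).2.2.1, Fin.succ_zero_eq_one]
      · intro x _ y _ h
        exact Sym2.congr_right.1 h
    have hfib : ∀ x ∈ P.image fun p => p 1, ((P.filter fun p => p 1 = x).card : ℝ) ≤ X := by
      intro x hx
      obtain ⟨p₀, hp₀, rfl⟩ := Finset.mem_image.1 hx
      have hne : p₀ 1 ≠ w := by
        rw [← (mem_pathsBetween.1 hp₀).2.2.2]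
        refine (mem_pathsBetween.1 hp₀).1.ne fun h => ?_
        have := congrArg Fin.val h
        simp at this
        omega
      refine le_trans (Nat.cast_le.2 ?_) (hX _ hne)
      refine Finset.card_le_card_of_injOn Fin.tail ?_ ?_
      · intro p hp
        obtain ⟨hp, hp1⟩ := Finset.mem_filter.1 (Finset.mem_coe.1 hp)
        obtain ⟨hinj, hwalk, hpu, hpw⟩ := mem_pathsBetween.1 hp
        refine Finset.mem_coe.2 (mem_pathsBetween.2 ⟨?_, ?_, ?_, ?_⟩)
        · exact hinj.comp (Fin.succ_injective _)
        · intro l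
          exact hwalk l.succ
        · exact hp1
        · exact hpw
      · intro p hp p' hp' h
        have h1 := (mem_pathsBetween.1 (Finset.mem_filter.1 (Finset.mem_coe.1 hp)).1).2.2.1
        have h2 := (mem_pathsBetween.1 (Finset.mem_filter.1 (Finset.mem_coe.1 hp')).1).2.2.1
        rw [← Fin.cons_self_tail p, ← Fin.cons_self_tail p', h1, h2, h]
    rw [Finset.card_eq_sum_card_image (fun p => p 1) P, Nat.cast_sum]
    refine (Finset.sum_le_sum hfib).trans ?_
    rw [Finset.sum_const, nsmul_eq_mul]
    gcongr

end PathUnion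

/-! ### Degrees along a cycle -/

lemma le_of_one_le_pow_mul_choose {n K s : ℕ} {q : ℝ} (hq : 0 ≤ q) (hμ : 1 ≤ n * q)
    (h : 1 ≤ (n : ℝ) ^ K * ((K * n).choose s : ℝ) * q ^ (K + s)) : (s : ℝ) ≤ 8 * (K : ℝ) * (n * q) := by
  by_contra! hlt
  have h1 : (s : ℝ) ^ s * ((K * n).choose s : ℝ) ≤ (Real.exp 1 * (K * n)) ^ s := by
    have h2 := pow_self_le_exp_mul_factorial s
    have h3 : ((s.factorial : ℝ) * ((K * n).choose s : ℝ)) ≤ (K * n) ^ s := by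
      have : s.factorial * (K * n).choose s ≤ (K * n) ^ s := by
        rw [← Nat.descFactorial_eq_factorial_mul_choose]
        exact Nat.descFactorial_le_pow _ _
      exact_mod_cast this
    calc (s : ℝ) ^ s * ((K * n).choose s : ℝ)
        ≤ (Real.exp 1 ^ s * s.factorial) * ((K * n).choose s : ℝ) := by gcongr
      _ = Real.exp 1 ^ s * ((s.factorial : ℝ) * ((K * n).choose s : ℝ)) := by ring
      _ ≤ Real.exp 1 ^ s * (K * n) ^ s := by gcongr
      _ = _ := by rw [mul_pow (Real.exp 1)]
  have h2 : (s : ℝ) ^ s ≤ (n * q) ^ K * (Real.exp 1 * (K * (n * q))) ^ s := by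
    calc (s : ℝ) ^ s ≤ (s : ℝ) ^ s * ((n : ℝ) ^ K * ((K * n).choose s : ℝ) * q ^ (K + s)) :=
          le_mul_of_one_le_right (by positivity) h
      _ = ((s : ℝ) ^ s * ((K * n).choose s : ℝ)) * ((n * q) ^ K * q ^ s) := by
          rw [mul_pow, pow_add]; ring
      _ ≤ (Real.exp 1 * (K * n)) ^ s * ((n * q) ^ K * q ^ s) := by gcongr
      _ = _ := by simp only [mul_pow]; ring
  set μ : ℝ := n * q with hμdef
  have h3 : (8 * K * μ) ^ s ≤ (s : ℝ) ^ s := by gcongr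
  -- One factor e comes from s!; the spare one leaves e^s ≤ μ^K ≤ e^(Kμ), that is s ≤ Kμ,
  -- contradicting s > 8Kμ.
  have h4 : Real.exp 1 * Real.exp 1 ≤ 8 := by nlinarith [Real.exp_one_lt_d9, Real.exp_pos 1]
  rcases Nat.eq_zero_or_pos K with rfl | hK
  · simp only [zero_mul, pow_zero, one_mul, zero_add, CharP.cast_eq_zero, mul_zero,
      Nat.cast_pos] at h hlt
    rw [Nat.choose_eq_zero_of_lt hlt] at h
    norm_num at h
  have hKμ : 0 < K * μ := by positivity
  have h5 : (Real.exp 1 * (K * μ)) ^ s * Real.exp 1 ^ s ≤ (8 * K * μ) ^ s := by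
    rw [← mul_pow]
    refine pow_le_pow_left₀ (by positivity) ?_ s
    nlinarith
  have h6 : Real.exp 1 ^ s ≤ μ ^ K := by
    refine le_of_mul_le_mul_left ?_ (by positivity : 0 < (Real.exp 1 * (K * μ)) ^ s)
    exact (h5.trans (h3.trans h2)).trans_eq (mul_comm _ _)
  have h7 : μ ^ K ≤ Real.exp μ ^ K := by
    gcongr
    linarith [Real.add_one_le_exp μ]
  have h8 := h6.trans h7
  rw [← Real.exp_nat_mul, ← Real.exp_nat_mul, Real.exp_le_exp] at h8
  nlinarith

section CycleDegrees

variable {W : Type*} [Fintype W] {H : SimpleGraph W} {n k : ℕ} {q : I}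

/-- A cycle has as many edges as vertices, so sparsity reads 1 ≤ (nq)^(k+1). -/
lemma IsSparse.one_le_of_cycle (hs : IsSparse n q H) (hn : 0 < n) (hk : 2 ≤ k)
    {c : Fin (k + 1) → W} (hc : IsCopyMap (cycleGraph (k + 1)) H c) : (1 : ℝ) ≤ n * q := by
  classical
  have h1 := hs.one_le_pow_mul hn _ (blockEdges_subset hc)
  rw [card_blockEdges hc.1, ncard_edgeSet_cycleGraph hk] at h1
  have h2 : (endpoints (blockEdges (cycleGraph (k + 1)) c)).card ≤ k + 1 := by
    have : endpoints (blockEdges (cycleGraph (k + 1)) c) ⊆ Finset.univ.image c := by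
      intro v hv
      obtain ⟨e, he, hve⟩ := mem_endpoints.1 hv
      obtain ⟨e', -, rfl⟩ := mem_blockEdges.1 he
      obtain ⟨x, -, rfl⟩ := Sym2.mem_map.1 hve
      exact Finset.mem_image_of_mem _ (Finset.mem_univ _)
    exact (Finset.card_le_card this).trans (Finset.card_image_le.trans (by simp))
  have hn1 : (1 : ℝ) ≤ n := by exact_mod_cast hn
  have hq : (0 : ℝ) ≤ q := q.2.1
  have h3 : (1 : ℝ) ≤ (n * q) ^ (k + 1) := by
    rw [mul_pow]
    refine h1.trans ?_
    gcongr
  by_contra! hlt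
  exact absurd h3 (not_le.2 (pow_lt_one₀ (by positivity) hlt (by omega)))

/-- In a sparse graph, the average degree along a cycle is small. -/
lemma IsSparse.sum_degree_cycle_le [DecidableRel H.Adj] (hs : IsSparse n q H) (hn : 0 < n)
    (hk : 2 ≤ k) {c : Fin (k + 1) → W} (hc : IsCopyMap (cycleGraph (k + 1)) H c) :
    ∑ x, (H.degree (c x) : ℝ) ≤ 18 * (n * q) * (k + 1) := by
  classical
  have hμ := hs.one_le_of_cycle hn hk hc
  have hq : (0 : ℝ) ≤ q := q.2.1
  set B := blockEdges (cycleGraph (k + 1)) c with hB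
  set E := H.edgeFinset.filter fun e => ∃ x, c x ∈ e with hE
  have hEH : (E : Set (Sym2 W)) ⊆ H.edgeSet := fun e he => by
    simpa using (Finset.mem_filter.1 (Finset.mem_coe.1 he)).1
  have hBE : B ⊆ E := by
    intro e he
    refine Finset.mem_filter.2 ⟨by simpa using blockEdges_subset hc (Finset.mem_coe.2 he), ?_⟩
    obtain ⟨e', he', rfl⟩ := mem_blockEdges.1 he
    induction e' with
    | _ x y => exact ⟨x, by simp⟩
  have hBc : B.card = k + 1 := by
    rw [hB, card_blockEdges hc.1, ncard_edgeSet_cycleGraph hk]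
  set R := E \ B with hR
  have hEc : E.card = k + 1 + R.card := by
    rw [hR, Finset.card_sdiff_of_subset hBE, hBc]
    have := Finset.card_le_card hBE
    omega
  set s := R.card with hsdef
  have hrep : ∀ e ∈ R, ∃ z : Fin (k + 1) × W, e = s(c z.1, z.2) := by
    intro e he
    obtain ⟨x, hx⟩ := (Finset.mem_filter.1 (Finset.mem_sdiff.1 he).1).2
    obtain ⟨y, rfl⟩ := hx
    exact ⟨(x, y), rfl⟩
  have : Nonempty (Fin (k + 1) × W) := ⟨(0, c 0)⟩
  choose! z hz using hrep
  have hzE : ∀ e ∈ R, (z e).2 ∈ endpoints E := fun e he =>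
    mem_endpoints.2 ⟨e, (Finset.mem_sdiff.1 he).1, by
      have h := Sym2.mem_mk_right (c (z e).1) (z e).2
      rwa [← hz e he] at h⟩
  -- An edge off the cycle is coded by a position on the cycle and the image of its other end, and
  -- the s such pairs are recorded as an unordered set. Labelling all outer vertices in order would
  -- lose the factor s!.
  have hcode := hs.one_le_card_mul hn E hEH
    ((Finset.univ : Finset (Fin (k + 1) → Fin n)) ×ˢ
      Finset.powersetCard s (Finset.univ : Finset (Fin (k + 1) × Fin n)))
    (fun f => (f ∘ c, R.image fun e => ((z e).1, f (z e).2))) (by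
      intro f hf
      refine Finset.mem_product.2 ⟨Finset.mem_univ _, Finset.mem_powersetCard.2
        ⟨Finset.subset_univ _, Finset.card_image_of_injOn ?_⟩⟩
      intro e he e' he' h
      simp only [Prod.mk.injEq] at h
      rw [hz e he, hz e' he', h.1, hf (hzE e he) (hzE e' he') h.2])
    (by
      intro f g hf hg hfg
      simp only [Prod.mk.injEq] at hfg
      have key : ∀ f : W → Fin n, E.image (Sym2.map f) =
          blockEdges (cycleGraph (k + 1)) (f ∘ c) ∪
            (R.image fun e => ((z e).1, f (z e).2)).image fun t => s((f ∘ c) t.1, t.2) := by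
        intro f
        rw [← Finset.sdiff_union_of_subset hBE, Finset.image_union, Finset.union_comm,
          Finset.image_image, blockEdges_comp]
        congr 1
        refine Finset.image_congr fun e he => ?_
        have := hz e he
        conv_lhs => rw [this]
        rfl
      rw [key f, key g, hfg.1, hfg.2])
  rw [Finset.card_product, Finset.card_powersetCard, Finset.card_univ, Finset.card_univ,
    Fintype.card_fun, Fintype.card_prod, Fintype.card_fin, Fintype.card_fin, hEc] at hcode
  have hs8 : (s : ℝ) ≤ 8 * ((k + 1 : ℕ) : ℝ) * (n * q) :=
    le_of_one_le_pow_mul_choose hq hμ (by exact_mod_cast hcode)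
  have hdeg : ∑ x, H.degree (c x) ≤ 2 * E.card := by
    rw [← sum_card_filter_mem hEH]
    calc ∑ x, H.degree (c x) ≤ ∑ x, (E.filter fun e => c x ∈ e).card := by
          refine Finset.sum_le_sum fun x _ => ?_
          rw [← SimpleGraph.card_neighborFinset_eq_degree]
          refine Finset.card_le_card_of_injOn (fun y => s(c x, y)) ?_ ?_
          · intro y hy
            have hy : H.Adj (c x) y := by simpa using hy
            exact Finset.mem_coe.2 (Finset.mem_filter.2
              ⟨Finset.mem_filter.2 ⟨by simpa using hy, x, by simp⟩, by simp⟩)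
          · intro y _ y' _ h
            exact Sym2.congr_right.1 h
      _ = ∑ v ∈ Finset.univ.image c, (E.filter fun e => v ∈ e).card :=
          (Finset.sum_image (f := fun v => (E.filter fun e => v ∈ e).card)
            (fun _ _ _ _ h => hc.1 h)).symm
      _ ≤ _ := Finset.sum_le_sum_of_subset (Finset.subset_univ _)
  have hdegR : ∑ x, (H.degree (c x) : ℝ) ≤ 2 * ((k + 1 : ℝ) + s) := by
    have h1 : ((∑ x, H.degree (c x) : ℕ) : ℝ) ≤ ((2 * (k + 1 + s) : ℕ) : ℝ) := by
      rw [← hEc]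
      exact_mod_cast hdeg
    push_cast at h1
    exact h1
  push_cast at hs8
  -- The constant 18 arises from 2(1 + 8nq) with nq ≥ 1.
  nlinarith [(Nat.cast_nonneg k : (0 : ℝ) ≤ k)]

/-- A form of the inequality of arithmetic and geometric means. -/
lemma prod_le_pow_of_sum_le {ι : Type*} [Fintype ι] {a : ι → ℝ} (ha : ∀ x, 0 ≤ a x) {D : ℝ}
    (hD : 0 < D) (hsum : ∑ x, a x ≤ D * Fintype.card ι) : ∏ x, a x ≤ D ^ Fintype.card ι := by
  calc ∏ x, a x ≤ ∏ x, D * Real.exp (a x / D - 1) := by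
        refine Finset.prod_le_prod (fun x _ => ha x) fun x _ => ?_
        have := Real.add_one_le_exp (a x / D - 1)
        rw [sub_add_cancel, div_le_iff₀ hD] at this
        linarith
    _ = D ^ Fintype.card ι * Real.exp (∑ x, (a x / D - 1)) := by
        rw [Finset.prod_mul_distrib, Finset.prod_const, Finset.card_univ, Real.exp_sum]
    _ ≤ D ^ Fintype.card ι * 1 := by
        gcongr
        rw [Real.exp_le_one_iff, Finset.sum_sub_distrib, ← Finset.sum_div, Finset.sum_const,
          Finset.card_univ, nsmul_eq_mul, mul_one, sub_nonpos, div_le_iff₀ hD]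
        linarith
    _ = _ := mul_one _

lemma IsSparse.prod_degree_cycle_le [DecidableRel H.Adj] (hs : IsSparse n q H) (hn : 0 < n)
    (hk : 2 ≤ k) {c : Fin (k + 1) → W} (hc : IsCopyMap (cycleGraph (k + 1)) H c) :
    ∏ x, (H.degree (c x) : ℝ) ≤ (18 * (n * q)) ^ (k + 1) := by
  have hμ := hs.one_le_of_cycle hn hk hc
  have := prod_le_pow_of_sum_le (a := fun x => (H.degree (c x) : ℝ)) (fun _ => by positivity)
    (D := 18 * (n * q)) (by linarith) (by
      rw [Fintype.card_fin]
      push_cast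
      exact hs.sum_degree_cycle_le hn hk hc)
  rwa [Fintype.card_fin] at this

end CycleDegrees

/-! ### Counting cycles in the rare and the frequent regime -/

lemma pow_three_le_four_mul_two_pow (m : ℕ) : m ^ 3 ≤ 4 * 2 ^ m := by
  rcases Nat.lt_or_ge m 6 with h | h
  · interval_cases m <;> norm_num
  · induction m, h using Nat.le_induction with
    | base => norm_num
    | succ m hm ih =>
      rw [pow_succ 2 m]
      nlinarith [Nat.mul_le_mul hm hm, Nat.mul_le_mul (Nat.mul_le_mul hm hm) hm]

/-- Lets the base of (18nq)^(k+1) absorb the threshold constant of the rare regime. -/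
lemma le_eighteen_pow {m : ℕ} (hm : 3 ≤ m) : 55 * m ^ 2 ≤ 18 ^ m := by
  induction m, hm using Nat.le_induction with
  | base => norm_num
  | succ m hm ih =>
    rw [pow_succ 18 m]
    nlinarith

/-- The bound log z ≤ z at z = √x, squared. -/
lemma log_sq_le {x : ℝ} (hx : 1 ≤ x) : Real.log x ^ 2 ≤ 4 * x := by
  have h1 : Real.log √x ≤ √x := by
    have := Real.log_le_sub_one_of_pos (Real.sqrt_pos.2 (show 0 < x by linarith))
    linarith
  rw [Real.log_sqrt (by linarith)] at h1
  have h2 := Real.log_nonneg hx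
  have h3 := Real.sq_sqrt (show 0 ≤ x by linarith)
  nlinarith [Real.sqrt_nonneg x]

/-- A number `N` with `18 ^ N ≤ y ^ a` is at most `a * log y`. -/
lemma le_mul_log_of_pow_le {N a : ℕ} {y : ℝ} (h : (18 : ℝ) ^ N ≤ y ^ a) :
    (N : ℝ) ≤ a * Real.log y := by
  have h1 := Real.log_le_log (by positivity) h
  rw [Real.log_pow, Real.log_pow] at h1
  have h2 : (1 : ℝ) ≤ Real.log 18 := by
    rw [Real.le_log_iff_exp_le (by norm_num)]
    linarith [Real.exp_one_lt_d9]
  nlinarith [(Nat.cast_nonneg N : (0 : ℝ) ≤ N)]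

section CycleCount

variable {W : Type*} [Fintype W] {n k : ℕ} {q : I}

lemma pathsBetween_mono {G H : SimpleGraph W} (h : G ≤ H) {i : ℕ} {u w : W} :
    pathsBetween G i u w ⊆ pathsBetween H i u w := by
  intro p hp
  have hp := mem_pathsBetween.1 hp
  exact mem_pathsBetween.2 ⟨hp.1, fun l => h (hp.2.1 l), hp.2.2⟩

lemma card_pathsBetween_one_le {H : SimpleGraph W} {u w : W} :
    (pathsBetween H 1 u w).card ≤ 1 := by
  refine Finset.card_le_one.2 fun p hp p' hp' => ?_
  have hp := mem_pathsBetween.1 hp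
  have hp' := mem_pathsBetween.1 hp'
  ext x
  fin_cases x
  · exact hp.2.2.1.trans hp'.2.2.1.symm
  · exact hp.2.2.2.trans hp'.2.2.2.symm

variable {H : SimpleGraph W}

/-- The number of cycles when cycles are rare, so that they form small clusters. -/
lemma IsSparse.card_cycles_le_of_small (hs : IsSparse n q H) (hn : 0 < n) (hq : 0 < (q : ℝ))
    (hk : 2 ≤ k) (hsmall : 55 * ((k : ℝ) + 1) ^ 2 * ((n : ℝ) ^ k * (q : ℝ) ^ (k + 1)) ≤ 1)
    (hμ : 1 ≤ (n : ℝ) * q) {A : Finset (Fin (k + 1) → W)}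
    (hA : ∀ c, c ∈ A ↔ IsCopyMap (cycleGraph (k + 1)) H c) :
    (A.card : ℝ) ≤ (2 ^ 18) ^ (k + 1) * ((n : ℝ) * q) ^ (k + 1) := by
  classical
  have hk0 : (0 : ℝ) ≤ k := Nat.cast_nonneg k
  have hedges := ncard_edgeSet_cycleGraph hk
  obtain ⟨U, hU, hUc⟩ := hs.exists_cover hn hq (isBalanced_cycleGraph hk)
    (by rw [hedges]; exact hsmall)
  rw [hedges] at hUc
  set x : ℝ := (n : ℝ) ^ k * (q : ℝ) ^ (k + 1) with hx
  have hx0 : 0 < x := by positivity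
  have hx1 : x < 1 := by nlinarith
  obtain ⟨G, hGadj⟩ : ∃ G : SimpleGraph W, ∀ a b, G.Adj a b ↔ H.Adj a b ∧ a ∈ U ∧ b ∈ U := by
    refine ⟨SimpleGraph.fromEdgeSet {e | e ∈ H.edgeSet ∧ ∀ v ∈ e, v ∈ U}, fun a b => ?_⟩
    rw [SimpleGraph.fromEdgeSet_adj]
    simp only [Set.mem_ofPred_eq, SimpleGraph.mem_edgeSet, Sym2.mem_iff, forall_eq_or_imp,
      forall_eq]
    exact ⟨fun h => h.1, fun h => ⟨h, h.1.ne⟩⟩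
  have hGH : G ≤ H := fun a b h => ((hGadj a b).1 h).1
  have hGE : (G.edgeFinset : Set (Sym2 W)) ⊆ H.edgeSet := by
    rw [SimpleGraph.coe_edgeFinset]
    exact SimpleGraph.edgeSet_mono hGH
  have hend : endpoints G.edgeFinset ⊆ U := by
    intro v hv
    obtain ⟨e, he, hve⟩ := mem_endpoints.1 hv
    rw [SimpleGraph.mem_edgeFinset] at he
    obtain ⟨y, rfl⟩ := hve
    exact ((hGadj v y).1 he).2.1
  have hE : G.edgeFinset.card ≤ 2 * U.card := by
    have h1 := (hs.density hn hx1 _ hGE).trans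
      (Nat.mul_le_mul_left _ (Finset.card_le_card hend))
    have h2 : k * G.edgeFinset.card ≤ k * (2 * U.card) := by nlinarith
    exact Nat.le_of_mul_le_mul_left h2 (by omega)
  have hAG : ∀ c, c ∈ A ↔ IsCopyMap (cycleGraph (k + 1)) G c := by
    intro c
    rw [hA]
    constructor
    · intro hc
      exact ⟨hc.1, fun a b hab => (hGadj _ _).2 ⟨hc.2 a b hab, hU c hc a, hU c hc b⟩⟩
    · intro hc
      exact ⟨hc.1, fun a b hab => hGH (hc.2 a b hab)⟩
  have hX : ∀ u w, u ≠ w → ((pathsBetween G k u w).card : ℝ) ≤ 2 ^ (9 * k + 2) := by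
    intro u w _
    obtain ⟨i, rfl⟩ : ∃ i, k = i + 1 := ⟨k - 1, by omega⟩
    refine (Nat.cast_le.2 (Finset.card_le_card (pathsBetween_mono hGH))).trans
      ((hs.card_pathsBetween_le hn (i := i) ?_).trans_eq ?_)
    -- The hypothesis of the path bound is x²/(nq) < 1, where x < 1 ≤ nq.
    · have h1 : (n : ℝ) ^ (2 * i + 1) * (q : ℝ) ^ (2 * i + 3) * (n * q) = x * x := by
        rw [hx]
        ring
      have h2 : 0 ≤ (n : ℝ) ^ (2 * i + 1) * (q : ℝ) ^ (2 * i + 3) := by positivity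
      nlinarith
    · congr 1
  -- One edge, closed by a path with all the other k edges; since j = 0 the degree bound enters as
  -- D^0, so any valid D will do.
  have h1 := card_cycles_le (j := 0) (i := k) (by omega) (by omega) (by omega) hAG
    (D := (Fintype.card W : ℝ) + 1) (by positivity) (X := 2 ^ (9 * k + 2)) (by positivity)
    (fun c _ => by
      calc ∏ x, (G.degree (c x) : ℝ) ≤ ∏ _x : Fin (k + 1), ((Fintype.card W : ℝ) + 1) := by
            refine Finset.prod_le_prod (fun _ _ => by positivity) fun x _ => ?_
            exact_mod_cast (G.degree_lt_card_verts (c x)).le.trans (Nat.le_succ _)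
        _ = _ := by rw [Finset.prod_const, Finset.card_univ, Fintype.card_fin])
    hX
  have hE' : (G.edgeFinset.card : ℝ) ≤ 2 * U.card := by exact_mod_cast hE
  push_cast at hUc
  have hm1 : (k : ℝ) + 1 ≤ 2 ^ (k + 1) := by
    exact_mod_cast (Nat.lt_two_pow_self (n := k + 1)).le
  have hm2 : 1 + ((k : ℝ) + 1) ≤ 2 ^ (k + 1) := by
    have := Nat.succ_le_of_lt (Nat.lt_two_pow_self (n := k + 1))
    rw [add_comm]
    exact_mod_cast this
  have h8 : (8 : ℝ) ≤ 2 ^ (k + 1) := by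
    calc (8 : ℝ) = 2 ^ 3 := by norm_num
      _ ≤ 2 ^ (k + 1) := pow_le_pow_right₀ one_le_two (by omega)
  have h9 : (2 : ℝ) ^ (9 * k + 2) ≤ (2 ^ (k + 1)) ^ 9 := by
    rw [← pow_mul]
    exact pow_le_pow_right₀ one_le_two (by omega)
  have hsplit : ((2 : ℝ) ^ 18) ^ (k + 1) = (2 ^ (k + 1)) ^ 18 := by
    rw [← pow_mul, ← pow_mul, mul_comm]
  set t : ℝ := 2 ^ (k + 1) with ht
  calc (A.card : ℝ)
      ≤ (k + 1) * (((Fintype.card W : ℝ) + 1) ^ 0 * (2 * (G.edgeFinset.card : ℝ)) *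
        2 ^ (9 * k + 2)) := h1
    _ ≤ (k + 1) * (1 * (2 * (2 * (7 * ((k : ℝ) + 1) ^ 2 * (1 + ((k : ℝ) + 1)) *
        ((n : ℝ) ^ (k + 1) * (q : ℝ) ^ (k + 1))))) * t ^ 9) := by
        rw [pow_zero]
        gcongr
        exact hE'.trans (by gcongr)
    _ = 28 * ((k : ℝ) + 1) ^ 3 * (1 + ((k : ℝ) + 1)) * t ^ 9 * ((n : ℝ) * q) ^ (k + 1) := by
        rw [mul_pow]
        ring
    _ ≤ t ^ 2 * t ^ 3 * t * t ^ 9 * ((n : ℝ) * q) ^ (k + 1) := by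
        gcongr
        nlinarith
    _ = t ^ 15 * ((n : ℝ) * q) ^ (k + 1) := by ring
    _ ≤ t ^ 18 * ((n : ℝ) * q) ^ (k + 1) := by
        gcongr
        · linarith
        · norm_num
    _ = _ := by rw [hsplit]

variable [DecidableRel H.Adj]

/-- An edge bound for sparse graphs of large density. -/
lemma IsSparse.card_edgeFinset_le (hs : IsSparse n q H) (hn : 0 < n) (hq2 : (q : ℝ) ≤ 1 / 2)
    {y : ℝ} (hy : (n : ℝ) * q ≤ y) (hny : (n : ℝ) ≤ y ^ 2) :
    (H.edgeFinset.card : ℝ) ≤ 3 * y ^ 2 := by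
  classical
  have hq : (0 : ℝ) ≤ q := q.2.1
  have hE : (H.edgeFinset : Set (Sym2 W)) ⊆ H.edgeSet := by
    rw [SimpleGraph.coe_edgeFinset]
  have hend : (endpoints H.edgeFinset).card ≤ n := (Finset.card_le_univ _).trans hs.card_le
  by_cases h3 : (n : ℝ) ^ 1 * (q : ℝ) ^ 3 < 1
  · have h1 := (hs.density hn h3 _ hE).trans (Nat.mul_le_mul_left _ hend)
    have h2 : (H.edgeFinset.card : ℝ) ≤ 3 * n := by
      rw [one_mul] at h1
      exact_mod_cast h1
    linarith
  push Not at h3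
  set l := Nat.log 2 n + 1 with hl
  have hnl : n < 2 ^ l := Nat.lt_pow_succ_log_self one_lt_two n
  have hln : 2 ^ l ≤ 2 * n := by
    rw [hl, pow_succ, mul_comm]
    exact Nat.mul_le_mul_left 2 (Nat.pow_log_le_self 2 hn.ne')
  have h1 : (n : ℝ) ^ 1 * (q : ℝ) ^ l < 1 := by
    calc (n : ℝ) ^ 1 * (q : ℝ) ^ l ≤ n * (1 / 2) ^ l := by rw [pow_one]; gcongr
      _ < 2 ^ l * (1 / 2) ^ l := by
          gcongr
          exact_mod_cast hnl
      _ = 1 := by rw [← mul_pow]; norm_num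
  have h2 := (hs.density hn h1 _ hE).trans (Nat.mul_le_mul_left _ hend)
  rw [one_mul] at h2
  -- The logarithmic density loses only n^(1/3), which n q^3 ≥ 1 absorbs: n^4 ≤ n^4 (n q^3)^2 =
  -- (nq)^6.
  have h4 : H.edgeFinset.card ^ 3 ≤ 8 * n ^ 4 := by
    have hl3 : l ^ 3 ≤ 8 * n := by
      have := pow_three_le_four_mul_two_pow l
      linarith
    calc H.edgeFinset.card ^ 3 ≤ (l * n) ^ 3 := Nat.pow_le_pow_left h2 3
      _ = l ^ 3 * n ^ 3 := by ring
      _ ≤ (8 * n) * n ^ 3 := Nat.mul_le_mul_right _ hl3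
      _ = _ := by ring
  have h5 : (n : ℝ) ^ 4 ≤ (y ^ 2) ^ 3 := by
    calc (n : ℝ) ^ 4 ≤ n ^ 4 * ((n : ℝ) ^ 1 * (q : ℝ) ^ 3) ^ 2 :=
          le_mul_of_one_le_right (by positivity) (one_le_pow₀ h3)
      _ = (n * q) ^ 6 := by ring
      _ ≤ y ^ 6 := by gcongr
      _ = _ := by ring
  have h6 : (H.edgeFinset.card : ℝ) ^ 3 ≤ (2 * y ^ 2) ^ 3 := by
    calc (H.edgeFinset.card : ℝ) ^ 3 ≤ 8 * n ^ 4 := by exact_mod_cast h4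
      _ ≤ 8 * (y ^ 2) ^ 3 := by gcongr
      _ = _ := by ring
  have h7 := le_of_pow_le_pow_left₀ (by norm_num) (by positivity) h6
  nlinarith [sq_nonneg y]

end CycleCount

section CycleCount

variable {W : Type*} [Fintype W] {n k : ℕ} {q : I} {H : SimpleGraph W}

/-- The number of cycles when cycles are not rare. -/
lemma IsSparse.card_cycles_le_of_large (hs : IsSparse n q H) (hn : 0 < n)
    (hq18 : 18 * (q : ℝ) ≤ 1)
    (hk : 2 ≤ k) (hlarge : 1 < 55 * ((k : ℝ) + 1) ^ 2 * ((n : ℝ) ^ k * (q : ℝ) ^ (k + 1)))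
    (hμ : 1 ≤ (n : ℝ) * q) {A : Finset (Fin (k + 1) → W)}
    (hA : ∀ c, c ∈ A ↔ IsCopyMap (cycleGraph (k + 1)) H c) :
    (A.card : ℝ) ≤ (2 ^ 13) ^ (k + 1) * (18 * ((n : ℝ) * q)) ^ (k + 1) := by
  classical
  have hn0 : (0 : ℝ) < n := by exact_mod_cast hn
  have hq0 : (0 : ℝ) ≤ q := q.2.1
  set y : ℝ := 18 * ((n : ℝ) * q) with hy
  have hy18 : 18 ≤ y := by linarith
  have hy0 : 0 < y := by linarith
  have hμy : (n : ℝ) * q < y := by linarith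
  have hyn : y ≤ n := by nlinarith
  have hyk : (n : ℝ) < y ^ (k + 1) := by
    have h1 : 55 * ((k : ℝ) + 1) ^ 2 ≤ 18 ^ (k + 1) := by
      exact_mod_cast le_eighteen_pow (show 3 ≤ k + 1 by omega)
    calc (n : ℝ) = n * 1 := (mul_one _).symm
      _ < n * (55 * ((k : ℝ) + 1) ^ 2 * ((n : ℝ) ^ k * (q : ℝ) ^ (k + 1))) := by gcongr
      _ = 55 * ((k : ℝ) + 1) ^ 2 * ((n : ℝ) * q) ^ (k + 1) := by rw [mul_pow]; ring
      _ ≤ 18 ^ (k + 1) * ((n : ℝ) * q) ^ (k + 1) := by gcongr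
      _ = y ^ (k + 1) := by rw [hy, mul_pow 18]
  have hex : ∃ i, (n : ℝ) < y ^ (i + 1) := ⟨k, hyk⟩
  -- This i is the natural length of the closing path: y^i ≤ n keeps such paths few, and n < y^(i+1)
  -- lets y^(i+1) pay for the linearly many edges.
  obtain ⟨i, hi, hmin⟩ : ∃ i, (n : ℝ) < y ^ (i + 1) ∧ ∀ j < i, ¬ (n : ℝ) < y ^ (j + 1) :=
    ⟨Nat.find hex, Nat.find_spec hex, fun j hj => Nat.find_min hex hj⟩
  have hik : i ≤ k := by
    by_contra! h
    exact hmin k h hyk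
  have hi1 : 1 ≤ i := by
    by_contra! h
    rw [Nat.lt_one_iff.1 h, zero_add, pow_one] at hi
    linarith
  have hiy : y ^ i ≤ n := by
    have := hmin (i - 1) (by omega)
    rwa [Nat.sub_add_cancel hi1, not_lt] at this
  have hdeg : ∀ c ∈ A, ∏ x, (H.degree (c x) : ℝ) ≤ y ^ (k + 1) := fun c hc =>
    hs.prod_degree_cycle_le hn hk ((hA c).1 hc)
  have hcount : ∀ X : ℝ, 0 ≤ X → (∀ u w, u ≠ w → ((pathsBetween H i u w).card : ℝ) ≤ X) →
      (A.card : ℝ) ≤ (k + 1) * (y ^ (k - i) * (2 * (H.edgeFinset.card : ℝ)) * X) :=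
    fun X hX0 hX => card_cycles_le hi1 (Nat.sub_add_cancel hik) (by omega) hA hy0 hX0 hdeg hX
  have hm1 : (k : ℝ) + 1 ≤ 2 ^ (k + 1) := by
    exact_mod_cast (Nat.lt_two_pow_self (n := k + 1)).le
  have h8 : (8 : ℝ) ≤ 2 ^ (k + 1) := by
    calc (8 : ℝ) = 2 ^ 3 := by norm_num
      _ ≤ 2 ^ (k + 1) := pow_le_pow_right₀ one_le_two (by omega)
  have hsplit : ((2 : ℝ) ^ 13) ^ (k + 1) = (2 ^ (k + 1)) ^ 13 := by
    rw [← pow_mul, ← pow_mul, mul_comm]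
  have h9 : (2 : ℝ) ^ (9 * i + 2) ≤ (2 ^ (k + 1)) ^ 9 := by
    rw [← pow_mul]
    exact pow_le_pow_right₀ one_le_two (by omega)
  have hypow : y ^ (k - i) * y ^ (i + 1) = y ^ (k + 1) := by
    rw [← pow_add]
    congr 1
    omega
  set t : ℝ := 2 ^ (k + 1) with ht
  have ht1 : 1 ≤ t := by linarith
  rw [hsplit]
  rcases Nat.lt_or_ge i 2 with hi2 | hi2
  · obtain rfl : i = 1 := by omega
    have hE := hs.card_edgeFinset_le hn (by linarith) hμy.le hi.le
    have h1 := hcount 1 zero_le_one fun u w _ => by exact_mod_cast card_pathsBetween_one_le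
    calc (A.card : ℝ) ≤ (k + 1) * (y ^ (k - 1) * (2 * (H.edgeFinset.card : ℝ)) * 1) := h1
      _ ≤ t * (y ^ (k - 1) * (2 * (3 * y ^ 2)) * 1) := by gcongr
      _ = t * 6 * (y ^ (k - 1) * y ^ (1 + 1)) := by ring
      _ = t * 6 * y ^ (k + 1) := by rw [hypow]
      _ ≤ t * t * y ^ (k + 1) := by
          gcongr
          linarith
      _ = t ^ 2 * y ^ (k + 1) := by ring
      _ ≤ t ^ 13 * y ^ (k + 1) := by
          gcongr
          norm_num
  obtain ⟨a, rfl⟩ : ∃ a, i = a + 2 := ⟨i - 2, by omega⟩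
  have hE : (H.edgeFinset.card : ℝ) ≤ 2 * n := by
    have h1 : (n : ℝ) ^ 1 * (q : ℝ) ^ 2 < 1 := by
      have h2 : (n : ℝ) * ((n : ℝ) ^ 1 * (q : ℝ) ^ 2) < n * 1 := by
        calc (n : ℝ) * ((n : ℝ) ^ 1 * (q : ℝ) ^ 2) = (n * q) ^ 2 := by ring
          _ < y ^ 2 := by gcongr
          _ ≤ y ^ (a + 2) := pow_le_pow_right₀ (by linarith) (by omega)
          _ ≤ n * 1 := by linarith
      exact lt_of_mul_lt_mul_left h2 hn0.le
    have h2 := (hs.density hn h1 H.edgeFinset (by rw [SimpleGraph.coe_edgeFinset])).trans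
      (Nat.mul_le_mul_left _ ((Finset.card_le_univ _).trans hs.card_le))
    rw [one_mul] at h2
    exact_mod_cast h2
  -- With i = a+2, the condition y^(2i+1) ≤ n² is what applies the path bound at length i.
  by_cases hcase : y ^ (2 * (a + 2) + 1) ≤ (n : ℝ) ^ 2
  · have hX : ∀ u w, u ≠ w → ((pathsBetween H (a + 2) u w).card : ℝ) ≤ t ^ 9 := by
      intro u w _
      refine (hs.card_pathsBetween_le hn (i := a + 1) ?_).trans (le_trans (le_of_eq ?_) h9)
      · have h2 : (n : ℝ) ^ 2 * ((n : ℝ) ^ (2 * (a + 1) + 1) * (q : ℝ) ^ (2 * (a + 1) + 3)) <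
            n ^ 2 * 1 := by
          calc (n : ℝ) ^ 2 * ((n : ℝ) ^ (2 * (a + 1) + 1) * (q : ℝ) ^ (2 * (a + 1) + 3))
              = (n * q) ^ (2 * (a + 2) + 1) := by ring
            _ < y ^ (2 * (a + 2) + 1) := pow_lt_pow_left₀ hμy (by positivity) (by omega)
            _ ≤ n ^ 2 * 1 := by linarith
        exact lt_of_mul_lt_mul_left h2 (by positivity)
      · congr 1
    calc (A.card : ℝ)
        ≤ (k + 1) * (y ^ (k - (a + 2)) * (2 * (H.edgeFinset.card : ℝ)) * t ^ 9) :=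
          hcount _ (by positivity) hX
      _ ≤ t * (y ^ (k - (a + 2)) * (2 * (2 * y ^ (a + 2 + 1))) * t ^ 9) := by
          gcongr
          linarith
      _ = 4 * t ^ 10 * (y ^ (k - (a + 2)) * y ^ (a + 2 + 1)) := by ring
      _ = 4 * t ^ 10 * y ^ (k + 1) := by rw [hypow]
      _ ≤ t * t ^ 10 * y ^ (k + 1) := by
          gcongr
          linarith
      _ = t ^ 11 * y ^ (k + 1) := by ring
      _ ≤ t ^ 13 * y ^ (k + 1) := by
          gcongr
          norm_num
  -- Now n lies between y^i and y^(i+1/2). The path bound still applies at length i−1, and one more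
  -- edge costs a logarithmic factor, paid for by n being a factor √y below y^(i+1).
  push Not at hcase
  have hlog := Real.log_nonneg (show 1 ≤ y by linarith)
  have hshort : ∀ x w : W, x ≠ w → ((pathsBetween H (a + 1) x w).card : ℝ) ≤ t ^ 9 := by
    intro x w _
    refine (hs.card_pathsBetween_le hn (i := a) ?_).trans (le_trans ?_ h9)
    · have h2 : (n : ℝ) ^ 2 * ((n : ℝ) ^ (2 * a + 1) * (q : ℝ) ^ (2 * a + 3)) <
          n ^ 2 * 1 := by
        calc (n : ℝ) ^ 2 * ((n : ℝ) ^ (2 * a + 1) * (q : ℝ) ^ (2 * a + 3))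
            = (n * q) ^ (2 * a + 3) := by ring
          _ < y ^ (2 * a + 3) := pow_lt_pow_left₀ hμy (by positivity) (by omega)
          _ ≤ y ^ ((a + 2) * 2) := pow_le_pow_right₀ (by linarith) (by omega)
          _ = (y ^ (a + 2)) ^ 2 := pow_mul _ _ _
          _ ≤ n ^ 2 := by gcongr
          _ = n ^ 2 * 1 := (mul_one _).symm
      exact lt_of_mul_lt_mul_left h2 (by positivity)
    · exact pow_le_pow_right₀ one_le_two (by omega)
  have hX : ∀ u w, u ≠ w → ((pathsBetween H (a + 2) u w).card : ℝ) ≤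
      2 * t * Real.log y * t ^ 9 := by
    intro u w _
    -- With κ = 18 the left side is exactly y^i/n; the constant in y leaves room for a base κ larger
    -- than 1.
    have h2 : (18 : ℝ) ^ (a + 1 + 1) * ((n : ℝ) ^ (a + 1) * (q : ℝ) ^ (a + 1 + 1)) ≤ 1 := by
      have h3 : (n : ℝ) * ((18 : ℝ) ^ (a + 1 + 1) * ((n : ℝ) ^ (a + 1) * (q : ℝ) ^ (a + 1 + 1))) ≤
          n * 1 := by
        calc (n : ℝ) * ((18 : ℝ) ^ (a + 1 + 1) * ((n : ℝ) ^ (a + 1) * (q : ℝ) ^ (a + 1 + 1)))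
            = y ^ (a + 2) := by
              rw [hy, mul_pow 18, mul_pow]
              ring
          _ ≤ n * 1 := by linarith
      exact le_of_mul_le_mul_left h3 hn0
    obtain ⟨e, he, hcard⟩ := hs.exists_card_pathsBetween_le hn (i := a + 1) (by omega)
      (κ := 18) (by norm_num) h2 (X := t ^ 9) (by positivity) (u := u) (w := w)
      (fun x hx => hshort x w hx)
    refine hcard.trans ?_
    gcongr
    refine (le_mul_log_of_pow_le (he.trans hcase.le)).trans ?_
    gcongr
    have : ((2 * (a + 2) + 1 : ℕ) : ℝ) ≤ 2 * ((k : ℝ) + 1) := by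
      exact_mod_cast (by omega : 2 * (a + 2) + 1 ≤ 2 * (k + 1))
    linarith
  have hnlog : (n : ℝ) * Real.log y ≤ 2 * y ^ (a + 2 + 1) := by
    refine le_of_pow_le_pow_left₀ (n := 2) (by norm_num) (by positivity) ?_
    calc ((n : ℝ) * Real.log y) ^ 2 = n ^ 2 * Real.log y ^ 2 := by ring
      _ ≤ y ^ (2 * (a + 2) + 1) * (4 * y) := by
          gcongr
          exact log_sq_le (by linarith)
      _ = _ := by ring
  calc (A.card : ℝ)
      ≤ (k + 1) * (y ^ (k - (a + 2)) * (2 * (H.edgeFinset.card : ℝ)) *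
          (2 * t * Real.log y * t ^ 9)) := hcount _ (by positivity) hX
    _ ≤ t * (y ^ (k - (a + 2)) * (2 * (2 * n)) * (2 * t * Real.log y * t ^ 9)) := by gcongr
    _ = 8 * t ^ 11 * (y ^ (k - (a + 2)) * (n * Real.log y)) := by ring
    _ ≤ 8 * t ^ 11 * (y ^ (k - (a + 2)) * (2 * y ^ (a + 2 + 1))) := by gcongr
    _ = 16 * t ^ 11 * (y ^ (k - (a + 2)) * y ^ (a + 2 + 1)) := by ring
    _ = 16 * t ^ 11 * y ^ (k + 1) := by rw [hypow]
    _ ≤ t ^ 2 * t ^ 11 * y ^ (k + 1) := by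
        gcongr
        nlinarith
    _ = _ := by ring

/-! ### Comparison with the expectation and the theorem -/

lemma copyCount_le_card {X : Type*} [Fintype X] {F : SimpleGraph X} {A : Finset (X → W)}
    (hA : ∀ c, c ∈ A ↔ IsCopyMap F H c) : H.copyCount F ≤ A.card := by
  classical
  refine SimpleGraph.copyCount_le_labelledCopyCount.trans ?_
  have h : ∀ f : F.Copy H, (f : X → W) ∈ A := fun f =>
    (hA _).2 ⟨f.injective, fun x y h => f.toHom.map_adj h⟩
  have := Fintype.card_le_of_injective (fun f : F.Copy H => (⟨f, h f⟩ : A))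
    fun f g hfg => DFunLike.coe_injective (congrArg Subtype.val hfg)
  rwa [Fintype.card_coe] at this

/-- With K = k+1, K^K ≤ e^K K! costs 4^K in passing to the falling factorial, and the labellings
K·2^K of one cycle cost another 4^K. -/
lemma pow_le_copyCount_cycleGraph {n k : ℕ} (hk : 2 ≤ k) (hkn : k + 1 ≤ n) :
    (n : ℝ) ^ (k + 1) ≤ (2 ^ 4) ^ (k + 1) *
      ((⊤ : SimpleGraph (Fin n)).copyCount (cycleGraph (k + 1)) : ℝ) := by
  have h1 : ((n ^ (k + 1) * (k + 1).factorial : ℕ) : ℝ) ≤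
      (((k + 1) ^ (k + 1) * n.descFactorial (k + 1) : ℕ) : ℝ) :=
    Nat.cast_le.2 (pow_mul_factorial_le hkn)
  have h2 := pow_self_le_exp_mul_factorial (k + 1)
  have h3 : (n.descFactorial (k + 1) : ℝ) ≤
      ((⊤ : SimpleGraph (Fin n)).copyCount (cycleGraph (k + 1)) : ℝ) *
        (((k : ℝ) + 1) * 2 ^ (k + 1)) := by
    exact_mod_cast descFactorial_le_copyCount_cycleGraph hk n
  have h4 : (k : ℝ) + 1 ≤ 2 ^ (k + 1) := by
    exact_mod_cast (Nat.lt_two_pow_self (n := k + 1)).le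
  push_cast at h1 h2
  set N : ℝ := ((⊤ : SimpleGraph (Fin n)).copyCount (cycleGraph (k + 1)) : ℝ) with hN
  have hfac : (0 : ℝ) < (k + 1).factorial := by exact_mod_cast Nat.factorial_pos _
  have h5 : (n : ℝ) ^ (k + 1) ≤ 4 ^ (k + 1) * n.descFactorial (k + 1) := by
    refine le_of_mul_le_mul_right ?_ hfac
    calc (n : ℝ) ^ (k + 1) * (k + 1).factorial
        ≤ ((k : ℝ) + 1) ^ (k + 1) * n.descFactorial (k + 1) := h1
      _ ≤ (Real.exp 1 ^ (k + 1) * (k + 1).factorial) * n.descFactorial (k + 1) := by gcongr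
      _ ≤ (4 ^ (k + 1) * (k + 1).factorial) * n.descFactorial (k + 1) := by
          gcongr
          linarith [Real.exp_one_lt_d9]
      _ = _ := by ring
  calc (n : ℝ) ^ (k + 1) ≤ 4 ^ (k + 1) * (N * (2 ^ (k + 1) * 2 ^ (k + 1))) :=
        h5.trans (by gcongr; exact h3.trans (by gcongr))
    _ = (4 * (2 * 2)) ^ (k + 1) * N := by simp only [mul_pow]; ring
    _ = _ := by norm_num

/-- The cycle case: a `q`-sparse graph has fewer cycles than expected in `G_{n,p}`. -/
theorem IsSparse.copyCount_cycleGraph_lt {p : I} {L : ℝ} (hL : 2 ^ 24 ≤ L) (hs : IsSparse n q H)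
    (hq : 0 < (q : ℝ)) (hp : (p : ℝ) = L * q) {m : ℕ} (hm : 3 ≤ m) (hmn : m ≤ n) :
    (H.copyCount (cycleGraph m) : ℝ) < expectedCopies n p (cycleGraph m) := by
  classical
  obtain ⟨k, rfl⟩ : ∃ k, m = k + 1 := ⟨m - 1, by omega⟩
  have hk : 2 ≤ k := by omega
  have hn : 0 < n := by omega
  have hn0 : (0 : ℝ) < n := by exact_mod_cast hn
  -- From p = Lq ≤ 1 and L large.
  have hq18 : 18 * (q : ℝ) ≤ 1 := by
    have := p.2.2
    nlinarith
  set A : Finset (Fin (k + 1) → W) :=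
    Finset.univ.filter fun c => IsCopyMap (cycleGraph (k + 1)) H c with hAdef
  have hA : ∀ c, c ∈ A ↔ IsCopyMap (cycleGraph (k + 1)) H c := by simp [hAdef]
  have hNA : H.copyCount (cycleGraph (k + 1)) ≤ A.card := copyCount_le_card hA
  have hupper : (A.card : ℝ) ≤ (2 ^ 18) ^ (k + 1) * ((n : ℝ) * q) ^ (k + 1) := by
    rcases A.eq_empty_or_nonempty with h0 | ⟨c, hc⟩
    · rw [h0]
      simp only [Finset.card_empty, Nat.cast_zero]
      positivity
    have hμ := hs.one_le_of_cycle hn hk ((hA c).1 hc)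
    rcases le_or_gt (55 * ((k : ℝ) + 1) ^ 2 * ((n : ℝ) ^ k * (q : ℝ) ^ (k + 1))) 1 with h | h
    · exact hs.card_cycles_le_of_small hn hq hk h hμ hA
    · refine (hs.card_cycles_le_of_large hn hq18 hk h hμ hA).trans ?_
      rw [mul_pow 18, ← mul_assoc, ← mul_pow]
      gcongr
      norm_num
  have hlower := pow_le_copyCount_cycleGraph hk hmn
  have hpos : (0 : ℝ) < (⊤ : SimpleGraph (Fin n)).copyCount (cycleGraph (k + 1)) := by
    have : (0 : ℝ) < (n : ℝ) ^ (k + 1) := by positivity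
    exact pos_of_mul_pos_right (this.trans_le hlower) (by positivity)
  rw [expectedCopies_eq, ncard_edgeSet_cycleGraph hk, hp]
  set N : ℝ := ((⊤ : SimpleGraph (Fin n)).copyCount (cycleGraph (k + 1)) : ℝ) with hN
  calc (H.copyCount (cycleGraph (k + 1)) : ℝ) ≤ A.card := by exact_mod_cast hNA
    _ ≤ (2 ^ 18) ^ (k + 1) * ((n : ℝ) * q) ^ (k + 1) := hupper
    _ = (2 ^ 18) ^ (k + 1) * ((n : ℝ) ^ (k + 1) * q ^ (k + 1)) := by rw [mul_pow (n : ℝ)]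
    _ ≤ (2 ^ 18) ^ (k + 1) * (((2 ^ 4) ^ (k + 1) * N) * q ^ (k + 1)) := by gcongr
    _ = (2 ^ 18 * 2 ^ 4) ^ (k + 1) * (N * q ^ (k + 1)) := by
        rw [mul_pow (2 ^ 18)]
        ring
    _ < L ^ (k + 1) * (N * q ^ (k + 1)) := by
        gcongr
        linarith
    _ = N * (L * q) ^ (k + 1) := by
        rw [mul_pow L]
        ring

end CycleCount

lemma expectedCopies_congr {n : ℕ} {p : I} {U U' : Type*} {F : SimpleGraph U}
    {F' : SimpleGraph U'} (e : F ≃g F') : expectedCopies n p F = expectedCopies n p F' := by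
  unfold expectedCopies
  simp only [copyCount_congr _ e]

end CopyThreshold

theorem theorem1p3 :
    ∃ L : ℝ, 0 < L ∧
      ∀ (n : ℕ) (q p : I), 0 < q → (p : ℝ) = L * (q : ℝ) →
      ∀ {W : Type*} [Fintype W] (H : SimpleGraph W), CopyThreshold.IsSparse n q H →
      ∀ {U : Type*} (F : SimpleGraph U) (k : ℕ), 2 ≤ k → k ≤ n →
        (CopyThreshold.IsCliqueOfOrder F k ∨ CopyThreshold.IsCycleOfOrder F k) →
        (SimpleGraph.copyCount H F : ℝ) < CopyThreshold.expectedCopies n p F := by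
  -- Cycles lose 2^18 · 2^4 per edge and cliques 2^18 · 2^2; `2 ^ 24` exceeds both.
  refine ⟨2 ^ 24, by positivity, fun n q p hq hp W _ H hs U F k hk hkn hF => ?_⟩
  have hq0 : 0 < (q : ℝ) := hq
  rcases hF with ⟨⟨e⟩⟩ | ⟨hk3, ⟨e⟩⟩
  · rw [CopyThreshold.copyCount_congr _ e, CopyThreshold.expectedCopies_congr e]
    exact hs.copyCount_completeGraph_lt (by norm_num) hq0 hp hk hkn
  · rw [CopyThreshold.copyCount_congr _ e, CopyThreshold.expectedCopies_congr e]
    exact hs.copyCount_cycleGraph_lt le_rfl hq0 hp hk3 hkn
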